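/- **Lemma 4.4.** Let $d\ge 3$, $m\ge 1$, and let $A=(a_{ij}^{\alpha\beta})$, $V=(V_i^{\alpha\beta})$, $B=(B_i^{\alpha\beta})$, $c=(c^{\alpha\beta})$ ($1\le i,j\le d$, $1\le\alpha,\beta\le m$) be real, measurable, $\mathbb Z^d$-periodic functions on $\mathbb R^d$ with $$\mu|\xi|^2\le a_{ij}^{\alpha\beta}(y)\xi_i^\alpha\xi_j^\beta\le\mu^{-1}|\xi|^2\quad(\xi\in\mathbb R^{md}),\qquad |a_{ij}^{\alpha\beta}|,|V_i^{\alpha\beta}|,|B_i^{\alpha\beta}|,|c^{\alpha\beta}|\le\kappa$$ for almost every $y$, where $\mu,\kappa>0$ (repeated indices are summed). Let $Y=(0,1]^d$. *Correctors and auxiliary functions.* Let $\chi_k=(\chi_k^{\beta\gamma})\in H^1_{per}(Y;\mathbb R^{m^2})$, $0\le k\le d$, be the correctors: $\int_Y\chi_k=0$, $-\mathrm{div}(A\nabla\chi_0)=\mathrm{div}(V)$, and $-\mathrm{div}\big(A\nabla(\chi_k^\gamma+y_ke^\gamma)\big)=0$ for $1\le k\le d$, $1\le\gamma\le m$ (weakly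 in $\mathbb R^d$), $e^\gamma$ being the standard basis of $\mathbb R^m$. Put $$\hat a_{ik}^{\alpha\gamma}=\int_Y\Big[a_{ik}^{\alpha\gamma}+a_{ij}^{\alpha\beta}\tfrac{\partial\chi_k^{\beta\gamma}}{\partial y_j}\Big],\quad \hat V_i^{\alpha\gamma}=\int_Y\Big[V_i^{\alpha\gamma}+a_{ij}^{\alpha\beta}\tfrac{\partial\chi_0^{\beta\gamma}}{\partial y_j}\Big],\quad \hat B_i^{\alpha\gamma}=\int_Y\Big[B_i^{\alpha\gamma}+B_j^{\alpha\beta}\tfrac{\partial\chi_i^{\beta\gamma}}{\partial y_j}\Big],\quad \hat c^{\alpha\gamma}=\int_Y\Big[c^{\alpha\gamma}+B_j^{\alpha\beta}\tfrac{\partial\chi_0^{\beta\gamma}}{\partial y_j}\Big].$$ Let $b_{i0}^{\alpha\gamma}=\hat V_i^{\alpha\gamma}-V_i^{\alpha\gamma}-a_{ij}^{\alpha\beta}\partial_j\chi_0^{\beta\gamma}$ and $b_{ik}^{\alpha\gamma}=\hat a_{ik}^{\alpha\gamma}-a_{ik}^{\alpha\gamma}-a_{ij}^{\alpha\beta}\partial_j\chi_k^{\beta\gamma}$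 for $1\le k\le d$; let $W_0^{\alpha\gamma}=\hat c^{\alpha\gamma}-c^{\alpha\gamma}-B_j^{\alpha\beta}\partial_j\chi_0^{\beta\gamma}$ and $W_k^{\alpha\gamma}=\hat B_k^{\alpha\gamma}-B_k^{\alpha\gamma}-B_j^{\alpha\beta}\partial_j\chi_k^{\beta\gamma}$ for $1\le k\le d$. Let $\theta_{ik}^{\alpha\gamma}$ and $\vartheta_k^{\alpha\gamma}$ be the periodic $H^2_{loc}(\mathbb R^d)$ solutions with mean value zero over $Y$ of $\Delta\theta_{ik}^{\alpha\gamma}=b_{ik}^{\alpha\gamma}$ and $\Delta\vartheta_k^{\alpha\gamma}=W_k^{\alpha\gamma}$, and let $E_{jik}^{\alpha\gamma}=\partial_j\theta_{ik}^{\alpha\gamma}-\partial_i\theta_{jk}^{\alpha\gamma}$ be the (skew-symmetric in $i,j$) flux correctors. Let $h$ be the periodic function on $\mathbb R^d$ that is the sum of the absolute values of all the entries of $A,V,B,c$ and of $\chi_k,b_{ik},E_{jik},\nabla\vartheta_k$ ($0\le k\le d$), and write $h_\varepsilon(x)=h(x/\varepsilon)$. *Equations.* For a bounded Lipschitz domain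 $\Omega\subset\mathbb R^d$, $\lambda\ge0$ and $\varepsilon>0$ let $$\mathrm B_\varepsilon[u,v]=\int_\Omega\Big\{a_{ij}^{\alpha\beta}(x/\varepsilon)\frac{\partial u^\beta}{\partial x_j}+V_i^{\alpha\beta}(x/\varepsilon)u^\beta\Big\}\frac{\partial v^\alpha}{\partial x_i}\,dx+\int_\Omega\Big\{B_i^{\alpha\beta}(x/\varepsilon)\frac{\partial u^\beta}{\partial x_i}+c^{\alpha\beta}(x/\varepsilon)u^\beta+\lambda u^\alpha\Big\}v^\alpha\,dx$$ for $u,v\in H^1(\Omega;\mathbb R^m)$, and let $\mathrm B_0$ be the same form with the constant coefficients $\hat A,\hat V,\hat B,\hat c$. For $r>0$ let $\Sigma_r=\{x\in\Omega:\mathrm{dist}(x,\partial\Omega)>r\}$. *Claim.* There is $\lambda_0\ge0$, depending only on $\mu,\kappa,m,d$, such that for every $\lambda\ge\lambda_0$ and every bounded Lipschitz domain $\Omega$ there is a constant $C$, depending only on $\mu,\kappa,\lambda,m,d$ and $\Omega$, with the following property. Let the coefficients be as above, let $\varepsilon>0$, and let $u_\varepsilon,u_0\in H^1(\Omega;\mathbb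 R^m)$ satisfy $\mathcal L_\varepsilon(u_\varepsilon)=\mathcal L_0(u_0)$ in $\Omega$ and $\mathcal B_\varepsilon(u_\varepsilon)=\mathcal B_0(u_0)$ on $\partial\Omega$ in the weak sense, that is, $\mathrm B_\varepsilon[u_\varepsilon,v]=\mathrm B_0[u_0,v]$ for all $v\in H^1(\Omega;\mathbb R^m)$. For arbitrary $\varphi_k=(\varphi_k^\gamma)\in H^1(\mathbb R^d;\mathbb R^m)$, $0\le k\le d$, put $\vec\varphi=(\varphi_1,\dots,\varphi_d)$, $\vec\phi=(\varphi_0,\vec\varphi)$ and $$w_\varepsilon^\beta=u_\varepsilon^\beta-u_0^\beta-\varepsilon\sum_{k=0}^d\chi_k^{\beta\gamma}(x/\varepsilon)\,\varphi_k^\gamma .$$ Then $$\|w_\varepsilon\|_{H^1(\Omega)}\le C\Big\{\|h_\varepsilon\vec\phi\|_{L^2(\Omega\setminus\Sigma_{2\varepsilon})}+\|\nabla u_0-\vec\varphi\|_{L^2(\Omega)}+\|u_0-\varphi_0\|_{L^2(\Omega)}+\varepsilon\|h_\varepsilon\nabla\vec\phi\|_{L^2(\Omega)}+\varepsilon\|h_\varepsilon\vec\phi\|_{L^2(\Omega)}\Big\}+C\varepsilon\|h_\varepsilon\vec\phi\|_{L^2(\partial\Omega)}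 .$$ On $\partial\Omega$ the functions are understood as traces, and there only the part $h=\sum_{k}|\nabla\vartheta_k|$ (sum of the absolute values of the entries) of the weight is needed. Norms take values in $[0,\infty]$; in particular $w_\varepsilon\in H^1(\Omega;\mathbb R^m)$ whenever the right-hand side is finite. -/

import Mathlib

open MeasureTheory Set Filter Topology
open scoped ENNReal NNReal ContDiff RealInnerProductSpace

noncomputable section

namespace NeumannHomogenization

/-- Euclidean space `ℝ^d`. -/
abbrev E (d : ℕ) : Type := EuclideanSpace ℝ (Fin d)

/-! ### Domains -/

/-- Bounded Lipschitz domain: a bounded open set which, near each boundary point, is the region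
above the graph of a Lipschitz function in some rotated coordinate system; the last coordinate is
`⟪x, e⟫` and the remaining ones are given by the projection of `x` to the hyperplane orthogonal
to `e`. Connectedness is not required. -/
structure IsBoundedLipschitzDomain {d : ℕ} (Ω : Set (E d)) : Prop where
  isOpen : IsOpen Ω
  isBounded : Bornology.IsBounded Ω
  graph : ∀ P ∈ frontier Ω, ∃ (e : E d) (r : ℝ) (K : ℝ≥0) (f : E d → ℝ),
    ‖e‖ = 1 ∧ 0 < r ∧ LipschitzWith K f ∧
      ∀ x ∈ Metric.ball P r, x ∈ Ω ↔ f (x - ⟪x, e⟫ • e) < ⟪x, e⟫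

/-- `Σ_r = {x ∈ Ω : dist(x, ∂Ω) > r}`; the boundary layer is `Ω \ Σ_r`. -/
def innerRegion {d : ℕ} (Ω : Set (E d)) (r : ℝ) : Set (E d) :=
  {x ∈ Ω | r < Metric.infDist x (frontier Ω)}

/-- The surface measure on `∂Ω`: normalized `(d-1)`-dimensional Hausdorff measure. -/
def surfaceMeasure {d : ℕ} (Ω : Set (E d)) : Measure (E d) :=
  (Measure.euclideanHausdorffMeasure (d - 1)).restrict (frontier Ω)

/-! ### Sobolev functions -/

/-- `i`-th partial derivative of a smooth function. -/
def partialDeriv {d : ℕ} (i : Fin d) (ψ : E d → ℝ) (x : E d) : ℝ :=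
  fderiv ℝ ψ x (EuclideanSpace.single i 1)

/-- `g` is the weak `i`-th partial derivative of `u` in `Ω`. -/
def HasWeakPartial {d : ℕ} (Ω : Set (E d)) (i : Fin d) (u g : E d → ℝ) : Prop :=
  LocallyIntegrableOn u Ω ∧ LocallyIntegrableOn g Ω ∧
    ∀ ψ : E d → ℝ, ContDiff ℝ ∞ ψ → HasCompactSupport ψ → tsupport ψ ⊆ Ω →
      ∫ x in Ω, u x * partialDeriv i ψ x = - ∫ x in Ω, g x * ψ x

/-- `u ∈ H¹(Ω)`, with weak gradient `Du`. -/
def IsH1 {d : ℕ} (Ω : Set (E d)) (u : E d → ℝ) (Du : Fin d → E d → ℝ) : Prop :=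
  MemLp u 2 (volume.restrict Ω) ∧
    ∀ i, MemLp (Du i) 2 (volume.restrict Ω) ∧ HasWeakPartial Ω i u (Du i)

/-- `u = (u^α) ∈ H¹(Ω; ℝ^m)`, with weak gradient `Du i α = ∂u^α/∂x_i`. -/
def IsH1Vec {d m : ℕ} (Ω : Set (E d)) (u : Fin m → E d → ℝ) (Du : Fin d → Fin m → E d → ℝ) :
    Prop :=
  ∀ α, IsH1 Ω (u α) (fun i => Du i α)

/-- The `L²` norm (with values in `[0, ∞]`) of a function with finitely many components. -/
def l2Norm {d : ℕ} {ι : Type*} [Fintype ι] (ν : Measure (E d)) (f : ι → E d → ℝ) : ℝ≥0∞ :=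
  (∫⁻ x, ∑ i, ENNReal.ofReal (f i x ^ 2) ∂ν) ^ (1 / 2 : ℝ)

/-- The norm of `H¹(Ω; ℝ^m)` with values in `[0, ∞]`. The weak gradient is unique up to null sets,
so the infimum runs over one value, or over none, and is then `∞`. -/
def h1Norm {d m : ℕ} (Ω : Set (E d)) (w : Fin m → E d → ℝ) : ℝ≥0∞ :=
  ⨅ (Dw : Fin d → Fin m → E d → ℝ) (_ : ∀ i α, HasWeakPartial Ω i (w α) (Dw i α)),
    ((l2Norm (volume.restrict Ω) w) ^ 2 +
      (l2Norm (volume.restrict Ω) (fun (p : Fin d × Fin m) => Dw p.1 p.2)) ^ 2) ^ (1 / 2 : ℝ)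

/-- `t ∈ L²(∂Ω)` is the trace on `∂Ω` of `u ∈ H¹(Ω)`: some sequence of smooth functions on `ℝ^d`
tends to `u` in `H¹(Ω)` while its restrictions to `∂Ω` tend to `t` in `L²(∂Ω)`. -/
def HasTrace {d : ℕ} (Ω : Set (E d)) (u t : E d → ℝ) : Prop :=
  MemLp t 2 (surfaceMeasure Ω) ∧
  ∃ Du : Fin d → E d → ℝ, IsH1 Ω u Du ∧
    ∃ v : ℕ → E d → ℝ, (∀ n, ContDiff ℝ ∞ (v n)) ∧
      Tendsto (fun n => eLpNorm (fun x => v n x - u x) 2 (volume.restrict Ω)) atTop (𝓝 0) ∧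
      (∀ i, Tendsto (fun n => eLpNorm (fun x => partialDeriv i (v n) x - Du i x) 2
        (volume.restrict Ω)) atTop (𝓝 0)) ∧
      Tendsto (fun n => eLpNorm (fun x => v n x - t x) 2 (surfaceMeasure Ω)) atTop (𝓝 0)

/-! ### Periodic functions -/

/-- The periodicity cell `Y = (0,1]^d`. -/
def cell (d : ℕ) : Set (E d) := {y | ∀ i, y i ∈ Ioc (0 : ℝ) 1}

/-- `ℤ^d`-periodic functions. -/
def IsPeriodic {d : ℕ} (f : E d → ℝ) : Prop :=
  ∀ (y : E d) (z : Fin d → ℤ), f (y + WithLp.toLp 2 (fun i => (z i : ℝ))) = f y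

/-- `u ∈ H¹_per(Y)`, as a periodic function on `ℝ^d`, with weak gradient `Du`
(a periodic representative). -/
def IsH1Per {d : ℕ} (u : E d → ℝ) (Du : Fin d → E d → ℝ) : Prop :=
  IsPeriodic u ∧ MemLp u 2 (volume.restrict (cell d)) ∧
    ∀ i, IsPeriodic (Du i) ∧ MemLp (Du i) 2 (volume.restrict (cell d)) ∧
      HasWeakPartial univ i u (Du i)

/-- `θ` is the periodic `H²_loc` solution, with mean value zero, of `Δθ = f` in `ℝ^d`, and `Dθ` is
its gradient. -/
def IsPeriodicPoissonSolution {d : ℕ} (f θ : E d → ℝ) (Dθ : Fin d → E d → ℝ) : Prop :=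
  IsH1Per θ Dθ ∧ ∫ y in cell d, θ y = 0 ∧
    ∃ D2θ : Fin d → Fin d → E d → ℝ, (∀ i, IsH1Per (Dθ i) (D2θ i)) ∧
      ∀ᵐ y : E d, ∑ i, D2θ i i y = f y

/-! ### Coefficients, correctors, homogenized coefficients -/

/-- The coefficients of `-div(A∇ + V) + B∇ + c`, with `a i j α β = a_{ij}^{αβ}`,
`V i α β = V_i^{αβ}`, `B i α β = B_i^{αβ}`, `c α β = c^{αβ}`. -/
structure Coefficients (d m : ℕ) where
  a : Fin d → Fin d → Fin m → Fin m → E d → ℝ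
  V : Fin d → Fin m → Fin m → E d → ℝ
  B : Fin d → Fin m → Fin m → E d → ℝ
  c : Fin m → Fin m → E d → ℝ

/-- Measurability, uniform ellipticity with constant `μ`, periodicity, boundedness by `κ`. -/
structure Coefficients.IsAdmissible {d m : ℕ} (𝒜 : Coefficients d m) (μ κ : ℝ) : Prop where
  measurable_a : ∀ i j α β, Measurable (𝒜.a i j α β)
  measurable_V : ∀ i α β, Measurable (𝒜.V i α β)
  measurable_B : ∀ i α β, Measurable (𝒜.B i α β)
  measurable_c : ∀ α β, Measurable (𝒜.c α β)
  elliptic : ∀ᵐ y : E d, ∀ ξ : Fin d → Fin m → ℝ,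
    μ * ∑ i, ∑ α, ξ i α ^ 2 ≤ ∑ i, ∑ j, ∑ α, ∑ β, 𝒜.a i j α β y * ξ i α * ξ j β ∧
    ∑ i, ∑ j, ∑ α, ∑ β, 𝒜.a i j α β y * ξ i α * ξ j β ≤ μ⁻¹ * ∑ i, ∑ α, ξ i α ^ 2
  periodic_a : ∀ i j α β, IsPeriodic (𝒜.a i j α β)
  periodic_V : ∀ i α β, IsPeriodic (𝒜.V i α β)
  periodic_B : ∀ i α β, IsPeriodic (𝒜.B i α β)
  periodic_c : ∀ α β, IsPeriodic (𝒜.c α β)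
  bounded_a : ∀ i j α β, ∀ᵐ y : E d, |𝒜.a i j α β y| ≤ κ
  bounded_V : ∀ i α β, ∀ᵐ y : E d, |𝒜.V i α β y| ≤ κ
  bounded_B : ∀ i α β, ∀ᵐ y : E d, |𝒜.B i α β y| ≤ κ
  bounded_c : ∀ α β, ∀ᵐ y : E d, |𝒜.c α β y| ≤ κ

variable {d m : ℕ}

/-- The rescaled coefficients `A(x/ε)`, `V(x/ε)`, `B(x/ε)`, `c(x/ε)`. -/
def Coefficients.rescale (𝒜 : Coefficients d m) (ε : ℝ) : Coefficients d m where
  a i j α β x := 𝒜.a i j α β (ε⁻¹ • x)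
  V i α β x := 𝒜.V i α β (ε⁻¹ • x)
  B i α β x := 𝒜.B i α β (ε⁻¹ • x)
  c α β x := 𝒜.c α β (ε⁻¹ • x)

/-- `A∇χ_k + V` (for `k = 0`) and `A∇(χ_k + y_k)` (for `1 ≤ k ≤ d`), where
`Dχ k j β γ = ∂χ_k^{βγ}/∂y_j`. -/
def Coefficients.flux (𝒜 : Coefficients d m)
    (Dχ : Fin (d + 1) → Fin d → Fin m → Fin m → E d → ℝ)
    (k : Fin (d + 1)) (i : Fin d) (α γ : Fin m) (y : E d) : ℝ :=
  (Fin.cases (𝒜.V i α γ y) (fun l => 𝒜.a i l α γ y) k : ℝ) +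
    ∑ j, ∑ β, 𝒜.a i j α β y * Dχ k j β γ y

/-- `B∇χ_0 + c` (for `k = 0`) and `B∇(χ_k + y_k)` (for `1 ≤ k ≤ d`). -/
def Coefficients.lowerFlux (𝒜 : Coefficients d m)
    (Dχ : Fin (d + 1) → Fin d → Fin m → Fin m → E d → ℝ)
    (k : Fin (d + 1)) (α γ : Fin m) (y : E d) : ℝ :=
  (Fin.cases (𝒜.c α γ y) (fun l => 𝒜.B l α γ y) k : ℝ) +
    ∑ j, ∑ β, 𝒜.B j α β y * Dχ k j β γ y

/-- `χ_k = (χ_k^{βγ})`, `0 ≤ k ≤ d`, are the correctors: `χ_k ∈ H¹_per(Y)` has mean value zero and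
`-div(A∇χ_0) = div V`, `-div(A∇(χ_k^γ + y_k e^γ)) = 0` for `1 ≤ k ≤ d`, weakly. -/
def Coefficients.IsCorrector (𝒜 : Coefficients d m)
    (χ : Fin (d + 1) → Fin m → Fin m → E d → ℝ)
    (Dχ : Fin (d + 1) → Fin d → Fin m → Fin m → E d → ℝ) : Prop :=
  (∀ k β γ, IsH1Per (χ k β γ) (fun j => Dχ k j β γ) ∧ ∫ y in cell d, χ k β γ y = 0) ∧
  ∀ k γ, ∀ (ψ : Fin m → E d → ℝ) (Dψ : Fin d → Fin m → E d → ℝ),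
    (∀ α, IsH1Per (ψ α) (fun i => Dψ i α)) →
      ∫ y in cell d, ∑ i, ∑ α, 𝒜.flux Dχ k i α γ y * Dψ i α y = 0

/-- The homogenized (constant) coefficients `Â`, `V̂`, `B̂`, `ĉ`. -/
def Coefficients.homogenized (𝒜 : Coefficients d m)
    (Dχ : Fin (d + 1) → Fin d → Fin m → Fin m → E d → ℝ) : Coefficients d m where
  a i j α β _ := ∫ y in cell d, 𝒜.flux Dχ j.succ i α β y
  V i α β _ := ∫ y in cell d, 𝒜.flux Dχ 0 i α β y
  B i α β _ := ∫ y in cell d, 𝒜.lowerFlux Dχ i.succ α β y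
  c α β _ := ∫ y in cell d, 𝒜.lowerFlux Dχ 0 α β y

/-- `b_{i0} = V̂_i - V_i - a_{ij} ∂χ_0/∂y_j`, and `b_{ik} = â_{ik} - a_{ik} - a_{ij} ∂χ_k/∂y_j` for
`1 ≤ k ≤ d`. -/
def Coefficients.b (𝒜 : Coefficients d m)
    (Dχ : Fin (d + 1) → Fin d → Fin m → Fin m → E d → ℝ)
    (k : Fin (d + 1)) (i : Fin d) (α γ : Fin m) (y : E d) : ℝ :=
  (∫ z in cell d, 𝒜.flux Dχ k i α γ z) - 𝒜.flux Dχ k i α γ y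

/-- `W_0 = ĉ - c - B_j ∂χ_0/∂y_j`, and `W_k = B̂_k - B_k - B_j ∂χ_k/∂y_j` for `1 ≤ k ≤ d`. -/
def Coefficients.W (𝒜 : Coefficients d m)
    (Dχ : Fin (d + 1) → Fin d → Fin m → Fin m → E d → ℝ)
    (k : Fin (d + 1)) (α γ : Fin m) (y : E d) : ℝ :=
  (∫ z in cell d, 𝒜.lowerFlux Dχ k α γ z) - 𝒜.lowerFlux Dχ k α γ y

/-- The flux correctors `E_{jik} = ∂θ_{ik}/∂y_j - ∂θ_{jk}/∂y_i`, where
`Dθ k i j α γ = ∂θ_{ik}^{αγ}/∂y_j` and `Δθ_{ik} = b_{ik}`. -/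
def fluxCorrector (Dθ : Fin (d + 1) → Fin d → Fin d → Fin m → Fin m → E d → ℝ)
    (k : Fin (d + 1)) (j i : Fin d) (α γ : Fin m) (y : E d) : ℝ :=
  Dθ k i j α γ y - Dθ k j i α γ y

/-- The periodic weight `h`: the sum of the absolute values of all entries of `A`, `V`, `B`, `c`,
`χ_k`, `b_{ik}`, `E_{jik}` and `∇ϑ_k`, where `Dϑ k i α γ = ∂ϑ_k^{αγ}/∂y_i`. -/
def Coefficients.weight (𝒜 : Coefficients d m)
    (χ : Fin (d + 1) → Fin m → Fin m → E d → ℝ)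
    (Dχ : Fin (d + 1) → Fin d → Fin m → Fin m → E d → ℝ)
    (Dθ : Fin (d + 1) → Fin d → Fin d → Fin m → Fin m → E d → ℝ)
    (Dϑ : Fin (d + 1) → Fin d → Fin m → Fin m → E d → ℝ) (y : E d) : ℝ :=
  (∑ i, ∑ j, ∑ α, ∑ β, |𝒜.a i j α β y|) + (∑ i, ∑ α, ∑ β, |𝒜.V i α β y|) +
  (∑ i, ∑ α, ∑ β, |𝒜.B i α β y|) + (∑ α, ∑ β, |𝒜.c α β y|) +
  (∑ k, ∑ α, ∑ γ, |χ k α γ y|) + (∑ k, ∑ i, ∑ α, ∑ γ, |𝒜.b Dχ k i α γ y|) +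
  (∑ k, ∑ j, ∑ i, ∑ α, ∑ γ, |fluxCorrector Dθ k j i α γ y|) +
  (∑ k, ∑ i, ∑ α, ∑ γ, |Dϑ k i α γ y|)

/-! ### The equations -/

/-- The bilinear form of `-div(A∇ + V) + B∇ + c + λI` on `H¹(Ω; ℝ^m)`, for the conormal boundary
operator `n · (A∇ + V)`. -/
def Coefficients.form (𝒜 : Coefficients d m) (Ω : Set (E d)) (lam : ℝ)
    (u : Fin m → E d → ℝ) (Du : Fin d → Fin m → E d → ℝ)
    (v : Fin m → E d → ℝ) (Dv : Fin d → Fin m → E d → ℝ) : ℝ :=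
  (∫ x in Ω, ∑ i, ∑ α, ((∑ j, ∑ β, 𝒜.a i j α β x * Du j β x) + ∑ β, 𝒜.V i α β x * u β x)
      * Dv i α x) +
  ∫ x in Ω, ∑ α, ((∑ i, ∑ β, 𝒜.B i α β x * Du i β x) + (∑ β, 𝒜.c α β x * u β x)
      + lam * u α x) * v α x

/-- `w_ε = u_ε - u_0 - ε ∑_{k=0}^d χ_k(x/ε) φ_k`. -/
def remainder (ε : ℝ) (χ : Fin (d + 1) → Fin m → Fin m → E d → ℝ)
    (uε u₀ : Fin m → E d → ℝ) (φ : Fin (d + 1) → Fin m → E d → ℝ) (β : Fin m) (x : E d) : ℝ :=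
  uε β x - u₀ β x - ε * ∑ k, ∑ γ, χ k β γ (ε⁻¹ • x) * φ k γ x

end NeumannHomogenization

end

/-! Write w = u_ε - u₀ - z with z = ε ∑ χ_k(x/ε) φ_k. The equation gives B_ε[w,v] = B_0[u₀,v] -
B_ε[u₀,v] - B_ε[z,v] for every v in H¹(Ω). Differentiating χ_k(x/ε) produces a factor ε⁻¹ that
cancels the ε in z, and regrouping (`twoScale_expansion`) turns the flux on the right into bounded
coefficients times ∇u₀ - φ⃗ and u₀ - φ₀, terms ε χ_k(x/ε) φ_k and ε χ_k(x/ε) ∇φ_k, and the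
oscillating terms b_k(x/ε) φ_k. The lower order part has the same shape with W_k in place of b_k.
Only the oscillating terms are not small by themselves.

They are divergences. The corrector equation makes b_k divergence free, so b_{ik} = ∂_j E_{jik} with
E skew (`hasWeakDiv_sub_of_poisson`, through a Liouville theorem for periodic functions), and W_k =
div ∇ϑ_k. Let η be a cutoff supported in Ω, equal to 1 on Σ_{2ε}, with |∇η| ≤ C/ε (`exists_cutoff`).
The vector bφη + εE·∇(φη) is the divergence of εEφη; by skew symmetry it is itself divergence free,
and it pairs to zero with ∇v (`sum_integral_localized_eq_zero`). Subtracting it leaves bφ(1-η) and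
εφE∇η, which live in the boundary layer, and εηE∇φ. Likewise Wφη + ε∇ϑ·∇(φη) paired with v equals -∫
εφη ∇ϑ·∇v, of size ε h|φ| (`HasWeakDiv.localized_eq_zero`). Since η vanishes near ∂Ω, no boundary
integral appears: the estimate is obtained without its surface term, which is added at the end as a
nonnegative quantity.

For large λ the form B_ε is coercive (`coercive_pointwise`). Taking v = w, with all residuals
bounded pointwise by a constant times a single function s whose L² norm is at most the bracket in
the claim, Young's inequality gives the result (`energy_bound`, `integral_remainder_sq_le`).

Two points need care. First, h is only locally square integrable, so products such as χφ need not
lie in H¹. Ellipticity gives h ≥ μ, and solving A∇χ_k = mean - b_k - (V or A) pointwise gives |∇χ_k|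
≤ C h (`Coefficients.IsCorrector.ae_bounds`); thus finiteness of the norms of hφ and h∇φ makes every
product square integrable, and if one of them is infinite there is nothing to prove. Secondly,
identities tested with smooth functions must be extended to products of rough functions: φ is
replaced by the smooth sequence that comes with its trace, and, instead of v, the compactly
supported fields are mollified (`integral_add_sum_eq_zero_of_test`). -/

noncomputable section

namespace NeumannHomogenization

variable {d : ℕ}

/-! ### Test functions -/

/-- Smooth functions with compact support. -/
structure IsTest (ψ : E d → ℝ) : Prop where
  contDiff : ContDiff ℝ ∞ ψ
  hasCompactSupport : HasCompactSupport ψ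

theorem contDiff_partialDeriv {u : E d → ℝ} (hu : ContDiff ℝ ∞ u) (i : Fin d) :
    ContDiff ℝ ∞ (partialDeriv i u) := by
  unfold partialDeriv
  exact (hu.fderiv_right (m := ∞) (by simp)).clm_apply contDiff_const

theorem partialDeriv_eq_zero_of_notMem {ψ : E d → ℝ} {x : E d} (hx : x ∉ tsupport ψ) (i : Fin d) :
    partialDeriv i ψ x = 0 := by
  have h : ψ =ᶠ[𝓝 x] fun _ => 0 := notMem_tsupport_iff_eventuallyEq.1 hx
  unfold partialDeriv
  rw [h.fderiv_eq]
  simp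

theorem tsupport_partialDeriv_subset (ψ : E d → ℝ) (i : Fin d) :
    tsupport (partialDeriv i ψ) ⊆ tsupport ψ := by
  refine closure_minimal (fun x hx => ?_) isClosed_closure
  by_contra h
  exact hx (partialDeriv_eq_zero_of_notMem h i)

theorem IsTest.continuous {ψ : E d → ℝ} (h : IsTest ψ) : Continuous ψ := h.contDiff.continuous

theorem IsTest.partialDeriv {ψ : E d → ℝ} (h : IsTest ψ) (i : Fin d) :
    IsTest (partialDeriv i ψ) :=
  ⟨contDiff_partialDeriv h.contDiff i,
    h.hasCompactSupport.of_isClosed_subset isClosed_closure (tsupport_partialDeriv_subset ψ i)⟩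

theorem IsTest.mul_left {u ψ : E d → ℝ} (hu : ContDiff ℝ ∞ u) (h : IsTest ψ) :
    IsTest (fun x => u x * ψ x) :=
  ⟨hu.mul h.contDiff, h.hasCompactSupport.mul_left⟩

theorem IsTest.comp_smul {ψ : E d → ℝ} (h : IsTest ψ) {c : ℝ} (hc : c ≠ 0) :
    IsTest (fun x => ψ (c • x)) :=
  ⟨h.contDiff.comp (contDiff_const_smul c), h.hasCompactSupport.comp_homeomorph
    (Homeomorph.smulOfNeZero c hc)⟩

theorem differentiable_of_contDiff {u : E d → ℝ} (hu : ContDiff ℝ ∞ u) : Differentiable ℝ u :=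
  hu.differentiable (by simp)

theorem partialDeriv_mul {u v : E d → ℝ} (hu : ContDiff ℝ ∞ u) (hv : ContDiff ℝ ∞ v) (i : Fin d)
    (x : E d) : partialDeriv i (fun x => u x * v x) x =
      u x * partialDeriv i v x + partialDeriv i u x * v x := by
  unfold partialDeriv
  rw [fderiv_fun_mul (differentiable_of_contDiff hu x) (differentiable_of_contDiff hv x)]
  simp [mul_comm]

theorem partialDeriv_comp_smul {u : E d → ℝ} (hu : ContDiff ℝ ∞ u) (c : ℝ) (i : Fin d)
    (x : E d) : partialDeriv i (fun x => u (c • x)) x = c * partialDeriv i u (c • x) := by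
  unfold partialDeriv
  have h2 : HasFDerivAt (fun x : E d => c • x) (c • ContinuousLinearMap.id ℝ (E d)) x :=
    (hasFDerivAt_id x).const_smul c
  have h := (differentiable_of_contDiff hu (c • x)).hasFDerivAt.comp x h2
  rw [show (fun x => u (c • x)) = u ∘ (fun x : E d => c • x) from rfl, h.fderiv]
  simp

theorem partialDeriv_comp_add {u : E d → ℝ} (z : E d) (i : Fin d) (x : E d) :
    partialDeriv i (fun x => u (x + z)) x = partialDeriv i u (x + z) := by
  unfold partialDeriv
  rw [fderiv_comp_add_right]

theorem partialDeriv_comm {u : E d → ℝ} (hu : ContDiff ℝ ∞ u) (i j : Fin d) (x : E d) :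
    partialDeriv i (partialDeriv j u) x = partialDeriv j (partialDeriv i u) x := by
  have h2 : Differentiable ℝ (fderiv ℝ u) :=
    (hu.fderiv_right (m := ∞) (by simp)).differentiable (by simp)
  have key : ∀ v w : E d, fderiv ℝ (fun y => fderiv ℝ u y v) x w = fderiv ℝ (fderiv ℝ u) x w v := by
    intro v w
    rw [fderiv_clm_apply (h2 x) (differentiableAt_const v)]
    simp
  have hs : IsSymmSndFDerivAt ℝ u x := by
    refine hu.contDiffAt.isSymmSndFDerivAt ?_
    simp only [minSmoothness_of_isRCLikeNormedField]
    exact WithTop.coe_le_coe.2 (le_top : (2 : ℕ∞) ≤ ⊤)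
  unfold partialDeriv
  rw [key, key]
  exact hs _ _

theorem integrable_continuous_mul_test {u ψ : E d → ℝ} (hu : Continuous u) (h : IsTest ψ) :
    Integrable (fun x => u x * ψ x) :=
  (hu.mul h.continuous).integrable_of_hasCompactSupport h.hasCompactSupport.mul_left

theorem integral_mul_partialDeriv {u ψ : E d → ℝ} (hu : ContDiff ℝ ∞ u) (h : IsTest ψ)
    (i : Fin d) : ∫ x, u x * partialDeriv i ψ x = -∫ x, partialDeriv i u x * ψ x := by
  refine integral_mul_fderiv_eq_neg_fderiv_mul_of_integrable ?_ ?_ ?_ ?_ ?_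
  · exact integrable_continuous_mul_test (contDiff_partialDeriv hu i).continuous h
  · exact integrable_continuous_mul_test hu.continuous (h.partialDeriv i)
  · exact integrable_continuous_mul_test hu.continuous h
  · exact fun x _ => differentiable_of_contDiff hu x
  · exact fun x _ => differentiable_of_contDiff h.contDiff x

/-! ### Locally square integrable functions -/

/-- Functions on `ℝ^d` which are square integrable on every ball. -/
def LocL2 (f : E d → ℝ) : Prop := ∀ R : ℝ, MemLp f 2 (volume.restrict (Metric.ball 0 R))

theorem LocL2.memLp {f : E d → ℝ} (hf : LocL2 f) {K : Set (E d)} (hK : Bornology.IsBounded K) :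
    MemLp f 2 (volume.restrict K) := by
  obtain ⟨R, hR⟩ := hK.subset_ball 0
  exact (hf R).mono_measure (Measure.restrict_mono hR le_rfl)

theorem LocL2.add {f g : E d → ℝ} (hf : LocL2 f) (hg : LocL2 g) : LocL2 (fun x => f x + g x) :=
  fun R => (hf R).add (hg R)

theorem LocL2.sub {f g : E d → ℝ} (hf : LocL2 f) (hg : LocL2 g) : LocL2 (fun x => f x - g x) :=
  fun R => (hf R).sub (hg R)

theorem LocL2.const_mul {f : E d → ℝ} (hf : LocL2 f) (c : ℝ) : LocL2 (fun x => c * f x) :=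
  fun R => (hf R).const_mul c

theorem LocL2.sum {ι : Type*} (s : Finset ι) {f : ι → E d → ℝ} (hf : ∀ i, LocL2 (f i)) :
    LocL2 (fun x => ∑ i ∈ s, f i x) :=
  fun R => memLp_finsetSum s (fun i _ => hf i R)

theorem memLp_bdd_mul {ν : Measure (E d)} {f g : E d → ℝ} {κ : ℝ} (hf : AEStronglyMeasurable f ν)
    (hb : ∀ᵐ x ∂ν, |f x| ≤ κ) (hg : MemLp g 2 ν) : MemLp (fun x => f x * g x) 2 ν := by
  refine hg.of_le_mul (c := κ) (hf.mul hg.aestronglyMeasurable) ?_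
  filter_upwards [hb] with x hx
  rw [norm_mul]
  exact mul_le_mul_of_nonneg_right hx (norm_nonneg _)

theorem LocL2.bdd_mul {f g : E d → ℝ} {κ : ℝ} (hf : Measurable f)
    (hb : ∀ᵐ x : E d, |f x| ≤ κ) (hg : LocL2 g) : LocL2 (fun x => f x * g x) :=
  fun R => memLp_bdd_mul hf.aestronglyMeasurable (ae_restrict_of_ae hb) (hg R)

theorem LocL2.const (c : ℝ) : LocL2 (fun _ : E d => c) := fun R => by
  have : IsFiniteMeasure (volume.restrict (Metric.ball (0 : E d) R)) :=
    ⟨by rw [Measure.restrict_apply_univ]; exact measure_ball_lt_top⟩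
  exact memLp_const c

theorem LocL2.of_bdd {f : E d → ℝ} {κ : ℝ} (hf : Measurable f) (hb : ∀ᵐ x : E d, |f x| ≤ κ) :
    LocL2 f := by
  simpa using LocL2.bdd_mul hf hb (LocL2.const 1)

theorem LocL2.locallyIntegrable {f : E d → ℝ} (hf : LocL2 f) : LocallyIntegrable f := by
  intro x
  have : IsFiniteMeasure (volume.restrict (Metric.ball (0 : E d) (‖x‖ + 1))) :=
    ⟨by rw [Measure.restrict_apply_univ]; exact measure_ball_lt_top⟩
  refine ⟨Metric.ball 0 (‖x‖ + 1), Metric.isOpen_ball.mem_nhds (by simp), ?_⟩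
  exact (hf _).integrable (by norm_num)

theorem LocL2.aestronglyMeasurable {f : E d → ℝ} (hf : LocL2 f) :
    AEStronglyMeasurable f volume := hf.locallyIntegrable.aestronglyMeasurable

theorem LocL2.integrable_mul {f ψ : E d → ℝ} (hf : LocL2 f) (h : IsTest ψ) :
    Integrable (fun x => f x * ψ x) := by
  simpa [mul_comm] using hf.locallyIntegrable.integrable_smul_left_of_hasCompactSupport
    h.continuous h.hasCompactSupport

theorem LocL2.mul_continuous {f g : E d → ℝ} (hf : LocL2 f) (hg : Continuous g) :
    LocL2 (fun x => f x * g x) := by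
  intro R
  obtain ⟨C, hC⟩ := (isCompact_closedBall (0 : E d) R).exists_bound_of_continuousOn hg.continuousOn
  have : MemLp (fun x => g x * f x) 2 (volume.restrict (Metric.ball 0 R)) := by
    refine memLp_bdd_mul (κ := C) hg.aestronglyMeasurable ?_ (hf R)
    filter_upwards [ae_restrict_mem measurableSet_ball] with x hx
    exact hC x (Metric.ball_subset_closedBall hx)
  simpa [mul_comm] using this

theorem ae_comp_smul {P : E d → Prop} (h : ∀ᵐ y : E d, P y) {c : ℝ} (hc : c ≠ 0) :
    ∀ᵐ x : E d, P (c • x) := by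
  rw [ae_iff] at h ⊢
  have : {x : E d | ¬ P (c • x)} = (c • ·) ⁻¹' {y | ¬ P y} := rfl
  rw [this, Measure.addHaar_preimage_smul _ hc, h, mul_zero]

theorem LocL2.comp_smul {f : E d → ℝ} (hf : LocL2 f) {c : ℝ} (hc : 0 < c) :
    LocL2 (fun x => f (c • x)) := by
  intro R
  have he : MeasurableEmbedding (fun x : E d => c • x) :=
    (Homeomorph.smulOfNeZero c hc.ne').measurableEmbedding
  have h1 : (volume.restrict (Metric.ball (0 : E d) R)).map (fun x : E d => c • x)
      = ENNReal.ofReal |(c ^ Module.finrank ℝ (E d))⁻¹| •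
        volume.restrict (Metric.ball (0 : E d) (c * R)) := by
    have hpre : (fun x : E d => c • x) ⁻¹' Metric.ball 0 (c * R) = Metric.ball 0 R := by
      ext x
      simp [norm_smul, abs_of_pos hc, hc]
    rw [← hpre, ← he.restrict_map, Measure.map_addHaar_smul _ hc.ne', Measure.restrict_smul]
  have h2 : MemLp f 2 ((volume.restrict (Metric.ball (0 : E d) R)).map (fun x : E d => c • x)) := by
    rw [h1]
    exact (hf _).smul_measure ENNReal.ofReal_ne_top
  exact (he.memLp_map_measure_iff).1 h2

/-! ### Weak derivatives -/

theorem integrable_mul_test_of_locallyIntegrableOn {Ω : Set (E d)} {u ψ : E d → ℝ}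
    (hu : LocallyIntegrableOn u Ω) (hψ : IsTest ψ) (hs : tsupport ψ ⊆ Ω) :
    Integrable (fun x => u x * ψ x) := by
  have hK : IsCompact (tsupport ψ) := hψ.hasCompactSupport
  have h1 : IntegrableOn u (tsupport ψ) := hu.integrableOn_compact_subset hs hK
  have h2 : IntegrableOn (fun x => u x * ψ x) (tsupport ψ) :=
    h1.mul_continuousOn hψ.continuous.continuousOn hK
  rw [← integrableOn_univ]
  refine h2.of_forall_sdiff_eq_zero MeasurableSet.univ fun x hx => ?_
  rw [image_eq_zero_of_notMem_tsupport hx.2, mul_zero]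

theorem setIntegral_mul_eq_integral {Ω : Set (E d)} (u : E d → ℝ) {ψ : E d → ℝ}
    (hs : tsupport ψ ⊆ Ω) : ∫ x in Ω, u x * ψ x = ∫ x, u x * ψ x := by
  refine setIntegral_eq_integral_of_forall_compl_eq_zero fun x hx => ?_
  rw [image_eq_zero_of_notMem_tsupport (fun h => hx (hs h)), mul_zero]

theorem hasWeakPartial_iff {Ω : Set (E d)} {i : Fin d} {u g : E d → ℝ} :
    HasWeakPartial Ω i u g ↔ LocallyIntegrableOn u Ω ∧ LocallyIntegrableOn g Ω ∧
      ∀ ψ : E d → ℝ, IsTest ψ → tsupport ψ ⊆ Ω →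
        ∫ x, u x * partialDeriv i ψ x = - ∫ x, g x * ψ x := by
  unfold HasWeakPartial
  refine and_congr_right fun _ => and_congr_right fun _ => ⟨fun h ψ hψ hs => ?_,
    fun h ψ h1 h2 hs => ?_⟩
  · rw [← setIntegral_mul_eq_integral g hs, ← setIntegral_mul_eq_integral u
      ((tsupport_partialDeriv_subset ψ i).trans hs)]
    exact h ψ hψ.1 hψ.2 hs
  · rw [setIntegral_mul_eq_integral g hs, setIntegral_mul_eq_integral u
      ((tsupport_partialDeriv_subset ψ i).trans hs)]
    exact h ψ ⟨h1, h2⟩ hs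

theorem HasWeakPartial.integral_eq {i : Fin d} {u g ψ : E d → ℝ}
    (h : HasWeakPartial univ i u g) (hψ : IsTest ψ) :
    ∫ x, u x * partialDeriv i ψ x = - ∫ x, g x * ψ x :=
  (hasWeakPartial_iff.1 h).2.2 ψ hψ (subset_univ _)

theorem HasWeakPartial.mono {Ω Ω' : Set (E d)} {i : Fin d} {u g : E d → ℝ}
    (h : HasWeakPartial Ω i u g) (hs : Ω' ⊆ Ω) : HasWeakPartial Ω' i u g := by
  rw [hasWeakPartial_iff] at h ⊢
  exact ⟨h.1.mono_set hs, h.2.1.mono_set hs, fun ψ hψ h' => h.2.2 ψ hψ (h'.trans hs)⟩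

theorem HasWeakPartial.add {Ω : Set (E d)} {i : Fin d} {u g u' g' : E d → ℝ}
    (h : HasWeakPartial Ω i u g) (h' : HasWeakPartial Ω i u' g') :
    HasWeakPartial Ω i (fun x => u x + u' x) (fun x => g x + g' x) := by
  rw [hasWeakPartial_iff] at h h' ⊢
  refine ⟨h.1.add h'.1, h.2.1.add h'.2.1, fun ψ hψ hs => ?_⟩
  have hs' := (tsupport_partialDeriv_subset ψ i).trans hs
  have e1 := h.2.2 ψ hψ hs
  have e2 := h'.2.2 ψ hψ hs
  simp only [add_mul]
  rw [integral_add (integrable_mul_test_of_locallyIntegrableOn h.1 (hψ.partialDeriv i) hs')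
    (integrable_mul_test_of_locallyIntegrableOn h'.1 (hψ.partialDeriv i) hs'),
    integral_add (integrable_mul_test_of_locallyIntegrableOn h.2.1 hψ hs)
    (integrable_mul_test_of_locallyIntegrableOn h'.2.1 hψ hs), e1, e2]
  ring

theorem HasWeakPartial.const_mul {Ω : Set (E d)} {i : Fin d} {u g : E d → ℝ}
    (h : HasWeakPartial Ω i u g) (c : ℝ) :
    HasWeakPartial Ω i (fun x => c * u x) (fun x => c * g x) := by
  rw [hasWeakPartial_iff] at h ⊢
  refine ⟨h.1.smul c, h.2.1.smul c, fun ψ hψ hs => ?_⟩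
  simp only [mul_assoc]
  rw [integral_const_mul, integral_const_mul, h.2.2 ψ hψ hs]
  ring

theorem HasWeakPartial.sub {Ω : Set (E d)} {i : Fin d} {u g u' g' : E d → ℝ}
    (h : HasWeakPartial Ω i u g) (h' : HasWeakPartial Ω i u' g') :
    HasWeakPartial Ω i (fun x => u x - u' x) (fun x => g x - g' x) := by
  simpa [sub_eq_add_neg] using h.add (h'.const_mul (-1))

theorem HasWeakPartial.zero (Ω : Set (E d)) (i : Fin d) :
    HasWeakPartial Ω i (fun _ => 0) (fun _ => 0) :=
  ⟨locallyIntegrableOn_zero, locallyIntegrableOn_zero, by simp⟩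

theorem HasWeakPartial.sum {Ω : Set (E d)} {i : Fin d} {ι : Type*} (s : Finset ι)
    {u g : ι → E d → ℝ} (h : ∀ k, HasWeakPartial Ω i (u k) (g k)) :
    HasWeakPartial Ω i (fun x => ∑ k ∈ s, u k x) (fun x => ∑ k ∈ s, g k x) := by
  classical
  induction s using Finset.induction_on with
  | empty => simpa using HasWeakPartial.zero Ω i
  | insert a s ha ih => simpa [Finset.sum_insert ha] using (h a).add ih

theorem HasWeakPartial.ae_eq {Ω : Set (E d)} (hΩ : IsOpen Ω) {i : Fin d} {u g g' : E d → ℝ}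
    (h : HasWeakPartial Ω i u g) (h' : HasWeakPartial Ω i u g') :
    g =ᵐ[volume.restrict Ω] g' := by
  have h0 := h.sub h'
  rw [hasWeakPartial_iff] at h0
  have := hΩ.ae_eq_zero_of_integral_contDiff_smul_eq_zero (μ := volume) h0.2.1
    (fun ψ h1 h2 hs => by
      have := h0.2.2 ψ ⟨h1, h2⟩ hs
      simp only [sub_self, zero_mul, integral_zero] at this
      simp only [smul_eq_mul, mul_comm (ψ _)]
      linarith)
  rw [EventuallyEq, ae_restrict_iff' hΩ.measurableSet]
  filter_upwards [this] with x hx hxΩ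
  linarith [hx hxΩ]

theorem integral_comp_smul_mul {f ψ : E d → ℝ} {ε : ℝ} (hε : 0 < ε) :
    ∫ x, f (ε⁻¹ • x) * ψ x = ε ^ d * ∫ y, f y * ψ (ε • y) := by
  have := Measure.integral_comp_smul (volume : Measure (E d)) (fun y => f y * ψ (ε • y)) ε⁻¹
  simp only [smul_smul, mul_inv_cancel₀ hε.ne', one_smul] at this
  rw [this]
  simp [abs_of_pos (pow_pos hε d)]

theorem HasWeakPartial.comp_smul {i : Fin d} {u g : E d → ℝ} (h : HasWeakPartial univ i u g)
    (hu : LocL2 u) (hg : LocL2 g) {ε : ℝ} (hε : 0 < ε) :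
    HasWeakPartial univ i (fun x => u (ε⁻¹ • x)) (fun x => ε⁻¹ * g (ε⁻¹ • x)) := by
  rw [hasWeakPartial_iff]
  refine ⟨(hu.comp_smul (inv_pos.2 hε)).locallyIntegrable.locallyIntegrableOn _,
    ((hg.comp_smul (inv_pos.2 hε)).const_mul _).locallyIntegrable.locallyIntegrableOn _,
    fun ψ hψ _ => ?_⟩
  simp only [mul_assoc]
  rw [integral_const_mul, integral_comp_smul_mul hε, integral_comp_smul_mul hε]
  have h1 := h.integral_eq (hψ.comp_smul hε.ne')
  simp only [partialDeriv_comp_smul hψ.contDiff] at h1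
  have h2 : ∫ x, u x * (ε * partialDeriv i ψ (ε • x)) = ε * ∫ x, u x * partialDeriv i ψ (ε • x) :=
      by
    rw [← integral_const_mul]
    congr 1 with x
    ring
  rw [h2] at h1
  have : ∫ x, u x * partialDeriv i ψ (ε • x) = ε⁻¹ * -∫ x, g x * ψ (ε • x) := by
    rw [← h1]; field_simp
  rw [this]; ring


theorem LocL2.integrableOn {f : E d → ℝ} (hf : LocL2 f) {K : Set (E d)}
    (hK : Bornology.IsBounded K) : IntegrableOn f K := by
  have : IsFiniteMeasure (volume.restrict K) :=
    ⟨by rw [Measure.restrict_apply_univ]; exact hK.measure_lt_top⟩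
  exact (hf.memLp hK).integrable (by norm_num)

/-! ### The lattice and its fundamental cell -/

/-- The inclusion of `ℤ^d` in `ℝ^d`. -/
def latticeHom (d : ℕ) : (Fin d → ℤ) →+ E d where
  toFun z := WithLp.toLp 2 (fun i => (z i : ℝ))
  map_zero' := by ext i; simp
  map_add' a b := by ext i; simp

@[simp] theorem latticeHom_apply (z : Fin d → ℤ) (i : Fin d) : latticeHom d z i = z i := rfl

theorem latticeHom_injective : Function.Injective (latticeHom d) := by
  intro a b h
  ext i
  have : latticeHom d a i = latticeHom d b i := by rw [h]
  simpa using this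

theorem IsPeriodic.add_lattice {f : E d → ℝ} (hf : IsPeriodic f) (y : E d) (z : Fin d → ℤ) :
    f (y + latticeHom d z) = f y := hf y z

theorem measurableSet_cell : MeasurableSet (cell d) := by
  have : cell d = ⋂ i, (fun y : E d => y i) ⁻¹' Ioc 0 1 := by ext; simp [cell]
  rw [this]
  exact MeasurableSet.iInter fun i =>
    (show Measurable (fun y : E d => y i) by fun_prop) measurableSet_Ioc

theorem existsUnique_add_lattice_mem_cell (x : E d) : ∃! z : Fin d → ℤ, x + latticeHom d z ∈ cell d
    := by
  have h : ∀ i, ∃! n : ℤ, x i + n ∈ Ioc (0 : ℝ) 1 := fun i => by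
    simpa using existsUnique_add_zsmul_mem_Ioc (one_pos : (0 : ℝ) < 1) (x i) 0
  choose z hz hu using h
  exact ⟨z, fun i => hz i, fun z' hz' => funext fun i => hu i _ (hz' i)⟩

theorem isBounded_cell : Bornology.IsBounded (cell d) := by
  refine (Metric.isBounded_iff_subset_closedBall 0).2 ⟨√(∑ _i : Fin d, 1), fun y hy => ?_⟩
  rw [mem_closedBall_zero_iff, EuclideanSpace.norm_eq]
  refine Real.sqrt_le_sqrt (Finset.sum_le_sum fun i _ => ?_)
  have := hy i
  rw [Real.norm_eq_abs, sq_abs]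
  nlinarith [this.1, this.2]

theorem volume_cell : volume (cell d) = 1 := by
  have : cell d = (MeasurableEquiv.toLp 2 (Fin d → ℝ)).symm ⁻¹' (univ.pi fun _ => Ioc (0 : ℝ) 1) :=
      by
    ext; simp [cell]
  rw [this, (EuclideanSpace.volume_preserving_symm_measurableEquiv_toLp (Fin d)).measure_preimage
    (MeasurableSet.univ_pi fun _ => measurableSet_Ioc).nullMeasurableSet, Real.volume_pi_Ioc]
  simp

/-- The lattice `ℤ^d` in `ℝ^d`. -/
abbrev lattice (d : ℕ) : AddSubgroup (E d) := (latticeHom d).range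

instance : Countable (lattice d) := by
  have : Function.Surjective (latticeHom d).rangeRestrict := (latticeHom d).rangeRestrict_surjective
  exact this.countable

/-- The parametrization of the lattice by `ℤ^d`. -/
def latticeEquiv (d : ℕ) : (Fin d → ℤ) ≃ lattice d :=
  (AddMonoidHom.ofInjective latticeHom_injective).toEquiv

theorem latticeEquiv_vadd (z : Fin d → ℤ) (x : E d) :
    latticeEquiv d z +ᵥ x = x + latticeHom d z := by
  rw [add_comm]; rfl

theorem isAddFundamentalDomain_cell : IsAddFundamentalDomain (lattice d) (cell d) volume := by
  refine IsAddFundamentalDomain.mk' measurableSet_cell.nullMeasurableSet fun x => ?_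
  obtain ⟨z, hz, hu⟩ := existsUnique_add_lattice_mem_cell x
  refine ⟨latticeEquiv d z, by simpa only [latticeEquiv_vadd] using hz, fun g hg => ?_⟩
  obtain ⟨z', rfl⟩ := (latticeEquiv d).surjective g
  simp only [latticeEquiv_vadd] at hg
  rw [hu z' hg]

theorem exists_finset_lattice (R R₀ : ℝ) : ∃ T : Finset (Fin d → ℤ), ∀ z ∉ T, ∀ y : E d, ‖y‖ ≤ R →
    R₀ < ‖y + latticeHom d z‖ := by
  refine ⟨Fintype.piFinset fun _ => Finset.Icc (-⌈R + R₀⌉) ⌈R + R₀⌉, fun z hz y hy => ?_⟩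
  by_contra! h
  refine hz (Fintype.mem_piFinset.2 fun i => ?_)
  have h1 : ‖latticeHom d z‖ ≤ R + R₀ := by
    have := norm_sub_le (y + latticeHom d z) y
    rw [add_sub_cancel_left] at this
    linarith
  have h2 : |(z i : ℝ)| ≤ ‖latticeHom d z‖ := by
    simpa using PiLp.norm_apply_le (latticeHom d z) i
  have h3 : |(z i : ℝ)| ≤ (⌈R + R₀⌉ : ℤ) := (h2.trans h1).trans (Int.le_ceil _)
  have h4 : |z i| ≤ ⌈R + R₀⌉ := by exact_mod_cast h3
  rw [Finset.mem_Icc]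
  exact abs_le.1 h4

/-- A ball is covered by finitely many lattice translates of the cell, and on each of them `f` is a
copy of its restriction to the cell. -/
theorem LocL2.of_isPeriodic {f : E d → ℝ} (hf : IsPeriodic f)
    (h : MemLp f 2 (volume.restrict (cell d))) : LocL2 f := by
  have hA : ∀ z : Fin d → ℤ,
      MemLp f 2 (volume.restrict ((fun x => x + latticeHom d z) ⁻¹' cell d)) := by
    intro z
    have h1 := (measurePreserving_add_right volume (latticeHom d z)).restrict_preimage
      (measurableSet_cell (d := d))
    have h2 := h.comp_measurePreserving h1
    have h3 : f ∘ (fun x => x + latticeHom d z) = f := funext fun x => hf.add_lattice x z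
    rwa [h3] at h2
  intro R
  obtain ⟨R₀, hR₀⟩ := (Metric.isBounded_iff_subset_closedBall (0 : E d)).1 (isBounded_cell (d := d))
  obtain ⟨T, hT⟩ := exists_finset_lattice (d := d) R R₀
  have hcov : Metric.ball (0 : E d) R ⊆ ⋃ z ∈ T, (fun x => x + latticeHom d z) ⁻¹' cell d := by
    intro x hx
    obtain ⟨z, hz, -⟩ := existsUnique_add_lattice_mem_cell x
    refine mem_iUnion₂.2 ⟨z, ?_, hz⟩
    by_contra hzT
    have h1 := hT z hzT x (mem_ball_zero_iff.1 hx).le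
    have h2 := mem_closedBall_zero_iff.1 (hR₀ hz)
    linarith
  have hm : AEStronglyMeasurable f (volume.restrict
      (⋃ z ∈ T, (fun x => x + latticeHom d z) ⁻¹' cell d)) := by
    have : AEStronglyMeasurable f (volume.restrict
        (⋃ z, (fun x => x + latticeHom d z) ⁻¹' cell d)) :=
      aestronglyMeasurable_iUnion_iff.2 fun z => (hA z).aestronglyMeasurable
    exact this.mono_measure (Measure.restrict_mono (iUnion₂_subset_iUnion _ _) le_rfl)
  have h2 : MemLp f 2 (volume.restrict
      (⋃ z ∈ T, (fun x => x + latticeHom d z) ⁻¹' cell d)) := by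
    rw [memLp_two_iff_integrable_sq hm]
    exact integrableOn_finset_iUnion.2 fun z _ => (hA z).integrable_sq
  exact h2.mono_measure (Measure.restrict_mono hcov le_rfl)

theorem ae_of_ae_cell {P : E d → Prop} (hP : ∀ y z, P (y + latticeHom d z) → P y)
    (h : ∀ᵐ y ∂volume.restrict (cell d), P y) : ∀ᵐ y : E d, P y := by
  have h1 : ∀ z : Fin d → ℤ, ∀ᵐ y : E d, y + latticeHom d z ∈ cell d → P (y + latticeHom d z) :=
    fun z => (measurePreserving_add_right volume (latticeHom d z)).quasiMeasurePreserving.ae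
      ((ae_restrict_iff' measurableSet_cell).1 h)
  filter_upwards [ae_all_iff.2 h1] with y hy
  obtain ⟨z, hz, -⟩ := existsUnique_add_lattice_mem_cell y
  exact hP y z (hy z hz)

/-! ### Periodization -/

/-- `∑_z ψ(· + z)`, the sum over the lattice. -/
def periodization (ψ : E d → ℝ) (y : E d) : ℝ := ∑' z : Fin d → ℤ, ψ (y + latticeHom d z)

theorem isPeriodic_periodization (ψ : E d → ℝ) : IsPeriodic (periodization ψ) := by
  intro y z
  unfold periodization
  rw [← (Equiv.addLeft z).tsum_eq (fun z => ψ (y + latticeHom d z))]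
  refine tsum_congr fun w => ?_
  rw [Equiv.coe_addLeft, map_add, ← add_assoc]
  rfl

theorem IsTest.exists_finset {ψ : E d → ℝ} (h : IsTest ψ) (R : ℝ) : ∃ T : Finset (Fin d → ℤ),
    ∀ z ∉ T, ∀ y : E d, ‖y‖ ≤ R → ψ (y + latticeHom d z) = 0 := by
  obtain ⟨R₀, hR₀⟩ := (Metric.isBounded_iff_subset_closedBall (0 : E d)).1
    h.hasCompactSupport.isCompact.isBounded
  obtain ⟨T, hT⟩ := exists_finset_lattice (d := d) R R₀
  refine ⟨T, fun z hz y hy => image_eq_zero_of_notMem_tsupport fun hmem => ?_⟩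
  have h1 := hT z hz y hy
  have h2 := mem_closedBall_zero_iff.1 (hR₀ hmem)
  linarith

theorem periodization_eq_sum {ψ : E d → ℝ} {R : ℝ} {T : Finset (Fin d → ℤ)}
    (hT : ∀ z ∉ T, ∀ y : E d, ‖y‖ ≤ R → ψ (y + latticeHom d z) = 0) {y : E d} (hy : ‖y‖ ≤ R) :
    periodization ψ y = ∑ z ∈ T, ψ (y + latticeHom d z) :=
  tsum_eq_sum fun z hz => hT z hz y hy

theorem periodization_eventuallyEq {ψ : E d → ℝ} {T : Finset (Fin d → ℤ)} (x : E d)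
    (hT : ∀ z ∉ T, ∀ y : E d, ‖y‖ ≤ ‖x‖ + 1 → ψ (y + latticeHom d z) = 0) :
    periodization ψ =ᶠ[𝓝 x] fun y => ∑ z ∈ T, ψ (y + latticeHom d z) := by
  filter_upwards [Metric.ball_mem_nhds x one_pos] with y hy
  refine periodization_eq_sum hT ?_
  have := norm_le_norm_add_norm_sub' y x
  rw [mem_ball_iff_norm] at hy
  linarith

theorem IsTest.contDiff_periodization {ψ : E d → ℝ} (h : IsTest ψ) :
    ContDiff ℝ ∞ (periodization ψ) := by
  rw [contDiff_iff_contDiffAt]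
  intro x
  obtain ⟨T, hT⟩ := h.exists_finset (‖x‖ + 1)
  refine ContDiffAt.congr_of_eventuallyEq ?_ (periodization_eventuallyEq x hT)
  exact ContDiffAt.sum fun z _ => (h.contDiff.comp (contDiff_id.add contDiff_const)).contDiffAt

/-- Near a given point the lattice sum is a fixed finite sum, so it may be differentiated term by
term. -/
theorem IsTest.partialDeriv_periodization {ψ : E d → ℝ} (h : IsTest ψ) (i : Fin d) (x : E d) :
    NeumannHomogenization.partialDeriv i (periodization ψ) x =
      periodization (NeumannHomogenization.partialDeriv i ψ) x := by
  obtain ⟨T, hT⟩ := h.exists_finset (‖x‖ + 1)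
  obtain ⟨T', hT'⟩ := (h.partialDeriv i).exists_finset (‖x‖ + 1)
  classical
  have hT1 : ∀ z ∉ T ∪ T', ∀ y : E d, ‖y‖ ≤ ‖x‖ + 1 → ψ (y + latticeHom d z) = 0 :=
    fun z hz => hT z fun h => hz (Finset.mem_union_left _ h)
  have hT2 : ∀ z ∉ T ∪ T', ∀ y : E d, ‖y‖ ≤ ‖x‖ + 1 →
      NeumannHomogenization.partialDeriv i ψ (y + latticeHom d z) = 0 :=
    fun z hz => hT' z fun h => hz (Finset.mem_union_right _ h)
  have hd : ∀ z, DifferentiableAt ℝ (fun y => ψ (y + latticeHom d z)) x := fun z =>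
    ((differentiable_of_contDiff h.contDiff).comp (differentiable_id.add_const _)) x
  rw [periodization_eq_sum hT2 (by linarith), NeumannHomogenization.partialDeriv,
    (periodization_eventuallyEq x hT1).fderiv_eq, fderiv_fun_sum (fun z _ => hd z), sum_apply]
  refine Finset.sum_congr rfl fun z _ => ?_
  exact partialDeriv_comp_add (latticeHom d z) i x

theorem LocL2.of_continuous {f : E d → ℝ} (hf : Continuous f) : LocL2 f := by
  simpa using (LocL2.const 1).mul_continuous hf

theorem hasWeakPartial_of_contDiff {u : E d → ℝ} (hu : ContDiff ℝ ∞ u) (i : Fin d) :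
    HasWeakPartial univ i u (partialDeriv i u) := by
  rw [hasWeakPartial_iff]
  exact ⟨hu.continuous.locallyIntegrable.locallyIntegrableOn _,
    (contDiff_partialDeriv hu i).continuous.locallyIntegrable.locallyIntegrableOn _,
    fun ψ hψ _ => integral_mul_partialDeriv hu hψ i⟩

theorem IsTest.isH1Per_periodization {ψ : E d → ℝ} (h : IsTest ψ) :
    IsH1Per (periodization ψ) (fun i => periodization (NeumannHomogenization.partialDeriv i ψ)) :=
        by
  refine ⟨isPeriodic_periodization ψ,
    (LocL2.of_continuous h.contDiff_periodization.continuous).memLp isBounded_cell, fun i =>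
      ⟨isPeriodic_periodization _, (LocL2.of_continuous
        (h.partialDeriv i).contDiff_periodization.continuous).memLp isBounded_cell, ?_⟩⟩
  have := hasWeakPartial_of_contDiff h.contDiff_periodization i
  rwa [show NeumannHomogenization.partialDeriv i (periodization ψ) =
    periodization (NeumannHomogenization.partialDeriv i ψ) from
      funext (h.partialDeriv_periodization i)] at this

/-- Unfolding: cut ℝ^d into translates of the cell and move each piece back by periodicity of `f`.
This is how the corrector equation, posed on the cell with periodic test functions, becomes an
equation on ℝ^d tested with compactly supported functions. -/
theorem integral_mul_test_eq_setIntegral_cell {f ψ : E d → ℝ} (hf : IsPeriodic f) (hL : LocL2 f)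
    (h : IsTest ψ) : ∫ x, f x * ψ x = ∫ y in cell d, f y * periodization ψ y := by
  rw [isAddFundamentalDomain_cell.integral_eq_tsum'' _ (hL.integrable_mul h),
    ← (latticeEquiv d).tsum_eq]
  simp only [latticeEquiv_vadd, hf.add_lattice]
  obtain ⟨R, hR⟩ := (Metric.isBounded_iff_subset_closedBall (0 : E d)).1 (isBounded_cell (d := d))
  obtain ⟨T, hT⟩ := h.exists_finset R
  have hc : ∀ y ∈ cell d, ‖y‖ ≤ R := fun y hy => mem_closedBall_zero_iff.1 (hR hy)
  rw [tsum_eq_sum (s := T) fun z hz => setIntegral_eq_zero_of_forall_eq_zero fun y hy => by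
    rw [hT z hz y (hc y hy), mul_zero], ← integral_finsetSum]
  · refine setIntegral_congr_fun measurableSet_cell fun y hy => ?_
    rw [periodization_eq_sum hT (hc y hy), Finset.mul_sum]
  · intro z _
    exact (hL.mul_continuous (h.continuous.comp (continuous_add_const
      (latticeHom d z)))).integrableOn isBounded_cell

/-! ### Periodic harmonic functions -/

theorem IsPeriodic.partialDeriv {u : E d → ℝ} (h : IsPeriodic u) (i : Fin d) :
    IsPeriodic (partialDeriv i u) := by
  intro y z
  rw [← partialDeriv_comp_add]
  congr 1
  exact funext fun x => h x z

/-- A translate of the cell is again a fundamental domain of the lattice. -/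
theorem setIntegral_cell_translate {f : E d → ℝ} (hf : IsPeriodic f) (v : E d) :
    ∫ y in cell d, f (y + v) = ∫ y in cell d, f y := by
  have h1 : IsAddFundamentalDomain (lattice d) ((fun x => x - v) ⁻¹' cell d) volume := by
    refine IsAddFundamentalDomain.mk' ?_ fun x => ?_
    · exact (measurable_sub_const v measurableSet_cell).nullMeasurableSet
    · obtain ⟨z, hz, hu⟩ := existsUnique_add_lattice_mem_cell (x - v)
      refine ⟨latticeEquiv d z, ?_, fun g hg => ?_⟩
      · simp only [latticeEquiv_vadd, mem_preimage]
        convert hz using 1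
        abel
      obtain ⟨z', rfl⟩ := (latticeEquiv d).surjective g
      simp only [latticeEquiv_vadd, mem_preimage] at hg
      rw [hu z' (by convert hg using 1; abel)]
  have h2 : ∫ y in cell d, f y = ∫ y in (fun x => x - v) ⁻¹' cell d, f y := by
    refine isAddFundamentalDomain_cell.setIntegral_eq h1 fun g x => ?_
    obtain ⟨z, rfl⟩ := (latticeEquiv d).surjective g
    rw [latticeEquiv_vadd, hf.add_lattice]
  have h3 := (measurePreserving_sub_right volume v).setIntegral_preimage_emb
    (measurableEmbedding_subRight v) (fun y => f (y + v)) (cell d)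
  simp only [sub_add_cancel] at h3
  rw [h2, ← h3]

/-- The integral is the derivative at t = 0 of t ↦ ∫_Y u(y + t e_i), which is constant in t by
translation invariance. This replaces the divergence theorem on the cell. -/
theorem setIntegral_cell_partialDeriv {u : E d → ℝ} (hu : ContDiff ℝ ∞ u) (hp : IsPeriodic u)
    (i : Fin d) : ∫ y in cell d, partialDeriv i u y = 0 := by
  set e : E d := EuclideanSpace.single i 1 with he
  obtain ⟨R, hR⟩ := (Metric.isBounded_iff_subset_closedBall (0 : E d)).1 (isBounded_cell (d := d))
  have hc : Continuous (partialDeriv i u) := (contDiff_partialDeriv hu i).continuous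
  obtain ⟨C, hC⟩ := (isCompact_closedBall (0 : E d) (R + 1)).exists_bound_of_continuousOn
    hc.continuousOn
  have hfin : IsFiniteMeasure (volume.restrict (cell d)) :=
    ⟨by rw [Measure.restrict_apply_univ, volume_cell]; simp⟩
  have key := hasDerivAt_integral_of_dominated_loc_of_deriv_le (μ := volume.restrict (cell d))
    (F := fun (t : ℝ) y => u (y + t • e)) (F' := fun t y => partialDeriv i u (y + t • e))
    (x₀ := 0) (s := Metric.ball 0 1) (bound := fun _ => C) (Metric.ball_mem_nhds 0 one_pos)
    (Eventually.of_forall fun t =>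
      (hu.continuous.comp (continuous_add_const _)).aestronglyMeasurable)
    ((LocL2.of_continuous (hu.continuous.comp (continuous_add_const _))).integrableOn
      isBounded_cell)
    (hc.comp (continuous_add_const _)).aestronglyMeasurable
    (by
      filter_upwards [ae_restrict_mem measurableSet_cell] with y hy t ht
      refine hC _ (mem_closedBall_zero_iff.2 ((norm_add_le _ _).trans (add_le_add
        (mem_closedBall_zero_iff.1 (hR hy)) ?_)))
      rw [norm_smul, he, PiLp.norm_single, norm_one, mul_one]
      exact (mem_ball_zero_iff.1 ht).le)
    (integrable_const C)
    (by
      refine Eventually.of_forall fun y t _ => ?_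
      have h1 : HasDerivAt (fun t : ℝ => y + t • e) e t := by
        simpa using ((hasDerivAt_id t).smul_const e).const_add y
      exact (differentiable_of_contDiff hu (y + t • e)).hasFDerivAt.comp_hasDerivAt t h1)
  have h0 := key.2
  simp only [setIntegral_cell_translate hp, zero_smul, add_zero] at h0
  exact h0.unique (hasDerivAt_const 0 _)

theorem IsPeriodic.mul {f g : E d → ℝ} (hf : IsPeriodic f) (hg : IsPeriodic g) :
    IsPeriodic (fun x => f x * g x) := fun y z => by simp only [hf y z, hg y z]

/-- Energy argument: integrating div(u∇u) = uΔu + |∇u|² over the cell gives ∫_Y |∇u|² = 0. -/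
theorem partialDeriv_eq_zero_of_harmonic {u : E d → ℝ} (hu : ContDiff ℝ ∞ u) (hp : IsPeriodic u)
    (hh : ∀ x, ∑ i, partialDeriv i (partialDeriv i u) x = 0) (i : Fin d) (x : E d) :
    partialDeriv i u x = 0 := by
  have hD : ∀ i, ContDiff ℝ ∞ (partialDeriv i u) := contDiff_partialDeriv hu
  have hint : ∀ v : E d → ℝ, Continuous v → IntegrableOn v (cell d) := fun v hv =>
    (LocL2.of_continuous hv).integrableOn isBounded_cell
  have h1 : ∀ i, ∫ y in cell d, (u y * partialDeriv i (partialDeriv i u) y +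
      partialDeriv i u y * partialDeriv i u y) = 0 := by
    intro i
    have := setIntegral_cell_partialDeriv (hu.mul (hD i)) (hp.mul (hp.partialDeriv i)) i
    simpa only [partialDeriv_mul hu (hD i)] using this
  have h2 : ∫ y in cell d, ∑ i, partialDeriv i u y * partialDeriv i u y = 0 := by
    have h3 : ∫ y in cell d, ∑ i, (u y * partialDeriv i (partialDeriv i u) y +
        partialDeriv i u y * partialDeriv i u y) = 0 := by
      rw [integral_finsetSum]
      · simp only [h1, Finset.sum_const_zero]
      · exact fun i _ => hint _ ((hu.continuous.mul
          (contDiff_partialDeriv (hD i) i).continuous).add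
            ((hD i).continuous.mul (hD i).continuous))
    rw [← h3]
    refine integral_congr_ae (Eventually.of_forall fun y => ?_)
    simp only [Finset.sum_add_distrib, ← Finset.mul_sum, hh, mul_zero, zero_add]
  have hcont : Continuous fun y => ∑ i, partialDeriv i u y * partialDeriv i u y :=
    continuous_finsetSum _ fun i _ => (hD i).continuous.mul (hD i).continuous
  have h4 : ∀ᵐ y : E d, ∑ i, partialDeriv i u y * partialDeriv i u y = 0 := by
    refine ae_of_ae_cell (fun y z h => ?_) ((integral_eq_zero_iff_of_nonneg
      (fun y => Finset.sum_nonneg fun i _ => mul_self_nonneg _) (hint _ hcont)).1 h2)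
    simpa only [fun i => (hp.partialDeriv i).add_lattice] using h
  have h5 : (fun y => ∑ i, partialDeriv i u y * partialDeriv i u y) = fun _ => 0 :=
    (hcont.ae_eq_iff_eq volume continuous_const).1 h4
  have h6 := congrFun h5 x
  simpa using (Finset.sum_eq_zero_iff_of_nonneg (fun i _ => mul_self_nonneg _)).1 h6 i
    (Finset.mem_univ i)

/-! ### Convolution with a test function -/

/-- The convolution `g * ρ`. -/
def conv (g ρ : E d → ℝ) (x : E d) : ℝ := ∫ y, g y * ρ (x - y)

theorem conv_eq (g ρ : E d → ℝ) :
    conv g ρ = convolution g ρ (ContinuousLinearMap.lsmul ℝ ℝ) volume := rfl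

theorem IsTest.contDiff_conv {g ρ : E d → ℝ} (hg : LocallyIntegrable g) (h : IsTest ρ) :
    ContDiff ℝ ∞ (conv g ρ) := by
  rw [conv_eq]
  exact h.hasCompactSupport.contDiff_convolution_right _ hg h.contDiff

theorem IsTest.partialDeriv_conv {g ρ : E d → ℝ} (hg : LocallyIntegrable g) (h : IsTest ρ)
    (i : Fin d) : NeumannHomogenization.partialDeriv i (conv g ρ) =
      conv g (NeumannHomogenization.partialDeriv i ρ) := by
  ext x
  have h1 : ContDiff ℝ 1 ρ := h.contDiff.of_le (by simp)
  have := h.hasCompactSupport.hasFDerivAt_convolution_right (ContinuousLinearMap.lsmul ℝ ℝ) hg h1 x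
  rw [NeumannHomogenization.partialDeriv, conv_eq, this.fderiv, convolution_precompR_apply _ hg
    (h.hasCompactSupport.fderiv ℝ) (h1.continuous_fderiv (by simp))]
  rfl

theorem IsPeriodic.conv {g : E d → ℝ} (hg : IsPeriodic g) (ρ : E d → ℝ) :
    IsPeriodic (conv g ρ) := by
  intro y z
  unfold NeumannHomogenization.conv
  rw [← integral_add_right_eq_self _ (latticeHom d z)]
  refine integral_congr_ae (Eventually.of_forall fun x => ?_)
  simp only [hg.add_lattice]
  congr 2
  exact add_sub_add_right_eq_sub _ _ _

theorem IsTest.comp_sub_left {ψ : E d → ℝ} (h : IsTest ψ) (x : E d) :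
    IsTest (fun y => ψ (x - y)) :=
  ⟨h.contDiff.comp (contDiff_const.sub contDiff_id),
    h.hasCompactSupport.comp_homeomorph (Homeomorph.subLeft x)⟩

theorem partialDeriv_comp_sub_left {ψ : E d → ℝ} (h : ContDiff ℝ ∞ ψ) (x : E d) (i : Fin d)
    (y : E d) : partialDeriv i (fun y => ψ (x - y)) y = -partialDeriv i ψ (x - y) := by
  unfold partialDeriv
  have h2 : HasFDerivAt (fun y : E d => x - y) (-ContinuousLinearMap.id ℝ (E d)) y :=
    (hasFDerivAt_id y).const_sub x
  have h := (differentiable_of_contDiff h (x - y)).hasFDerivAt.comp y h2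
  rw [show (fun y => ψ (x - y)) = ψ ∘ (fun y : E d => x - y) from rfl, h.fderiv]
  simp

/-- A periodic function which is harmonic in the sense of distributions is constant. -/
theorem integral_mul_partialDeriv_eq_zero_of_harmonic {g : E d → ℝ} (hp : IsPeriodic g)
    (hL : LocL2 g)
    (hh : ∀ ψ, IsTest ψ → ∫ x, g x * ∑ i, partialDeriv i (partialDeriv i ψ) x = 0)
    {ψ : E d → ℝ} (h : IsTest ψ) (i : Fin d) : ∫ x, g x * partialDeriv i ψ x = 0 := by
  have hg := hL.locallyIntegrable
  -- Convolution with the reflection of ψ smooths g while keeping it periodic and harmonic, and the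
  -- i-th derivative of the convolution at the origin is -∫ g ∂_iψ.
  set ρ : E d → ℝ := fun x => ψ (0 - x) with hρ
  have hρt : IsTest ρ := h.comp_sub_left 0
  have h0 := partialDeriv_eq_zero_of_harmonic (hρt.contDiff_conv hg) (hp.conv ρ) ?_ i 0
  · rw [hρt.partialDeriv_conv hg i] at h0
    have h1 : partialDeriv i ρ = fun x => -partialDeriv i ψ (0 - x) :=
      funext fun x => partialDeriv_comp_sub_left h.contDiff 0 i x
    rw [h1] at h0
    simpa [conv, integral_neg] using h0
  · intro x
    have h2 := hh _ (hρt.comp_sub_left x)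
    have h3 : ∀ j, partialDeriv j (partialDeriv j fun y => ρ (x - y)) =
        fun y => partialDeriv j (partialDeriv j ρ) (x - y) := by
      intro j
      have e1 : (partialDeriv j fun y => ρ (x - y)) = fun y => (-1) * partialDeriv j ρ (x - y) :=
        funext fun y => by rw [partialDeriv_comp_sub_left hρt.contDiff]; ring
      ext y
      rw [e1, partialDeriv_mul contDiff_const ((hρt.partialDeriv j).comp_sub_left x).contDiff,
        partialDeriv_comp_sub_left (hρt.partialDeriv j).contDiff]
      simp [partialDeriv]
    simp only [h3, Finset.mul_sum] at h2
    rw [integral_finsetSum _ fun j _ =>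
      hL.integrable_mul (((hρt.partialDeriv j).partialDeriv j).comp_sub_left x)] at h2
    rw [← h2]
    refine Finset.sum_congr rfl fun j _ => ?_
    rw [hρt.partialDeriv_conv hg, (hρt.partialDeriv j).partialDeriv_conv hg]
    rfl

variable {m : ℕ}

/-! ### Weak divergence and flux correctors -/

/-- `q` is the divergence of the vector field `P` on `ℝ^d` in the sense of distributions. -/
structure HasWeakDiv (P : Fin d → E d → ℝ) (q : E d → ℝ) : Prop where
  left : ∀ j, LocL2 (P j)
  right : LocL2 q
  sum_integral : ∀ ψ, IsTest ψ → ∑ j, ∫ x, P j x * partialDeriv j ψ x = -∫ x, q x * ψ x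

theorem IsH1Per.locL2 {u : E d → ℝ} {Du : Fin d → E d → ℝ} (h : IsH1Per u Du) : LocL2 u :=
  LocL2.of_isPeriodic h.1 h.2.1

theorem IsH1Per.locL2_partial {u : E d → ℝ} {Du : Fin d → E d → ℝ} (h : IsH1Per u Du) (i : Fin d) :
    LocL2 (Du i) :=
  LocL2.of_isPeriodic (h.2.2 i).1 (h.2.2 i).2.1

theorem LocL2.congr_ae {f g : E d → ℝ} (hf : LocL2 f) (h : ∀ᵐ y : E d, f y = g y) : LocL2 g :=
  fun R => (hf R).ae_eq (ae_restrict_of_ae h)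

theorem IsPeriodicPoissonSolution.hasWeakDiv {f θ : E d → ℝ} {Dθ : Fin d → E d → ℝ}
    (h : IsPeriodicPoissonSolution f θ Dθ) : HasWeakDiv Dθ f := by
  obtain ⟨h1, -, D2, h2, h3⟩ := h
  have hD : ∀ i, LocL2 (D2 i i) := fun i => (h2 i).locL2_partial i
  refine ⟨h1.locL2_partial, (LocL2.sum Finset.univ hD).congr_ae h3, fun ψ hψ => ?_⟩
  have e1 : ∀ j, ∫ x, Dθ j x * partialDeriv j ψ x = -∫ x, D2 j j x * ψ x :=
    fun j => ((h2 j).2.2 j).2.2.integral_eq hψ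
  simp only [e1, Finset.sum_neg_distrib]
  rw [← integral_finsetSum _ fun j _ => (hD j).integrable_mul hψ]
  congr 1
  refine integral_congr_ae ?_
  filter_upwards [h3] with x hx
  rw [← hx, Finset.sum_mul]

theorem IsPeriodic.sum {ι : Type*} (s : Finset ι) {f : ι → E d → ℝ} (hf : ∀ i, IsPeriodic (f i)) :
    IsPeriodic (fun x => ∑ i ∈ s, f i x) :=
  fun y z => Finset.sum_congr rfl fun i _ => hf i y z

/-- Formally ∑_j ∂_j(∂_jθ_i - ∂_iθ_j) = Δθ_i - ∂_i(div θ) = b_i - ∂_i(div θ). Moreover Δ(div θ) =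
div b = 0, so div θ is periodic and harmonic, hence constant, and the last term drops. -/
theorem hasWeakDiv_sub_of_poisson {b θ : Fin d → E d → ℝ} {Dθ : Fin d → Fin d → E d → ℝ}
    (hθ : ∀ i, IsPeriodicPoissonSolution (b i) (θ i) (Dθ i))
    (hb : ∀ ψ, IsTest ψ → ∑ i, ∫ x, b i x * partialDeriv i ψ x = 0) (i : Fin d) :
    HasWeakDiv (fun j x => Dθ i j x - Dθ j i x) (b i) := by
  have hD : ∀ i j, LocL2 (Dθ i j) := fun i j => (hθ i).hasWeakDiv.left j
  refine ⟨fun j => (hD i j).sub (hD j i), (hθ i).hasWeakDiv.right, fun ψ hψ => ?_⟩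
  have hw : ∀ i j ζ, IsTest ζ →
      ∫ x, θ i x * partialDeriv j ζ x = -∫ x, Dθ i j x * ζ x := fun i j ζ hζ =>
    ((hθ i).1.2.2 j).2.2.integral_eq hζ
  have hg : LocL2 (fun x => ∑ j, Dθ j j x) := LocL2.sum _ fun j => hD j j
  have hint : ∀ ζ, IsTest ζ → ∫ x, (∑ j, Dθ j j x) * ζ x = ∑ j, ∫ x, Dθ j j x * ζ x := by
    intro ζ hζ
    simp only [Finset.sum_mul]
    exact integral_finsetSum _ fun j _ => (hD j j).integrable_mul hζ
  -- The sum of the `Dθ j j` is div θ; its distributional gradient vanishes by the Liouville theorem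
  -- above.
  have hzero : ∫ x, (∑ j, Dθ j j x) * partialDeriv i ψ x = 0 := by
    refine integral_mul_partialDeriv_eq_zero_of_harmonic
      (IsPeriodic.sum _ fun j => ((hθ j).1.2.2 j).1) hg (fun ζ hζ => ?_) hψ i
    have hζ2 : ∀ k, IsTest (partialDeriv k (partialDeriv k ζ)) :=
      fun k => (hζ.partialDeriv k).partialDeriv k
    simp only [Finset.mul_sum]
    rw [integral_finsetSum _ fun k _ => hg.integrable_mul (hζ2 k)]
    simp only [fun k => hint _ (hζ2 k)]
    rw [Finset.sum_comm]
    -- Both sides equal -∫ θ_j ∂_j∂_k∂_kζ. Summed over k, the right side is the weak form of Δθ_j =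
    -- b_j tested with ∂_jζ.
    have e1 : ∀ j k, ∫ x, Dθ j j x * partialDeriv k (partialDeriv k ζ) x =
        ∫ x, Dθ j k x * partialDeriv k (partialDeriv j ζ) x := by
      intro j k
      have a1 := hw j j _ (hζ2 k)
      have a2 := hw j k _ ((hζ.partialDeriv j).partialDeriv k)
      have a3 : partialDeriv j (partialDeriv k (partialDeriv k ζ)) =
          partialDeriv k (partialDeriv k (partialDeriv j ζ)) := by
        rw [← (funext fun x => partialDeriv_comm hζ.contDiff j k x :
          partialDeriv j (partialDeriv k ζ) = partialDeriv k (partialDeriv j ζ))]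
        exact funext fun x => partialDeriv_comm (hζ.partialDeriv k).contDiff j k x
      rw [a3] at a1
      linarith
    simp only [e1, fun j => (hθ j).hasWeakDiv.sum_integral _ (hζ.partialDeriv j),
      Finset.sum_neg_distrib, hb ζ hζ, neg_zero]
  have e2 : ∀ j, ∫ x, Dθ j i x * partialDeriv j ψ x = ∫ x, Dθ j j x * partialDeriv i ψ x := by
    intro j
    have a1 := hw j i _ (hψ.partialDeriv j)
    have a2 := hw j j _ (hψ.partialDeriv i)
    rw [show partialDeriv i (partialDeriv j ψ) = partialDeriv j (partialDeriv i ψ) from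
      funext fun x => partialDeriv_comm hψ.contDiff i j x] at a1
    linarith
  have e3 : ∀ j, ∫ x, (Dθ i j x - Dθ j i x) * partialDeriv j ψ x =
      (∫ x, Dθ i j x * partialDeriv j ψ x) - ∫ x, Dθ j i x * partialDeriv j ψ x := by
    intro j
    simp only [sub_mul]
    exact integral_sub ((hD i j).integrable_mul (hψ.partialDeriv j))
      ((hD j i).integrable_mul (hψ.partialDeriv j))
  simp only [e3, e2, Finset.sum_sub_distrib]
  rw [← hint _ (hψ.partialDeriv i), hzero, sub_zero, (hθ i).hasWeakDiv.sum_integral ψ hψ]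

/-- The factor ε in front of the field compensates the ε⁻¹ of the chain rule. It is the source of
the smallness of the oscillating terms. -/
theorem HasWeakDiv.rescale {P : Fin d → E d → ℝ} {q : E d → ℝ} (h : HasWeakDiv P q) {ε : ℝ}
    (hε : 0 < ε) : HasWeakDiv (fun j x => ε * P j (ε⁻¹ • x)) (fun x => q (ε⁻¹ • x)) := by
  have hε' := inv_pos.2 hε
  refine ⟨fun j => ((h.left j).comp_smul hε').const_mul ε, h.right.comp_smul hε', fun ψ hψ => ?_⟩
  have h1 := h.sum_integral _ (hψ.comp_smul hε.ne')
  simp only [partialDeriv_comp_smul hψ.contDiff] at h1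
  have h2 : ∀ j, ∫ x, ε * P j (ε⁻¹ • x) * partialDeriv j ψ x =
      ε ^ d * ∫ y, P j y * (ε * partialDeriv j ψ (ε • y)) := by
    intro j
    rw [← integral_comp_smul_mul (ψ := fun x => ε * partialDeriv j ψ x) hε]
    congr 1 with x
    ring
  simp only [h2]
  rw [← Finset.mul_sum, h1, integral_comp_smul_mul hε]
  ring

/-! ### Pointwise and integral bounds for correctors -/

theorem Coefficients.IsAdmissible.locL2_matrix_mul {𝒜 : Coefficients d m} {μ κ : ℝ}
    (h : 𝒜.IsAdmissible μ κ) (i : Fin d) (α : Fin m) {D : Fin d → Fin m → E d → ℝ}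
    (hD : ∀ j β, LocL2 (D j β)) : LocL2 (fun y => ∑ j, ∑ β, 𝒜.a i j α β y * D j β y) :=
  LocL2.sum _ fun j => LocL2.sum _ fun β =>
    LocL2.bdd_mul (h.measurable_a i j α β) (h.bounded_a i j α β) (hD j β)

theorem Coefficients.IsAdmissible.locL2_flux {𝒜 : Coefficients d m} {μ κ : ℝ}
    (h : 𝒜.IsAdmissible μ κ) {Dχ : Fin (d + 1) → Fin d → Fin m → Fin m → E d → ℝ}
    (hD : ∀ k j β γ, LocL2 (Dχ k j β γ)) (k : Fin (d + 1)) (i : Fin d) (α γ : Fin m) :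
    LocL2 (𝒜.flux Dχ k i α γ) := by
  refine LocL2.add ?_ (h.locL2_matrix_mul i α fun j β => hD k j β γ)
  refine Fin.cases ?_ (fun l => ?_) k
  · exact LocL2.of_bdd (h.measurable_V i α γ) (h.bounded_V i α γ)
  · exact LocL2.of_bdd (h.measurable_a i l α γ) (h.bounded_a i l α γ)

theorem Coefficients.IsAdmissible.isPeriodic_flux {𝒜 : Coefficients d m} {μ κ : ℝ}
    (h : 𝒜.IsAdmissible μ κ) {Dχ : Fin (d + 1) → Fin d → Fin m → Fin m → E d → ℝ}
    (hD : ∀ k j β γ, IsPeriodic (Dχ k j β γ)) (k : Fin (d + 1)) (i : Fin d) (α γ : Fin m) :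
    IsPeriodic (𝒜.flux Dχ k i α γ) := by
  intro y z
  unfold Coefficients.flux
  congr 1
  · refine Fin.cases ?_ (fun l => ?_) k
    · exact h.periodic_V i α γ y z
    · exact h.periodic_a i l α γ y z
  · exact Finset.sum_congr rfl fun j _ => Finset.sum_congr rfl fun β _ => by
      rw [h.periodic_a i j α β y z, hD k j β γ y z]

theorem integral_partialDeriv_eq_zero {ψ : E d → ℝ} (h : IsTest ψ) (i : Fin d) :
    ∫ x, partialDeriv i ψ x = 0 := by
  simpa [partialDeriv] using integral_mul_partialDeriv (u := fun _ => 1) contDiff_const h i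

theorem Coefficients.IsCorrector.locL2 {𝒜 : Coefficients d m}
    {χ : Fin (d + 1) → Fin m → Fin m → E d → ℝ}
    {Dχ : Fin (d + 1) → Fin d → Fin m → Fin m → E d → ℝ} (hχ : 𝒜.IsCorrector χ Dχ)
    (k j β γ) : LocL2 (Dχ k j β γ) := (hχ.1 k β γ).1.locL2_partial j

/-- The constant mean integrates to zero against ∂_iψ, and the flux of the corrector is divergence
free: unfolding turns the sum into the corrector equation tested with the periodization of ψ. -/
theorem Coefficients.IsCorrector.sum_integral_b {𝒜 : Coefficients d m} {μ κ : ℝ}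
    (h : 𝒜.IsAdmissible μ κ) {χ : Fin (d + 1) → Fin m → Fin m → E d → ℝ}
    {Dχ : Fin (d + 1) → Fin d → Fin m → Fin m → E d → ℝ} (hχ : 𝒜.IsCorrector χ Dχ)
    (k : Fin (d + 1)) (α γ : Fin m) {ψ : E d → ℝ} (hψ : IsTest ψ) :
    ∑ i, ∫ x, 𝒜.b Dχ k i α γ x * partialDeriv i ψ x = 0 := by
  have hL := h.locL2_flux hχ.locL2
  have hp := h.isPeriodic_flux (fun k j β γ => ((hχ.1 k β γ).1.2.2 j).1)
  have e1 : ∀ i, ∫ x, 𝒜.b Dχ k i α γ x * partialDeriv i ψ x =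
      -∫ y in cell d, 𝒜.flux Dχ k i α γ y * periodization (partialDeriv i ψ) y := by
    intro i
    rw [← integral_mul_test_eq_setIntegral_cell (hp k i α γ) (hL k i α γ) (hψ.partialDeriv i)]
    simp only [Coefficients.b, sub_mul]
    rw [integral_sub ((LocL2.const _).integrable_mul (hψ.partialDeriv i))
      ((hL k i α γ).integrable_mul (hψ.partialDeriv i)), integral_const_mul,
      integral_partialDeriv_eq_zero hψ]
    simp
  have hz : IsH1Per (fun _ : E d => (0 : ℝ)) (fun _ _ => 0) :=
    ⟨fun _ _ => rfl, MemLp.zero', fun i => ⟨fun _ _ => rfl, MemLp.zero', HasWeakPartial.zero _ _⟩⟩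
  -- A vector test function with a single nonzero component isolates the row α.
  have h2 := hχ.2 k γ (fun α' => if α' = α then periodization ψ else fun _ => 0)
    (fun i α' => if α' = α then periodization (partialDeriv i ψ) else fun _ => 0) (fun α' => by
      by_cases hα : α' = α
      · simpa [hα] using hψ.isH1Per_periodization
      · simpa [hα] using hz)
  simp only [e1, Finset.sum_neg_distrib, neg_eq_zero]
  rw [← integral_finsetSum]
  · rw [← h2]
    refine integral_congr_ae (Eventually.of_forall fun y => Finset.sum_congr rfl fun i _ => ?_)
    rw [Finset.sum_eq_single α (fun β _ hβ => by simp [hβ]) (by simp)]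
    simp
  · intro i _
    exact ((hL k i α γ).mul_continuous
      (hψ.partialDeriv i).contDiff_periodization.continuous).integrableOn isBounded_cell


theorem le_sum_of_le {ι : Type*} [Fintype ι] {f : ι → ℝ} (hf : ∀ i, 0 ≤ f i) (i : ι) {x : ℝ}
    (hx : x ≤ f i) : x ≤ ∑ i, f i :=
  hx.trans (Finset.single_le_sum (fun i _ => hf i) (Finset.mem_univ i))

theorem le_sum₂ {ι κ : Type*} [Fintype ι] [Fintype κ] {f : ι → κ → ℝ} (hf : ∀ i j, 0 ≤ f i j)
    (i : ι) (j : κ) : f i j ≤ ∑ i, ∑ j, f i j :=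
  le_sum_of_le (fun i => Finset.sum_nonneg fun j _ => hf i j) i (le_sum_of_le (hf i) j le_rfl)

theorem le_sum₃ {ι κ τ : Type*} [Fintype ι] [Fintype κ] [Fintype τ] {f : ι → κ → τ → ℝ}
    (hf : ∀ i j k, 0 ≤ f i j k) (i : ι) (j : κ) (k : τ) : f i j k ≤ ∑ i, ∑ j, ∑ k, f i j k :=
  le_sum_of_le (fun i => Finset.sum_nonneg fun j _ => Finset.sum_nonneg fun k _ => hf i j k) i
    (le_sum₂ (hf i) j k)

theorem le_sum₄ {ι κ τ σ : Type*} [Fintype ι] [Fintype κ] [Fintype τ] [Fintype σ]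
    {f : ι → κ → τ → σ → ℝ} (hf : ∀ i j k l, 0 ≤ f i j k l) (i : ι) (j : κ) (k : τ) (l : σ) :
    f i j k l ≤ ∑ i, ∑ j, ∑ k, ∑ l, f i j k l :=
  le_sum_of_le (fun i => Finset.sum_nonneg fun j _ => Finset.sum_nonneg fun k _ =>
    Finset.sum_nonneg fun l _ => hf i j k l) i (le_sum₃ (hf i) j k l)

/-! ### The entries of the weight -/

section weight

variable (𝒜 : Coefficients d m) (χ : Fin (d + 1) → Fin m → Fin m → E d → ℝ)
  (Dχ : Fin (d + 1) → Fin d → Fin m → Fin m → E d → ℝ)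
  (Dθ : Fin (d + 1) → Fin d → Fin d → Fin m → Fin m → E d → ℝ)
  (Dϑ : Fin (d + 1) → Fin d → Fin m → Fin m → E d → ℝ) (y : E d)

theorem Coefficients.abs_entries_le_weight :
    (∀ i j α β, |𝒜.a i j α β y| ≤ 𝒜.weight χ Dχ Dθ Dϑ y) ∧
    (∀ i α β, |𝒜.V i α β y| ≤ 𝒜.weight χ Dχ Dθ Dϑ y) ∧
    (∀ i α β, |𝒜.B i α β y| ≤ 𝒜.weight χ Dχ Dθ Dϑ y) ∧
    (∀ α β, |𝒜.c α β y| ≤ 𝒜.weight χ Dχ Dθ Dϑ y) ∧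
    (∀ k α γ, |χ k α γ y| ≤ 𝒜.weight χ Dχ Dθ Dϑ y) ∧
    (∀ k i α γ, |𝒜.b Dχ k i α γ y| ≤ 𝒜.weight χ Dχ Dθ Dϑ y) ∧
    (∀ k j i α γ, |fluxCorrector Dθ k j i α γ y| ≤ 𝒜.weight χ Dχ Dθ Dϑ y) ∧
    (∀ k i α γ, |Dϑ k i α γ y| ≤ 𝒜.weight χ Dχ Dθ Dϑ y) := by
  have h1 : 0 ≤ ∑ i, ∑ j, ∑ α, ∑ β, |𝒜.a i j α β y| :=
    Finset.sum_nonneg fun _ _ => Finset.sum_nonneg fun _ _ => Finset.sum_nonneg fun _ _ =>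
        Finset.sum_nonneg fun _ _ => abs_nonneg _
  have h2 : 0 ≤ ∑ i, ∑ α, ∑ β, |𝒜.V i α β y| :=
    Finset.sum_nonneg fun _ _ => Finset.sum_nonneg fun _ _ => Finset.sum_nonneg fun _ _ =>
        abs_nonneg _
  have h3 : 0 ≤ ∑ i, ∑ α, ∑ β, |𝒜.B i α β y| :=
    Finset.sum_nonneg fun _ _ => Finset.sum_nonneg fun _ _ => Finset.sum_nonneg fun _ _ =>
        abs_nonneg _
  have h4 : 0 ≤ ∑ α, ∑ β, |𝒜.c α β y| :=
    Finset.sum_nonneg fun _ _ => Finset.sum_nonneg fun _ _ => abs_nonneg _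
  have h5 : 0 ≤ ∑ k, ∑ α, ∑ γ, |χ k α γ y| :=
    Finset.sum_nonneg fun _ _ => Finset.sum_nonneg fun _ _ => Finset.sum_nonneg fun _ _ =>
        abs_nonneg _
  have h6 : 0 ≤ ∑ k, ∑ i, ∑ α, ∑ γ, |𝒜.b Dχ k i α γ y| :=
    Finset.sum_nonneg fun _ _ => Finset.sum_nonneg fun _ _ => Finset.sum_nonneg fun _ _ =>
        Finset.sum_nonneg fun _ _ => abs_nonneg _
  have h7 : 0 ≤ ∑ k, ∑ j, ∑ i, ∑ α, ∑ γ, |fluxCorrector Dθ k j i α γ y| :=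
    Finset.sum_nonneg fun _ _ => Finset.sum_nonneg fun _ _ => Finset.sum_nonneg fun _ _ =>
        Finset.sum_nonneg fun _ _ => Finset.sum_nonneg fun _ _ => abs_nonneg _
  have h8 : 0 ≤ ∑ k, ∑ i, ∑ α, ∑ γ, |Dϑ k i α γ y| :=
    Finset.sum_nonneg fun _ _ => Finset.sum_nonneg fun _ _ => Finset.sum_nonneg fun _ _ =>
        Finset.sum_nonneg fun _ _ => abs_nonneg _
  have h7' : ∀ k, 0 ≤ ∑ j, ∑ i, ∑ α, ∑ γ, |fluxCorrector Dθ k j i α γ y| := fun k =>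
    Finset.sum_nonneg fun _ _ => Finset.sum_nonneg fun _ _ => Finset.sum_nonneg fun _ _ =>
    Finset.sum_nonneg fun _ _ => abs_nonneg _
  have g1 := fun i j => le_sum₄ (fun i j α β => abs_nonneg (𝒜.a i j α β y)) i j
  have g2 := fun i => le_sum₃ (fun i α β => abs_nonneg (𝒜.V i α β y)) i
  have g3 := fun i => le_sum₃ (fun i α β => abs_nonneg (𝒜.B i α β y)) i
  have g4 := fun α => le_sum₂ (fun α β => abs_nonneg (𝒜.c α β y)) α
  have g5 := fun k => le_sum₃ (fun k α γ => abs_nonneg (χ k α γ y)) k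
  have g6 := fun k => le_sum₄ (fun k i α γ => abs_nonneg (𝒜.b Dχ k i α γ y)) k
  have g7 := fun k j i α γ => le_sum_of_le (fun k => h7' k) k
    (le_sum₄ (fun j i α γ => abs_nonneg (fluxCorrector Dθ k j i α γ y)) j i α γ)
  have g8 := fun k => le_sum₄ (fun k i α γ => abs_nonneg (Dϑ k i α γ y)) k
  unfold Coefficients.weight
  refine ⟨fun i j α β => ?_, fun i α β => ?_, fun i α β => ?_, fun α β => ?_, fun k α γ => ?_,
    fun k i α γ => ?_, fun k j i α γ => ?_, fun k i α γ => ?_⟩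
  · linarith [g1 i j α β]
  · linarith [g2 i α β]
  · linarith [g3 i α β]
  · linarith [g4 α β]
  · linarith [g5 k α γ]
  · linarith [g6 k i α γ]
  · linarith [g7 k j i α γ]
  · linarith [g8 k i α γ]

end weight

/-! ### Bounds for the correctors -/

theorem sum_quadratic_eq (a : Fin d → Fin d → Fin m → Fin m → ℝ) (ξ : Fin d → Fin m → ℝ) :
    ∑ i, ∑ j, ∑ α, ∑ β, a i j α β * ξ i α * ξ j β =
      ∑ i, ∑ α, (∑ j, ∑ β, a i j α β * ξ j β) * ξ i α := by
  refine Finset.sum_congr rfl fun i _ => ?_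
  rw [Finset.sum_comm]
  refine Finset.sum_congr rfl fun α _ => ?_
  rw [Finset.sum_mul]
  refine Finset.sum_congr rfl fun j _ => ?_
  rw [Finset.sum_mul]
  exact Finset.sum_congr rfl fun β _ => by ring

/-- Young's inequality in the form used for absorption. -/
theorem neg_mul_le_add_sq {μ K s t : ℝ} (hμ : 0 < μ) (hs : |s| ≤ K) :
    s * t ≤ K ^ 2 / (2 * μ) + μ / 2 * t ^ 2 := by
  have h1 : s * t ≤ K * |t| := (le_abs_self _).trans (by
    rw [abs_mul]; exact mul_le_mul_of_nonneg_right hs (abs_nonneg t))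
  have h2 : 0 ≤ (K - μ * |t|) ^ 2 / (2 * μ) := by positivity
  have h3 : (K - μ * |t|) ^ 2 / (2 * μ) = K ^ 2 / (2 * μ) + μ / 2 * t ^ 2 - K * |t| := by
    rw [← sq_abs t]
    field_simp
    ring
  linarith

theorem sum_sum_const_add_mul (c e : ℝ) (ξ : Fin d → Fin m → ℝ) :
    ∑ i, ∑ α, (c + e * ξ i α ^ 2) = d * m * c + e * ∑ i, ∑ α, ξ i α ^ 2 := by
  simp only [Finset.sum_add_distrib, Finset.mul_sum]
  simp
  ring

/-- The bound for the entries of the homogenized coefficients. -/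
def meanBound (d m : ℕ) (μ κ : ℝ) : ℝ := κ + κ * (d * m + d * m * κ ^ 2 / μ ^ 2)

/-- The inequality |t| ≤ 1 + t² brings in squares, whose cell integral is what the energy estimate
controls. -/
theorem abs_sum_mul_le {κ : ℝ} {a ξ : Fin d → Fin m → ℝ} (ha : ∀ j β, |a j β| ≤ κ) :
    |∑ j, ∑ β, a j β * ξ j β| ≤ κ * (d * m + ∑ j, ∑ β, ξ j β ^ 2) := by
  have h1 : |∑ j, ∑ β, a j β * ξ j β| ≤ ∑ j, ∑ β, (κ + κ * ξ j β ^ 2) := by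
    refine (Finset.abs_sum_le_sum_abs _ _).trans (Finset.sum_le_sum fun j _ =>
      (Finset.abs_sum_le_sum_abs _ _).trans (Finset.sum_le_sum fun β _ => ?_))
    rw [abs_mul]
    have hκ : 0 ≤ κ := (abs_nonneg _).trans (ha j β)
    have h2 : |ξ j β| ≤ 1 + ξ j β ^ 2 := by
      rw [← sq_abs (ξ j β)]
      nlinarith [sq_nonneg (|ξ j β| - 1), abs_nonneg (ξ j β)]
    calc |a j β| * |ξ j β| ≤ κ * (1 + ξ j β ^ 2) :=
          mul_le_mul (ha j β) h2 (abs_nonneg _) hκ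
      _ = κ + κ * ξ j β ^ 2 := by ring
  rw [sum_sum_const_add_mul] at h1
  linarith

theorem setIntegral_cell_const (c : ℝ) : ∫ _ in cell d, c = c := by
  rw [setIntegral_const, measureReal_def, volume_cell]
  simp

theorem isFiniteMeasure_restrict_cell : IsFiniteMeasure (volume.restrict (cell d)) :=
  ⟨by rw [Measure.restrict_apply_univ, volume_cell]; simp⟩

/-- The corrector equation is tested with χ_k itself. Ellipticity bounds the quadratic part from
below, and Young's inequality absorbs the term with V or A, costing half of μ. The bound depends on
d, m, μ, κ only, which makes the final constant uniform in the coefficients. -/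
theorem Coefficients.IsCorrector.energy {𝒜 : Coefficients d m} {μ κ : ℝ} (hμ : 0 < μ)
    (h : 𝒜.IsAdmissible μ κ) {χ : Fin (d + 1) → Fin m → Fin m → E d → ℝ}
    {Dχ : Fin (d + 1) → Fin d → Fin m → Fin m → E d → ℝ} (hχ : 𝒜.IsCorrector χ Dχ)
    (k : Fin (d + 1)) (γ : Fin m) :
    IntegrableOn (fun y => ∑ i, ∑ α, Dχ k i α γ y ^ 2) (cell d) ∧
    ∫ y in cell d, ∑ i, ∑ α, Dχ k i α γ y ^ 2 ≤ d * m * κ ^ 2 / μ ^ 2 := by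
  have hL := h.locL2_flux hχ.locL2
  have hcell := fun i α γ => (hL k i α γ).memLp (isBounded_cell (d := d))
  have hDcell := fun i α => (hχ.locL2 k i α γ).memLp (isBounded_cell (d := d))
  have hint : IntegrableOn (fun y => ∑ i, ∑ α, Dχ k i α γ y ^ 2) (cell d) :=
    integrable_finsetSum _ fun i _ => integrable_finsetSum _ fun α _ => (hDcell i α).integrable_sq
  refine ⟨hint, ?_⟩
  have hint2 : IntegrableOn (fun y => ∑ i, ∑ α, 𝒜.flux Dχ k i α γ y * Dχ k i α γ y) (cell d) :=
    integrable_finsetSum _ fun i _ => integrable_finsetSum _ fun α _ =>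
      (hcell i α γ).integrable_mul (hDcell i α)
  have h0 := hχ.2 k γ (fun α => χ k α γ) (fun i α => Dχ k i α γ) (fun α => (hχ.1 k α γ).1)
  have hfin := isFiniteMeasure_restrict_cell (d := d)
  have hpt : ∀ᵐ y : E d, μ / 2 * ∑ i, ∑ α, Dχ k i α γ y ^ 2 ≤
      (∑ i, ∑ α, 𝒜.flux Dχ k i α γ y * Dχ k i α γ y) + d * m * (κ ^ 2 / (2 * μ)) := by
    filter_upwards [h.elliptic, ae_all_iff.2 fun i => ae_all_iff.2 fun α =>
      ae_all_iff.2 fun β => h.bounded_V i α β, ae_all_iff.2 fun i => ae_all_iff.2 fun j =>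
      ae_all_iff.2 fun α => ae_all_iff.2 fun β => h.bounded_a i j α β] with y hell hV ha
    have h1 := (hell (fun i α => Dχ k i α γ y)).1
    rw [sum_quadratic_eq (fun i j α β => 𝒜.a i j α β y)] at h1
    have h2 : ∑ i, ∑ α, (∑ j, ∑ β, 𝒜.a i j α β y * Dχ k j β γ y) * Dχ k i α γ y ≤
        ∑ i, ∑ α, (𝒜.flux Dχ k i α γ y * Dχ k i α γ y +
          (κ ^ 2 / (2 * μ) + μ / 2 * Dχ k i α γ y ^ 2)) := by
      refine Finset.sum_le_sum fun i _ => Finset.sum_le_sum fun α _ => ?_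
      have hK : |-(Fin.cases (𝒜.V i α γ y) (fun l => 𝒜.a i l α γ y) k : ℝ)| ≤ κ := by
        rw [abs_neg]
        refine Fin.cases ?_ (fun l => ?_) k
        · exact hV i α γ
        · exact ha i l α γ
      have := neg_mul_le_add_sq (t := Dχ k i α γ y) hμ hK
      unfold Coefficients.flux
      linarith
    simp only [Finset.sum_add_distrib (f := fun α => 𝒜.flux Dχ k _ α γ y * Dχ k _ α γ y)] at h2
    rw [Finset.sum_add_distrib, sum_sum_const_add_mul] at h2
    linarith
  have h3 := integral_mono_ae (hint.const_mul (μ / 2)) (hint2.add (integrable_const _))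
    (ae_restrict_of_ae hpt)
  rw [integral_const_mul, integral_add' hint2 (integrable_const _), h0] at h3
  rw [setIntegral_cell_const, zero_add] at h3
  have h4 : d * m * κ ^ 2 / μ ^ 2 = 2 / μ * (d * m * (κ ^ 2 / (2 * μ))) := by field_simp
  rw [h4]
  calc _ = 2 / μ * (μ / 2 * ∫ y in cell d, ∑ i, ∑ α, Dχ k i α γ y ^ 2) := by field_simp
    _ ≤ _ := mul_le_mul_of_nonneg_left h3 (by positivity)

theorem abs_setIntegral_cell_le {f X : E d → ℝ} {κ c e : ℝ} (hX : IntegrableOn X (cell d))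
    (hXe : ∫ y in cell d, X y ≤ e) (hκ : 0 ≤ κ)
    (hf : ∀ᵐ y : E d, |f y| ≤ κ + κ * (c + X y)) :
    |∫ y in cell d, f y| ≤ κ + κ * (c + e) := by
  have hfin := isFiniteMeasure_restrict_cell (d := d)
  have hi : Integrable (fun y => c + X y) (volume.restrict (cell d)) := (integrable_const c).add hX
  have h1 := norm_integral_le_of_norm_le (f := f) (g := fun y => κ + κ * (c + X y))
    ((integrable_const κ).add (hi.const_mul κ)) (ae_restrict_of_ae hf)
  rw [integral_add (integrable_const _) (hi.const_mul κ), integral_const_mul,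
    integral_add (integrable_const _) hX, setIntegral_cell_const, setIntegral_cell_const] at h1
  refine h1.trans ?_
  gcongr

theorem Coefficients.IsCorrector.abs_integral_flux_le {𝒜 : Coefficients d m} {μ κ : ℝ} (hμ : 0 < μ)
    (hκ : 0 < κ) (h : 𝒜.IsAdmissible μ κ) {χ : Fin (d + 1) → Fin m → Fin m → E d → ℝ}
    {Dχ : Fin (d + 1) → Fin d → Fin m → Fin m → E d → ℝ} (hχ : 𝒜.IsCorrector χ Dχ)
    (k : Fin (d + 1)) (i : Fin d) (α γ : Fin m) :
    |∫ y in cell d, 𝒜.flux Dχ k i α γ y| ≤ meanBound d m μ κ := by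
  obtain ⟨hX, hXe⟩ := hχ.energy hμ h k γ
  refine abs_setIntegral_cell_le hX hXe hκ.le ?_
  filter_upwards [ae_all_iff.2 fun i => ae_all_iff.2 fun α =>
      ae_all_iff.2 fun β => h.bounded_V i α β, ae_all_iff.2 fun i => ae_all_iff.2 fun j =>
      ae_all_iff.2 fun α => ae_all_iff.2 fun β => h.bounded_a i j α β] with y hV ha
  refine (abs_add_le _ _).trans (add_le_add ?_ (abs_sum_mul_le fun j β => ha i j α β))
  refine Fin.cases ?_ (fun l => ?_) k
  · exact hV i α γ
  · exact ha i l α γ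

theorem Coefficients.IsCorrector.abs_integral_lowerFlux_le {𝒜 : Coefficients d m} {μ κ : ℝ}
    (hμ : 0 < μ) (hκ : 0 < κ) (h : 𝒜.IsAdmissible μ κ)
    {χ : Fin (d + 1) → Fin m → Fin m → E d → ℝ}
    {Dχ : Fin (d + 1) → Fin d → Fin m → Fin m → E d → ℝ} (hχ : 𝒜.IsCorrector χ Dχ)
    (k : Fin (d + 1)) (α γ : Fin m) :
    |∫ y in cell d, 𝒜.lowerFlux Dχ k α γ y| ≤ meanBound d m μ κ := by
  obtain ⟨hX, hXe⟩ := hχ.energy hμ h k γ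
  refine abs_setIntegral_cell_le hX hXe hκ.le ?_
  filter_upwards [ae_all_iff.2 fun α => ae_all_iff.2 fun β => h.bounded_c α β,
      ae_all_iff.2 fun i => ae_all_iff.2 fun α => ae_all_iff.2 fun β => h.bounded_B i α β]
    with y hc hB
  refine (abs_add_le _ _).trans (add_le_add ?_ (abs_sum_mul_le fun j β => hB j α β))
  refine Fin.cases ?_ (fun l => ?_) k
  · exact hc α γ
  · exact hB l α γ

/-- The constant in the bound of `∇χ_k` by the weight. -/
def correctorBound (d m : ℕ) (μ κ : ℝ) : ℝ := d * m * ((meanBound d m μ κ / μ + 2) / μ)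

/-- The constant in the bound of `W_k` by the weight. -/
def lowerBound (d m : ℕ) (μ κ : ℝ) : ℝ :=
  meanBound d m μ κ / μ + 1 + d * m * (κ * correctorBound d m μ κ)

theorem meanBound_nonneg {μ κ : ℝ} (hκ : 0 < κ) : 0 ≤ meanBound d m μ κ := by
  unfold meanBound; positivity

/-- With F = Aξ this is the boundedness of the inverse of an elliptic matrix. Young's inequality
gives |ξ|² ≤ dm (K/μ)², and dm ≥ 1 (the indices `i`, `α` exist) allows the square root of dm to be
replaced by dm. -/
theorem abs_le_of_elliptic {μ K : ℝ} (hμ : 0 < μ) {F ξ : Fin d → Fin m → ℝ}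
    (hF : ∀ i α, |F i α| ≤ K) (hell : μ * ∑ i, ∑ α, ξ i α ^ 2 ≤ ∑ i, ∑ α, F i α * ξ i α)
    (i : Fin d) (α : Fin m) : |ξ i α| ≤ d * m * (K / μ) := by
  have hK : 0 ≤ K := (abs_nonneg _).trans (hF i α)
  have h1 : ∑ i, ∑ α, F i α * ξ i α ≤ ∑ i, ∑ α, (K ^ 2 / (2 * μ) + μ / 2 * ξ i α ^ 2) :=
    Finset.sum_le_sum fun i _ => Finset.sum_le_sum fun α _ => neg_mul_le_add_sq hμ (hF i α)
  rw [sum_sum_const_add_mul] at h1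
  have h2 : ξ i α ^ 2 ≤ ∑ i, ∑ α, ξ i α ^ 2 :=
    le_sum_of_le (fun _ => by positivity) i <| le_sum_of_le (fun _ => by positivity) α le_rfl
  have h3 : ∑ i, ∑ α, ξ i α ^ 2 ≤ d * m * (K / μ) ^ 2 := by
    have h4 : μ / 2 * ∑ i, ∑ α, ξ i α ^ 2 ≤ d * m * (K ^ 2 / (2 * μ)) := by linarith
    calc ∑ i, ∑ α, ξ i α ^ 2 = 2 / μ * (μ / 2 * ∑ i, ∑ α, ξ i α ^ 2) := by field_simp
      _ ≤ 2 / μ * (d * m * (K ^ 2 / (2 * μ))) := mul_le_mul_of_nonneg_left h4 (by positivity)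
      _ = d * m * (K / μ) ^ 2 := by field_simp
  have hdm : (1 : ℝ) ≤ d * m := by
    have hd : 1 ≤ d := i.pos
    have hm : 1 ≤ m := α.pos
    exact_mod_cast Nat.mul_pos hd hm
  refine abs_le_of_sq_le_sq (h2.trans (h3.trans ?_)) (by positivity)
  rw [mul_pow]
  exact mul_le_mul_of_nonneg_right (by nlinarith) (by positivity)

/-- The weight contains neither ∇χ_k nor W_k, but it controls both. Its lower bound μ absorbs
constants such as the homogenized coefficients, and ∇χ_k is recovered pointwise from b_k by
inverting A; W_k is then a bounded combination of these. -/
theorem Coefficients.IsCorrector.ae_bounds {𝒜 : Coefficients d m} {μ κ : ℝ}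
    (hd : 0 < d) (hm : 0 < m)
    (hμ : 0 < μ) (hκ : 0 < κ) (h : 𝒜.IsAdmissible μ κ)
    {χ : Fin (d + 1) → Fin m → Fin m → E d → ℝ}
    {Dχ : Fin (d + 1) → Fin d → Fin m → Fin m → E d → ℝ} (hχ : 𝒜.IsCorrector χ Dχ)
    (Dθ : Fin (d + 1) → Fin d → Fin d → Fin m → Fin m → E d → ℝ)
    (Dϑ : Fin (d + 1) → Fin d → Fin m → Fin m → E d → ℝ) :
    ∀ᵐ y : E d, μ ≤ 𝒜.weight χ Dχ Dθ Dϑ y ∧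
      (∀ k i α γ, |Dχ k i α γ y| ≤ correctorBound d m μ κ * 𝒜.weight χ Dχ Dθ Dϑ y) ∧
      (∀ k α γ, |𝒜.W Dχ k α γ y| ≤ lowerBound d m μ κ * 𝒜.weight χ Dχ Dθ Dϑ y) := by
  filter_upwards [h.elliptic, ae_all_iff.2 fun i => ae_all_iff.2 fun α => ae_all_iff.2 fun β =>
    h.bounded_B i α β] with y hell hB
  obtain ⟨wa, wV, wB, wc, -, wb, -, -⟩ := 𝒜.abs_entries_le_weight χ Dχ Dθ Dϑ y
  set w := 𝒜.weight χ Dχ Dθ Dϑ y with hw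
  set C₀ := meanBound d m μ κ with hC₀
  have hC₀' : 0 ≤ C₀ := meanBound_nonneg hκ
  have hμw : μ ≤ w := by
    -- Ellipticity on a unit matrix bounds one diagonal entry of A below by μ, and that entry is
    -- part of the weight.
    have h1 := (hell (fun i α => if i = ⟨0, hd⟩ then if α = ⟨0, hm⟩ then 1 else 0 else 0)).1
    simp at h1
    exact h1.trans ((le_abs_self _).trans (wa _ _ _ _))
  have hw0 : 0 < w := hμ.trans_le hμw
  have hC₀w : C₀ ≤ C₀ / μ * w := by
    calc C₀ = C₀ / μ * μ := by field_simp
      _ ≤ _ := mul_le_mul_of_nonneg_left hμw (by positivity)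
  have hD : ∀ k i α γ, |Dχ k i α γ y| ≤ correctorBound d m μ κ * w := by
    intro k i α γ
    have h1 := (hell (fun i α => Dχ k i α γ y)).1
    rw [sum_quadratic_eq (fun i j α β => 𝒜.a i j α β y)] at h1
    have h2 := abs_le_of_elliptic (K := (C₀ / μ + 2) * w) hμ (fun i α => ?_) h1 i α
    · refine h2.trans_eq ?_
      unfold correctorBound
      ring
    · have hK : |(Fin.cases (𝒜.V i α γ y) (fun l => 𝒜.a i l α γ y) k : ℝ)| ≤ w := by
        refine Fin.cases ?_ (fun l => ?_) k
        · exact wV i α γ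
        · exact wa i l α γ
      -- Definition of b_k solved for A∇χ_k. The three terms are at most (C₀/μ) w, w and w, whence
      -- the constant C₀/μ + 2.
      have e1 : ∑ j, ∑ β, 𝒜.a i j α β y * Dχ k j β γ y =
          (∫ z in cell d, 𝒜.flux Dχ k i α γ z) - 𝒜.b Dχ k i α γ y -
            (Fin.cases (𝒜.V i α γ y) (fun l => 𝒜.a i l α γ y) k : ℝ) := by
        simp only [Coefficients.b, Coefficients.flux]
        ring
      rw [e1]
      refine (abs_sub _ _).trans ((add_le_add (abs_sub _ _) le_rfl).trans ?_)
      have := hχ.abs_integral_flux_le hμ hκ h k i α γ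
      linarith [wb k i α γ]
  refine ⟨hμw, hD, fun k α γ => ?_⟩
  have hK : |(Fin.cases (𝒜.c α γ y) (fun l => 𝒜.B l α γ y) k : ℝ)| ≤ w := by
    refine Fin.cases ?_ (fun l => ?_) k
    · exact wc α γ
    · exact wB l α γ
  have h1 : |∑ j, ∑ β, 𝒜.B j α β y * Dχ k j β γ y| ≤
      d * m * (κ * correctorBound d m μ κ) * w := by
    have : |∑ j, ∑ β, 𝒜.B j α β y * Dχ k j β γ y| ≤
        ∑ _j : Fin d, ∑ _β : Fin m, κ * (correctorBound d m μ κ * w) := by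
      refine (Finset.abs_sum_le_sum_abs _ _).trans (Finset.sum_le_sum fun j _ =>
        (Finset.abs_sum_le_sum_abs _ _).trans (Finset.sum_le_sum fun β _ => ?_))
      rw [abs_mul]
      exact mul_le_mul (hB j α β) (hD k j β γ) (abs_nonneg _) hκ.le
    refine this.trans_eq ?_
    simp
    ring
  have h2 := hχ.abs_integral_lowerFlux_le hμ hκ h k α γ
  unfold Coefficients.W
  refine (abs_sub _ _).trans ?_
  have h3 : |𝒜.lowerFlux Dχ k α γ y| ≤ w + d * m * (κ * correctorBound d m μ κ) * w :=
    (abs_add_le _ _).trans (add_le_add hK h1)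
  unfold lowerBound
  linarith


/-! ### Mollification in `L²` -/

theorem eLpNorm_two_sq {α : Type*} [MeasurableSpace α] (f : α → ℝ) (ν : Measure α) :
    eLpNorm f 2 ν ^ 2 = ∫⁻ x, ‖f x‖ₑ ^ 2 ∂ν := by
  have := eLpNorm_nnreal_pow_eq_lintegral (f := f) (μ := ν) (p := 2) (by norm_num)
  norm_num at this
  exact this

/-- Jensen's inequality for the probability density `k`: Cauchy-Schwarz for the factors f k^{1/2}
and k^{1/2}. -/
theorem sq_lintegral_mul_le {α : Type*} [MeasurableSpace α] {ν : Measure α} {f k : α → ℝ≥0∞}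
    (hf : AEMeasurable f ν) (hk : AEMeasurable k ν) (hk1 : ∫⁻ x, k x ∂ν = 1) :
    (∫⁻ x, f x * k x ∂ν) ^ 2 ≤ ∫⁻ x, f x ^ 2 * k x ∂ν := by
  have hsq : ∀ t : ℝ≥0∞, (t ^ (1 / 2 : ℝ)) ^ 2 = t := fun t => by
    rw [← ENNReal.rpow_natCast, ← ENNReal.rpow_mul]; norm_num
  have h := ENNReal.lintegral_mul_le_Lp_mul_Lq ν Real.HolderConjugate.two_two
    (hf.mul (hk.pow_const (1 / 2 : ℝ))) (hk.pow_const (1 / 2 : ℝ))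
  simp only [Pi.mul_apply, ENNReal.rpow_two, mul_pow, hsq, hk1, ENNReal.one_rpow, mul_one] at h
  have h2 : ∀ x, f x * k x ^ (1 / 2 : ℝ) * k x ^ (1 / 2 : ℝ) = f x * k x := fun x => by
    rw [mul_assoc, ← sq, hsq]
  simp only [h2] at h
  calc _ ≤ ((∫⁻ x, f x ^ 2 * k x ∂ν) ^ (1 / 2 : ℝ)) ^ 2 := by gcongr
    _ = _ := hsq _

/-- Young's convolution inequality for a kernel of mass one: Jensen pointwise in x, then Tonelli. -/
theorem eLpNorm_conv_le {F ρ : E d → ℝ} (hF : AEStronglyMeasurable F volume) (hρ : Continuous ρ)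
    (hρ1 : ∫⁻ x, ‖ρ x‖ₑ = 1) : eLpNorm (conv F ρ) 2 volume ≤ eLpNorm F 2 volume := by
  have hsub : ∀ x, ∫⁻ y, ‖ρ (x - y)‖ₑ = 1 := fun x => by
    rw [← hρ1]; exact lintegral_sub_left_eq_self (fun y => ‖ρ y‖ₑ) x
  have hsub' : ∀ y, ∫⁻ x, ‖ρ (x - y)‖ₑ = 1 := fun y => by
    rw [← hρ1]; exact lintegral_sub_right_eq_self (fun y => ‖ρ y‖ₑ) y
  have h1 : ∀ x, ‖conv F ρ x‖ₑ ^ 2 ≤ ∫⁻ y, ‖F y‖ₑ ^ 2 * ‖ρ (x - y)‖ₑ := by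
    intro x
    have hc : Continuous fun y => ρ (x - y) := hρ.comp (continuous_const.sub continuous_id)
    refine le_trans ?_ (sq_lintegral_mul_le hF.enorm hc.enorm.aemeasurable (hsub x))
    gcongr
    refine (enorm_integral_le_lintegral_enorm _).trans_eq ?_
    simp only [enorm_mul]
  have h2 : eLpNorm (conv F ρ) 2 volume ^ 2 ≤ eLpNorm F 2 volume ^ 2 := by
    rw [eLpNorm_two_sq, eLpNorm_two_sq]
    refine (lintegral_mono h1).trans ?_
    rw [lintegral_lintegral_swap]
    · refine lintegral_mono fun y => ?_
      have hc : Continuous fun x => ρ (x - y) := hρ.comp (continuous_id.sub continuous_const)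
      rw [lintegral_const_mul _ hc.enorm.measurable, hsub', mul_one]
    · have hc : Continuous fun p : E d × E d => ρ (p.1 - p.2) :=
        hρ.comp (continuous_fst.sub continuous_snd)
      exact (hF.enorm.pow_const 2).comp_snd.mul hc.enorm.aemeasurable
  exact (ENNReal.pow_le_pow_left_iff two_ne_zero).1 h2

theorem conv_eq_normed_convolution (F ρ : E d → ℝ) (x : E d) :
    conv F ρ x = convolution ρ F (ContinuousLinearMap.lsmul ℝ ℝ) volume x := by
  rw [convolution_eq_swap]
  simp [conv, mul_comm]

theorem conv_sub {F G ρ : E d → ℝ} (hF : LocallyIntegrable F) (hG : LocallyIntegrable G)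
    (h : IsTest ρ) : conv (F - G) ρ = conv F ρ - conv G ρ := by
  ext x
  have hi : ∀ H : E d → ℝ, LocallyIntegrable H → Integrable fun y => H y * ρ (x - y) := fun H hH =>
    integrable_mul_test_of_locallyIntegrableOn (hH.locallyIntegrableOn univ) (h.comp_sub_left x)
      (subset_univ _)
  simp only [conv, Pi.sub_apply, sub_mul]
  exact integral_sub (hi F hF) (hi G hG)

theorem isTest_normed (φ : ContDiffBump (0 : E d)) : IsTest (φ.normed volume) :=
  ⟨φ.contDiff_normed, φ.hasCompactSupport_normed⟩

theorem lintegral_enorm_normed (φ : ContDiffBump (0 : E d)) :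
    ∫⁻ x, ‖φ.normed volume x‖ₑ = 1 := by
  have h1 := ofReal_integral_eq_lintegral_ofReal (φ.integrable_normed (μ := volume))
    (Eventually.of_forall fun x => φ.nonneg_normed x)
  rw [φ.integral_normed, ENNReal.ofReal_one] at h1
  rw [h1]
  exact lintegral_congr fun x => Real.enorm_of_nonneg (φ.nonneg_normed x)

theorem conv_eq_zero_of_ball_subset {F ρ : E d → ℝ} {δ : ℝ} {x : E d}
    (hρ : ∀ x, δ ≤ ‖x‖ → ρ x = 0) (hF : ∀ y ∈ Metric.ball x δ, F y = 0) : conv F ρ x = 0 := by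
  unfold conv
  rw [← integral_zero (E d) ℝ (μ := volume)]
  congr 1 with y
  by_cases hy : y ∈ Metric.ball x δ
  · rw [hF y hy, zero_mul]
  · rw [hρ, mul_zero]
    rw [Metric.mem_ball, not_lt, dist_comm, dist_eq_norm] at hy
    exact hy

theorem normed_eq_zero (φ : ContDiffBump (0 : E d)) (x : E d) (hx : φ.rOut ≤ ‖x‖) :
    φ.normed volume x = 0 := by
  have : x ∉ Function.support (φ.normed volume) := by
    rw [φ.support_normed_eq, mem_ball_zero_iff]
    exact not_lt.2 hx
  simpa using this

/-- Approximate F in L² by a continuous compactly supported g. The contraction property handles F -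
g uniformly in n, and uniform continuity handles g on a fixed ball. -/
theorem tendsto_eLpNorm_conv_sub {F : E d → ℝ} (hF : MemLp F 2 volume)
    {φ : ℕ → ContDiffBump (0 : E d)} (hφ : Tendsto (fun n => (φ n).rOut) atTop (𝓝 0)) :
    Tendsto (fun n => eLpNorm (conv F ((φ n).normed volume) - F) 2 volume) atTop (𝓝 0) := by
  rw [ENNReal.tendsto_atTop_zero]
  intro η hη
  by_cases hηt : η = ⊤
  · exact ⟨0, fun n _ => by rw [hηt]; exact le_top⟩
  have h3 : η / 3 ≠ 0 := (ENNReal.div_pos hη.ne' (by norm_num)).ne'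
  obtain ⟨g, hgc, hFg, hg, hgL⟩ := hF.exists_hasCompactSupport_eLpNorm_sub_le (by norm_num) h3
  have hFl : LocallyIntegrable F := hF.locallyIntegrable (by norm_num)
  have hgl : LocallyIntegrable g := hg.locallyIntegrable
  obtain ⟨R, hR⟩ := (Metric.isBounded_iff_subset_closedBall (0 : E d)).1 hgc.isCompact.isBounded
  -- The mollification radius will be below 1, so this ball contains the support of g * ρ - g for
  -- all large n.
  set B := Metric.closedBall (0 : E d) (R + 1) with hB
  set M : ℝ≥0∞ := volume B ^ (2 : ℝ≥0∞).toReal⁻¹ with hM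
  have hMt : M ≠ ⊤ := ENNReal.rpow_ne_top_of_nonneg (by simp)
    (isCompact_closedBall (0 : E d) (R + 1)).measure_lt_top.ne
  obtain ⟨τ, hτ, hτM⟩ : ∃ τ : ℝ, 0 < τ ∧ M * ENNReal.ofReal τ ≤ η / 3 := by
    have : Tendsto (fun τ : ℝ => M * ENNReal.ofReal τ) (𝓝[>] 0) (𝓝 0) := by
      have h1 : Tendsto (fun τ : ℝ => ENNReal.ofReal τ) (𝓝[>] 0) (𝓝 0) := by
        simpa using (ENNReal.continuous_ofReal.tendsto 0).mono_left nhdsWithin_le_nhds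
      simpa using ENNReal.Tendsto.const_mul h1 (Or.inr hMt)
    have h2 := (this.eventually (ge_mem_nhds (pos_iff_ne_zero.2 h3))).and self_mem_nhdsWithin
    obtain ⟨τ, h, h'⟩ := h2.exists
    exact ⟨τ, h', h⟩
  obtain ⟨δ, hδ, hunif⟩ := Metric.uniformContinuous_iff.1
    (hgc.uniformContinuous_of_continuous hg) τ hτ
  obtain ⟨N, hN⟩ := (hφ.eventually (gt_mem_nhds (lt_min hδ one_pos))).exists_forall_of_atTop
  refine ⟨N, fun n hn => ?_⟩
  have hn' := hN n hn
  set ρ := (φ n).normed volume with hρ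
  have hρt : IsTest ρ := isTest_normed _
  have e : conv F ρ - F = conv (F - g) ρ + (conv g ρ - g) - (F - g) := by
    rw [conv_sub hFl hgl hρt]; abel
  have hsupp : Function.support (conv g ρ - g) ⊆ B := by
    intro x hx
    by_contra hxB
    have hxR : R + 1 < ‖x‖ := by simpa [hB] using hxB
    have hz : ∀ y ∈ Metric.ball x 1, g y = 0 := by
      intro y hy
      refine image_eq_zero_of_notMem_tsupport fun hy' => ?_
      have h1 := mem_closedBall_zero_iff.1 (hR hy')
      have h2 := norm_le_norm_add_norm_sub' x y
      rw [mem_ball_iff_norm'] at hy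
      linarith
    refine hx ?_
    rw [Pi.sub_apply, hz x (Metric.mem_ball_self one_pos), sub_zero]
    refine conv_eq_zero_of_ball_subset (δ := 1) (fun x hx => normed_eq_zero _ _ ?_) hz
    exact (hn'.le.trans (min_le_right _ _)).trans hx
  have hmid : eLpNorm (conv g ρ - g) 2 volume ≤ η / 3 := by
    rw [← eLpNorm_restrict_eq_of_support_subset hsupp]
    refine (eLpNorm_le_of_ae_bound (C := τ) (Eventually.of_forall fun x => ?_)).trans ?_
    · rw [Pi.sub_apply, conv_eq_normed_convolution, ← dist_eq_norm]
      refine (φ n).dist_normed_convolution_le hg.aestronglyMeasurable fun y hy => ?_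
      refine (hunif ?_).le
      exact (Metric.mem_ball.1 hy).trans_le (hn'.le.trans (min_le_left _ _))
    · rw [Measure.restrict_apply_univ]
      exact hτM
  have hm1 : AEStronglyMeasurable (F - g) volume := (hF.sub hgL).aestronglyMeasurable
  have hm2 : AEStronglyMeasurable (conv (F - g) ρ) volume :=
    (hρt.contDiff_conv (hFl.sub hgl)).continuous.aestronglyMeasurable
  have hm3 : AEStronglyMeasurable (conv g ρ - g) volume :=
    ((hρt.contDiff_conv hgl).continuous.sub hg).aestronglyMeasurable
  rw [e]
  calc eLpNorm (conv (F - g) ρ + (conv g ρ - g) - (F - g)) 2 volume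
      ≤ eLpNorm (conv (F - g) ρ + (conv g ρ - g)) 2 volume + eLpNorm (F - g) 2 volume :=
        eLpNorm_sub_le (hm2.add hm3) hm1 (by norm_num)
    _ ≤ eLpNorm (conv (F - g) ρ) 2 volume + eLpNorm (conv g ρ - g) 2 volume +
        eLpNorm (F - g) 2 volume := by
        gcongr
        exact eLpNorm_add_le hm2 hm3 (by norm_num)
    _ ≤ η / 3 + η / 3 + η / 3 := by
        gcongr
        exact (eLpNorm_conv_le hm1 hρt.continuous (lintegral_enorm_normed _)).trans hFg
    _ = η := ENNReal.add_thirds η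

theorem tendsto_integral_mul_of_eLpNorm {α : Type*} [MeasurableSpace α] {ν : Measure α}
    {u : ℕ → α → ℝ} {v g : α → ℝ} (hu : ∀ᶠ n in atTop, MemLp (u n) 2 ν) (hv : MemLp v 2 ν)
    (hg : MemLp g 2 ν)
    (h : Tendsto (fun n => eLpNorm (fun x => u n x - v x) 2 ν) atTop (𝓝 0)) :
    Tendsto (fun n => ∫ x, u n x * g x ∂ν) atTop (𝓝 (∫ x, v x * g x ∂ν)) := by
  have h1 : Tendsto (fun n => eLpNorm (fun x => u n x - v x) 2 ν * eLpNorm g 2 ν) atTop (𝓝 0) := by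
    simpa using ENNReal.Tendsto.mul_const h (Or.inr hg.2.ne)
  refine tendsto_integral_of_L1 (fun x => v x * g x) (hv.integrable_mul hg).aestronglyMeasurable
    (hu.mono fun n hn => hn.integrable_mul hg) ?_
  refine tendsto_of_tendsto_of_tendsto_of_le_of_le' tendsto_const_nhds h1
    (Eventually.of_forall fun _ => zero_le) (hu.mono fun n hn => ?_)
  have h2 := eLpNorm_smul_le_mul_eLpNorm (p := 2) (q := 2) (r := 1) hg.aestronglyMeasurable
    (hn.sub hv).aestronglyMeasurable
  rw [eLpNorm_one_eq_lintegral_enorm] at h2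
  refine le_trans (le_of_eq ?_) h2
  refine lintegral_congr fun x => ?_
  simp [sub_mul]

/-- A weak identity tested with smooth functions extends to `H¹(Ω)` if all its coefficients are
square integrable with compact support in `Ω`. -/
theorem integral_add_sum_eq_zero_of_test {Ω K : Set (E d)} (hΩ : IsOpen Ω) (hK : IsCompact K)
    (hKΩ : K ⊆ Ω) {f : E d → ℝ} {G : Fin d → E d → ℝ} (hf : MemLp f 2 volume)
    (hG : ∀ i, MemLp (G i) 2 volume) (hGK : ∀ i, ∀ x ∉ K, G i x = 0)
    (hw : ∀ ζ, IsTest ζ → (∫ x, f x * ζ x) + ∑ i, ∫ x, G i x * partialDeriv i ζ x = 0)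
    {v : E d → ℝ} {Dv : Fin d → E d → ℝ} (hv : IsH1 Ω v Dv) :
    (∫ x in Ω, f x * v x) + ∑ i, ∫ x in Ω, G i x * Dv i x = 0 := by
  -- Room for mollification: fields supported in K stay supported in Ω once the radius is below δ.
  -- Then G_i * ρ is an admissible test function in the definition of the weak derivative of v, and
  -- v itself need not be approximated.
  obtain ⟨δ, hδ, hδΩ⟩ := hK.exists_cthickening_subset_open hΩ hKΩ
  set φ : ℕ → ContDiffBump (0 : E d) := fun n =>
    ⟨1 / ((n : ℝ) + 1) / 2, 1 / ((n : ℝ) + 1), by positivity, half_lt_self (by positivity)⟩ with hφ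
  have hφ0 : Tendsto (fun n => (φ n).rOut) atTop (𝓝 0) := tendsto_one_div_add_atTop_nhds_zero_nat
  have hlim : ∀ (F w : E d → ℝ), MemLp F 2 volume → MemLp w 2 (volume.restrict Ω) →
      Tendsto (fun n => ∫ x in Ω, conv F ((φ n).normed volume) x * w x) atTop
        (𝓝 (∫ x in Ω, F x * w x)) := by
    intro F w hF hw
    have hFl : LocallyIntegrable F := hF.locallyIntegrable (by norm_num)
    have hm : ∀ n, MemLp (conv F ((φ n).normed volume)) 2 volume := fun n =>
      ⟨((isTest_normed _).contDiff_conv hFl).continuous.aestronglyMeasurable,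
        (eLpNorm_conv_le hF.aestronglyMeasurable (isTest_normed _).continuous
          (lintegral_enorm_normed _)).trans_lt hF.2⟩
    refine tendsto_integral_mul_of_eLpNorm (Eventually.of_forall fun n => (hm n).restrict Ω)
      (hF.restrict Ω) hw ?_
    refine tendsto_of_tendsto_of_tendsto_of_le_of_le tendsto_const_nhds
      (tendsto_eLpNorm_conv_sub hF hφ0) (fun _ => zero_le) fun n => ?_
    exact eLpNorm_mono_measure _ Measure.restrict_le_self
  have hl := (hlim f v hf hv.1).add (tendsto_finsetSum Finset.univ fun i _ =>
    hlim (G i) (Dv i) (hG i) (hv.2 i).1)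
  refine tendsto_nhds_unique hl (tendsto_const_nhds.congr' ?_)
  filter_upwards [hφ0.eventually (gt_mem_nhds hδ)] with n hn
  set ρ := (φ n).normed volume with hρ
  have hρt : IsTest ρ := isTest_normed _
  have hGl : ∀ i, LocallyIntegrable (G i) := fun i => (hG i).locallyIntegrable (by norm_num)
  have hsub : ∀ i, tsupport (conv (G i) ρ) ⊆ Metric.cthickening δ K := by
    intro i
    refine closure_minimal (fun x hx => ?_) Metric.isClosed_cthickening
    by_contra hxK
    refine hx (conv_eq_zero_of_ball_subset (δ := δ)
      (fun y hy => normed_eq_zero _ _ (hn.le.trans hy)) fun y hy => hGK i y fun hyK => hxK ?_)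
    exact Metric.mem_cthickening_of_dist_le x y δ K hyK (by
      rw [dist_comm]; exact (Metric.mem_ball.1 hy).le)
  have ht : ∀ i, IsTest (conv (G i) ρ) := fun i => ⟨hρt.contDiff_conv (hGl i),
    (hK.cthickening (r := δ)).of_isClosed_subset isClosed_closure (hsub i)⟩
  -- The weak identity tested with y ↦ ρ(x - y) says that div G = f survives mollification, now
  -- pointwise.
  have hdiv : ∀ x, ∑ i, partialDeriv i (conv (G i) ρ) x = conv f ρ x := by
    intro x
    have h1 := hw _ (hρt.comp_sub_left x)
    simp only [partialDeriv_comp_sub_left hρt.contDiff, mul_neg, integral_neg,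
      Finset.sum_neg_distrib] at h1
    have h2 : ∀ i, partialDeriv i (conv (G i) ρ) x = ∫ y, G i y * partialDeriv i ρ (x - y) :=
      fun i => by rw [hρt.partialDeriv_conv (hGl i)]; rfl
    simp only [h2]
    unfold conv
    linarith
  have hweak : ∀ i, ∫ x in Ω, v x * partialDeriv i (conv (G i) ρ) x =
      -∫ x in Ω, conv (G i) ρ x * Dv i x := by
    intro i
    rw [(hv.2 i).2.2.2 _ (ht i).1 (ht i).2 ((hsub i).trans hδΩ)]
    simp only [mul_comm]
  have hint : ∀ i, Integrable (fun x => v x * partialDeriv i (conv (G i) ρ) x)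
      (volume.restrict Ω) := fun i => (integrable_mul_test_of_locallyIntegrableOn
        (hv.2 i).2.1 ((ht i).partialDeriv i)
        ((tsupport_partialDeriv_subset _ _).trans ((hsub i).trans hδΩ))).restrict
  have hsum : ∫ x in Ω, conv f ρ x * v x = -∑ i, ∫ x in Ω, conv (G i) ρ x * Dv i x := by
    rw [← Finset.sum_neg_distrib]
    simp only [← hweak]
    rw [← integral_finsetSum _ fun i _ => hint i]
    refine integral_congr_ae (Eventually.of_forall fun x => ?_)
    simp only [← hdiv, ← Finset.mul_sum, mul_comm]
  rw [hsum]
  simp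


/-! ### Cutoff functions -/

theorem isOpen_innerRegion {Ω : Set (E d)} (hΩ : IsOpen Ω) (r : ℝ) : IsOpen (innerRegion Ω r) :=
  hΩ.inter (isOpen_lt continuous_const (Metric.continuous_infDist_pt _))

/-- The ball is connected and misses the frontier, so it cannot leave Ω. This converts the distance
to ∂Ω used in Σ_r into a distance to the complement. -/
theorem ball_subset_of_mem_innerRegion {Ω : Set (E d)} (hΩ : IsOpen Ω) {r : ℝ} (hr : 0 < r)
    {x : E d} (hx : x ∈ innerRegion Ω r) : Metric.ball x r ⊆ Ω := by
  have hd : Disjoint (Metric.ball x r) (frontier Ω) := by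
    rw [disjoint_left]
    intro y hy hyf
    have h1 := Metric.infDist_le_dist_of_mem (x := x) hyf
    have h2 := Metric.mem_ball.1 hy
    rw [dist_comm] at h2
    exact absurd hx.2 (not_lt.2 (h1.trans h2.le))
  refine (convex_ball x r).isPreconnected.subset_left_of_subset_union hΩ
    (isClosed_closure (s := Ω)).isOpen_compl
    (disjoint_compl_right_iff_subset.2 subset_closure) ?_ ⟨x, Metric.mem_ball_self hr, hx.1⟩
  intro y hy
  by_cases hyc : y ∈ closure Ω
  · left
    by_contra hyΩ
    exact disjoint_left.1 hd hy ⟨hyc, by rwa [hΩ.interior_eq]⟩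
  · exact Or.inr hyc

theorem abs_conv_indicator_le {ρ : E d → ℝ} (h : IsTest ρ) (S : Set (E d)) (x : E d) :
    |conv (S.indicator fun _ => 1) ρ x| ≤ ∫ y, |ρ y| := by
  rw [← integral_sub_left_eq_self (fun y => |ρ y|) volume x]
  have hi : Integrable ρ volume := h.continuous.integrable_of_hasCompactSupport h.hasCompactSupport
  rw [conv, ← Real.norm_eq_abs]
  refine norm_integral_le_of_norm_le (hi.abs.comp_sub_left x)
    (Eventually.of_forall fun y => ?_)
  rw [norm_mul, Real.norm_eq_abs, Real.norm_eq_abs]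
  refine mul_le_of_le_one_left (abs_nonneg _) ?_
  by_cases hy : y ∈ S <;> simp [hy]

/-- A smooth cutoff function for `Ω` at scale `ε`, equal to one on `Σ_{2ε}`. -/
structure IsCutoff (Ω : Set (E d)) (ε C : ℝ) (η : E d → ℝ) : Prop where
  isTest : IsTest η
  tsupport_subset : tsupport η ⊆ Ω
  nonneg : ∀ x, 0 ≤ η x
  le_one : ∀ x, η x ≤ 1
  eq_one : ∀ x ∈ innerRegion Ω (2 * ε), η x = 1
  partialDeriv_eq_zero : ∀ x ∈ innerRegion Ω (2 * ε), ∀ i, partialDeriv i η x = 0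
  partialDeriv_le : ∀ x i, ε * |partialDeriv i η x| ≤ C

/-- The indicator of {dist(·, Ωᶜ) > ε} is mollified at scale ε/2. Rescaling to unit size first, the
mollifier is a fixed bump β, so C = ∑ ∫|∂_iβ| depends on d alone. -/
theorem exists_cutoff (d : ℕ) : ∃ C : ℝ, 0 ≤ C ∧ ∀ Ω : Set (E d), IsOpen Ω →
    Bornology.IsBounded Ω → ∀ ε : ℝ, 0 < ε → ∃ η, IsCutoff Ω ε C η := by
  set φ : ContDiffBump (0 : E d) := ⟨1 / 4, 1 / 2, by norm_num, by norm_num⟩ with hφ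
  set β := φ.normed volume with hβ
  have hβt : IsTest β := isTest_normed φ
  refine ⟨∑ i, ∫ y, |partialDeriv i β y|, Finset.sum_nonneg fun i _ => integral_nonneg fun y =>
    abs_nonneg _, fun Ω hΩ hb ε hε => ?_⟩
  have hβ0 : ∀ x : E d, 1 / 2 ≤ ‖x‖ → β x = 0 := fun x hx => normed_eq_zero φ x hx
  set S : Set (E d) := {x | ε < Metric.infDist x Ωᶜ} with hS
  have hSo : IsOpen S := isOpen_lt continuous_const (Metric.continuous_infDist_pt _)
  set S' : Set (E d) := (fun y => ε • y) ⁻¹' S with hS'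
  have hS'm : MeasurableSet S' := (hSo.preimage (continuous_const_smul ε)).measurableSet
  set F : E d → ℝ := S'.indicator fun _ => 1 with hF
  have hFl : LocallyIntegrable F := (locallyIntegrable_const (1 : ℝ)).indicator hS'm
  set ζ := conv F β with hζ
  have hζs : ContDiff ℝ ∞ ζ := hβt.contDiff_conv hFl
  set η : E d → ℝ := fun x => ζ (ε⁻¹ • x) with hη
  have hηs : ContDiff ℝ ∞ η := hζs.comp (contDiff_const_smul _)
  have hdist : ∀ x y : E d, y ∈ Metric.ball (ε⁻¹ • x) (1 / 2) → dist x (ε • y) < ε / 2 := by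
    intro x y hy
    have h1 : x - ε • y = ε • (ε⁻¹ • x - y) := by
      rw [smul_sub, smul_smul, mul_inv_cancel₀ hε.ne', one_smul]
    rw [dist_eq_norm, h1, norm_smul, Real.norm_of_nonneg hε.le]
    rw [mem_ball_iff_norm'] at hy
    linarith [mul_lt_mul_of_pos_left hy hε]
  -- The mollification moves points by less than ε/2: the support keeps distance ε - ε/2 from the
  -- complement, and η = 1 at distance 2ε ≥ ε + ε/2.
  have hsupp : tsupport η ⊆ {x | ε / 2 ≤ Metric.infDist x Ωᶜ} := by
    refine closure_minimal (fun x hx => ?_)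
      (isClosed_le continuous_const (Metric.continuous_infDist_pt _))
    by_contra hlt
    simp only [mem_ofPred_eq, not_le] at hlt
    refine hx (conv_eq_zero_of_ball_subset hβ0 fun y hy => ?_)
    refine indicator_of_notMem (fun hyS => ?_) _
    have h1 : ε < Metric.infDist (ε • y) Ωᶜ := hyS
    have h2 := Metric.infDist_le_infDist_add_dist (s := Ωᶜ) (x := ε • y) (y := x)
    have h3 := hdist x y hy
    rw [dist_comm] at h3
    linarith
  have hsΩ : tsupport η ⊆ Ω := by
    intro x hx
    by_contra hxΩ
    have h1 : ε / 2 ≤ Metric.infDist x Ωᶜ := hsupp hx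
    rw [Metric.infDist_zero_of_mem (show x ∈ Ωᶜ from hxΩ)] at h1
    linarith
  have hone : ∀ x ∈ innerRegion Ω (2 * ε), η x = 1 := by
    intro x hx
    have hball := ball_subset_of_mem_innerRegion hΩ (by positivity) hx
    -- The distance to the empty set is 0 by convention, so for Ω = ℝ^d the inner region would be
    -- empty.
    have hne : (Ωᶜ).Nonempty := by
      by_contra hne
      rw [not_nonempty_iff_eq_empty, compl_empty_iff] at hne
      have := hx.2
      rw [hne, frontier_univ, Metric.infDist_empty] at this
      linarith
    have hinf : 2 * ε ≤ Metric.infDist x Ωᶜ := by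
      refine (Metric.le_infDist hne).2 fun y hy => ?_
      by_contra hlt
      refine hy (hball ?_)
      rw [Metric.mem_ball, dist_comm]
      exact not_le.1 hlt
    have h1 : ∀ y, F y * β (ε⁻¹ • x - y) = β (ε⁻¹ • x - y) := by
      intro y
      by_cases hy : y ∈ Metric.ball (ε⁻¹ • x) (1 / 2)
      · have h2 := Metric.infDist_le_infDist_add_dist (s := Ωᶜ) (x := x) (y := ε • y)
        have h3 := hdist x y hy
        have h4 : y ∈ S' := by
          change ε < Metric.infDist (ε • y) Ωᶜ
          linarith
        rw [hF, indicator_of_mem h4, one_mul]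
      · rw [hβ0, mul_zero]
        rw [Metric.mem_ball, not_lt, dist_comm, dist_eq_norm] at hy
        exact hy
    change ∫ y, F y * β (ε⁻¹ • x - y) = 1
    simp only [h1]
    rw [integral_sub_left_eq_self (fun y => β y) volume (ε⁻¹ • x)]
    exact φ.integral_normed
  refine ⟨η, ⟨⟨hηs, ?_⟩, hsΩ, fun x => ?_, fun x => ?_, hone, fun x hx i => ?_, fun x i => ?_⟩⟩
  · exact Metric.isCompact_of_isClosed_isBounded isClosed_closure (hb.subset hsΩ)
  · refine integral_nonneg fun y => mul_nonneg (indicator_nonneg (fun _ _ => zero_le_one) y)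
      (φ.nonneg_normed _)
  · refine (le_abs_self _).trans ((abs_conv_indicator_le hβt S' _).trans_eq ?_)
    rw [← φ.integral_normed (μ := volume)]
    congr 1 with y
    exact abs_of_nonneg (φ.nonneg_normed _)
  · have : η =ᶠ[𝓝 x] fun _ => 1 := by
      filter_upwards [(isOpen_innerRegion hΩ (2 * ε)).mem_nhds hx] with y hy using hone y hy
    unfold partialDeriv
    rw [this.fderiv_eq]
    simp
  · rw [partialDeriv_comp_smul hζs, abs_mul, abs_of_pos (inv_pos.2 hε), ← mul_assoc,
      mul_inv_cancel₀ hε.ne', one_mul, hζ, hβt.partialDeriv_conv hFl]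
    refine (abs_conv_indicator_le (hβt.partialDeriv i) S' _).trans ?_
    exact Finset.single_le_sum (f := fun i => ∫ y, |partialDeriv i β y|)
      (fun i _ => integral_nonneg fun y => abs_nonneg _) (Finset.mem_univ i)


/-! ### Products of Sobolev functions -/

/-- Functions in `H¹(Ω)` which are limits in `H¹(Ω)` of functions smooth on `ℝ^d`. -/
def IsSmoothLimit (Ω : Set (E d)) (φ : E d → ℝ) (Dφ : Fin d → E d → ℝ) : Prop :=
  IsH1 Ω φ Dφ ∧ ∃ v : ℕ → E d → ℝ, (∀ n, ContDiff ℝ ∞ (v n)) ∧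
    Tendsto (fun n => eLpNorm (fun x => v n x - φ x) 2 (volume.restrict Ω)) atTop (𝓝 0) ∧
    ∀ i, Tendsto (fun n => eLpNorm (fun x => partialDeriv i (v n) x - Dφ i x) 2
      (volume.restrict Ω)) atTop (𝓝 0)

theorem IsH1.mono {Ω Ω' : Set (E d)} {u : E d → ℝ} {Du : Fin d → E d → ℝ} (h : IsH1 Ω u Du)
    (hs : Ω' ⊆ Ω) : IsH1 Ω' u Du :=
  ⟨h.1.mono_measure (Measure.restrict_mono hs le_rfl), fun i =>
    ⟨(h.2 i).1.mono_measure (Measure.restrict_mono hs le_rfl), (h.2 i).2.mono hs⟩⟩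

/-- The approximating sequence is part of the definition of the trace; uniqueness of weak gradients
identifies its limit gradient with the given one. -/
theorem HasTrace.isSmoothLimit {Ω : Set (E d)} (hΩ : IsOpen Ω) {φ t : E d → ℝ}
    {Dφ : Fin d → E d → ℝ} (h : HasTrace Ω φ t) (hφ : IsH1 univ φ Dφ) :
    IsSmoothLimit Ω φ Dφ := by
  obtain ⟨-, Du, hDu, v, hv, h1, h2, -⟩ := h
  have hφΩ := hφ.mono (subset_univ Ω)
  refine ⟨hφΩ, v, hv, h1, fun i => ?_⟩
  have hae := (hDu.2 i).2.ae_eq hΩ (hφΩ.2 i).2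
  refine (h2 i).congr fun n => eLpNorm_congr_ae ?_
  filter_upwards [hae] with x hx
  rw [hx]

theorem LocL2.mul_test_memLp {q τ : E d → ℝ} (hq : LocL2 q) (hτ : Continuous τ) {Ω : Set (E d)}
    (hb : Bornology.IsBounded Ω) : MemLp (fun x => q x * τ x) 2 (volume.restrict Ω) :=
  (hq.mul_continuous hτ).memLp hb

/-- Testing the equation `div P = q` with the product of `φ ∈ H¹(Ω)` and a test function. -/
theorem HasWeakDiv.sum_integral_mul {Ω : Set (E d)} (hb : Bornology.IsBounded Ω)
    {P : Fin d → E d → ℝ} {q : E d → ℝ} (h : HasWeakDiv P q) {φ : E d → ℝ}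
    {Dφ : Fin d → E d → ℝ} (hφ : IsSmoothLimit Ω φ Dφ) {τ : E d → ℝ} (hτ : IsTest τ)
    (hs : tsupport τ ⊆ Ω) :
    ∑ j, ((∫ x in Ω, φ x * (P j x * partialDeriv j τ x)) + ∫ x in Ω, Dφ j x * (P j x * τ x)) =
      -∫ x in Ω, φ x * (q x * τ x) := by
  obtain ⟨hφ1, v, hv, hlim, hDlim⟩ := hφ
  have hvL : ∀ n, MemLp (v n) 2 (volume.restrict Ω) := fun n =>
    (LocL2.of_continuous (hv n).continuous).memLp hb
  have hDvL : ∀ n j, MemLp (partialDeriv j (v n)) 2 (volume.restrict Ω) := fun n j =>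
    (LocL2.of_continuous (contDiff_partialDeriv (hv n) j).continuous).memLp hb
  have hPτ : ∀ j, MemLp (fun x => P j x * τ x) 2 (volume.restrict Ω) := fun j =>
    (h.left j).mul_test_memLp hτ.continuous hb
  have hPDτ : ∀ j, MemLp (fun x => P j x * partialDeriv j τ x) 2 (volume.restrict Ω) := fun j =>
    (h.left j).mul_test_memLp (hτ.partialDeriv j).continuous hb
  have hqτ := h.right.mul_test_memLp hτ.continuous hb
  -- For smooth v_n the product v_n τ is a test function. All coefficients multiplying v_n and ∇v_n
  -- are in L²(Ω), so both sides converge.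
  have e : ∀ n, ∑ j, ((∫ x in Ω, v n x * (P j x * partialDeriv j τ x)) +
      ∫ x in Ω, partialDeriv j (v n) x * (P j x * τ x)) = -∫ x in Ω, v n x * (q x * τ x) := by
    intro n
    have h1 := h.sum_integral _ (hτ.mul_left (hv n))
    have hsv : tsupport (fun x => v n x * τ x) ⊆ Ω :=
      (tsupport_mul_subset_right (f := v n) (g := τ)).trans hs
    rw [← setIntegral_mul_eq_integral q hsv] at h1
    have e1 : ∫ x in Ω, v n x * (q x * τ x) = ∫ x in Ω, q x * (v n x * τ x) := by
      congr 1 with x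
      ring
    rw [e1, ← h1]
    refine Finset.sum_congr rfl fun j _ => ?_
    rw [← setIntegral_mul_eq_integral (P j) ((tsupport_partialDeriv_subset _ j).trans hsv)]
    have i1 : Integrable (fun x => v n x * (P j x * partialDeriv j τ x)) (volume.restrict Ω) :=
      (hvL n).integrable_mul (hPDτ j)
    have i2 : Integrable (fun x => partialDeriv j (v n) x * (P j x * τ x)) (volume.restrict Ω) :=
      (hDvL n j).integrable_mul (hPτ j)
    rw [← integral_add i1 i2]
    congr 1 with x
    rw [partialDeriv_mul (hv n) hτ.contDiff]
    ring
  have l1 := tendsto_finsetSum Finset.univ fun j _ =>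
    (tendsto_integral_mul_of_eLpNorm (Eventually.of_forall hvL) hφ1.1 (hPDτ j) hlim).add
      (tendsto_integral_mul_of_eLpNorm (Eventually.of_forall fun n => hDvL n j) (hφ1.2 j).1
        (hPτ j) (hDlim j))
  have l2 := (tendsto_integral_mul_of_eLpNorm (Eventually.of_forall hvL) hφ1.1 hqτ hlim).neg
  exact tendsto_nhds_unique l1 (l2.congr fun n => (e n).symm)

/-- A weak partial derivative is the divergence of the field u e_i, so the product rule is the
preceding lemma for this field. The products need only be integrable here; their square
integrability comes from the weight. -/
theorem HasWeakPartial.mul {Ω : Set (E d)} (hb : Bornology.IsBounded Ω) {i : Fin d}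
    {u Du : E d → ℝ} (h : HasWeakPartial univ i u Du) (hu : LocL2 u) (hDu : LocL2 Du)
    {φ : E d → ℝ} {Dφ : Fin d → E d → ℝ} (hφ : IsSmoothLimit Ω φ Dφ) :
    HasWeakPartial Ω i (fun x => u x * φ x) (fun x => Du x * φ x + u x * Dφ i x) := by
  have hL : HasWeakDiv (fun j => if j = i then u else fun _ => 0) Du := by
    refine ⟨fun j => ?_, hDu, fun ψ hψ => ?_⟩
    · by_cases hj : j = i
      · simpa [hj] using hu
      · simpa [hj] using LocL2.const 0
    · rw [← h.integral_eq hψ, Finset.sum_eq_single i (fun j _ hj => by simp [hj]) (by simp)]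
      simp
  have i1 : IntegrableOn (fun x => u x * φ x) Ω := (hu.memLp hb).integrable_mul hφ.1.1
  have i2 : IntegrableOn (fun x => Du x * φ x) Ω := (hDu.memLp hb).integrable_mul hφ.1.1
  have i3 : IntegrableOn (fun x => u x * Dφ i x) Ω := (hu.memLp hb).integrable_mul (hφ.1.2 i).1
  refine ⟨i1.locallyIntegrableOn, (i2.add i3).locallyIntegrableOn, fun ψ h1 h2 hs => ?_⟩
  have hψ : IsTest ψ := ⟨h1, h2⟩
  have key := hL.sum_integral_mul hb hφ hψ hs
  rw [Finset.sum_eq_single i (fun j _ hj => by simp [hj]) (by simp)] at key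
  simp only [if_true] at key
  have e1 : ∫ x in Ω, u x * φ x * partialDeriv i ψ x =
      ∫ x in Ω, φ x * (u x * partialDeriv i ψ x) := by
    congr 1 with x
    ring
  have j2 : Integrable (fun x => φ x * (Du x * ψ x)) (volume.restrict Ω) :=
    hφ.1.1.integrable_mul (hDu.mul_test_memLp hψ.continuous hb)
  have j3 : Integrable (fun x => Dφ i x * (u x * ψ x)) (volume.restrict Ω) :=
    (hφ.1.2 i).1.integrable_mul (hu.mul_test_memLp hψ.continuous hb)
  have e2 : ∫ x in Ω, (Du x * φ x + u x * Dφ i x) * ψ x =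
      (∫ x in Ω, φ x * (Du x * ψ x)) + ∫ x in Ω, Dφ i x * (u x * ψ x) := by
    rw [← integral_add j2 j3]
    congr 1 with x
    ring
  rw [e1, e2]
  linarith

/-! ### Identities in the interior -/

theorem memLp_mul_bdd {ν : Measure (E d)} {f g : E d → ℝ} {κ : ℝ} (hf : Continuous f)
    (hb : ∀ x, |f x| ≤ κ) (hg : MemLp g 2 ν) : MemLp (fun x => g x * f x) 2 ν := by
  simpa only [mul_comm] using
    memLp_bdd_mul hf.aestronglyMeasurable (Eventually.of_forall hb) hg

theorem IsTest.exists_bound {ψ : E d → ℝ} (h : IsTest ψ) : ∃ C : ℝ, ∀ x, |ψ x| ≤ C :=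
  h.hasCompactSupport.exists_bound_of_continuous h.continuous

theorem IsTest.memLp_mul {ν : Measure (E d)} {g ψ : E d → ℝ} (h : IsTest ψ) (hg : MemLp g 2 ν) :
    MemLp (fun x => g x * ψ x) 2 ν := by
  obtain ⟨C, hC⟩ := h.exists_bound
  exact memLp_mul_bdd h.continuous hC hg

/-- Square integrability of the products of a field, its divergence, `φ` and `∇φ`. -/
structure MulMemLp (Ω : Set (E d)) (P : Fin d → E d → ℝ) (q φ : E d → ℝ) (Dφ : Fin d → E d → ℝ) :
    Prop where
  right : MemLp (fun x => q x * φ x) 2 (volume.restrict Ω)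
  left : ∀ j, MemLp (fun x => P j x * φ x) 2 (volume.restrict Ω)
  left_partial : ∀ j, MemLp (fun x => P j x * Dφ j x) 2 (volume.restrict Ω)

/-- The function `q φ η + P · ∇(φ η)`. -/
def localized (P : Fin d → E d → ℝ) (q φ : E d → ℝ) (Dφ : Fin d → E d → ℝ) (η : E d → ℝ)
    (x : E d) : ℝ :=
  q x * φ x * η x + ∑ j, P j x * (Dφ j x * η x + φ x * partialDeriv j η x)

theorem memLp_of_restrict {Ω : Set (E d)} (hΩ : IsOpen Ω) {f : E d → ℝ}
    (h : MemLp f 2 (volume.restrict Ω)) (h0 : ∀ x ∉ Ω, f x = 0) : MemLp f 2 volume := by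
  have : Ω.indicator f = f := by
    rw [indicator_eq_self]
    intro x hx
    by_contra hxΩ
    exact hx (h0 x hxΩ)
  rw [← this]
  exact (memLp_indicator_iff_restrict hΩ.measurableSet).2 h

theorem MulMemLp.localized_memLp {Ω : Set (E d)} {P : Fin d → E d → ℝ} {q φ η : E d → ℝ}
    {Dφ : Fin d → E d → ℝ} (h : MulMemLp Ω P q φ Dφ) (hη : IsTest η) :
    MemLp (localized P q φ Dφ η) 2 (volume.restrict Ω) := by
  refine (hη.memLp_mul h.right).add (memLp_finsetSum _ fun j _ => ?_)
  have := (hη.memLp_mul (h.left_partial j)).add ((hη.partialDeriv j).memLp_mul (h.left j))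
  refine this.ae_eq (Eventually.of_forall fun x => ?_)
  simp only [Pi.add_apply]
  ring

theorem localized_eq_zero {P : Fin d → E d → ℝ} {q φ η : E d → ℝ} {Dφ : Fin d → E d → ℝ} {x : E d}
    (hx : x ∉ tsupport η) : localized P q φ Dφ η x = 0 := by
  simp [localized, partialDeriv_eq_zero_of_notMem hx, image_eq_zero_of_notMem_tsupport hx]

theorem setIntegral_eq_integral_of_tsupport {Ω : Set (E d)} {η f : E d → ℝ} (hs : tsupport η ⊆ Ω)
    (hf : ∀ x ∉ tsupport η, f x = 0) : ∫ x in Ω, f x = ∫ x, f x :=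
  setIntegral_eq_integral_of_forall_compl_eq_zero fun x hx => hf x fun h => hx (hs h)

/-- In other words div(Pφη) = qφη + P·∇(φη) in the sense of distributions: take τ = ηζ in
`HasWeakDiv.sum_integral_mul` and expand ∇(ηζ). -/
theorem HasWeakDiv.localized_test {Ω : Set (E d)} (hb : Bornology.IsBounded Ω)
    {P : Fin d → E d → ℝ} {q : E d → ℝ} (h : HasWeakDiv P q) {φ : E d → ℝ}
    {Dφ : Fin d → E d → ℝ} (hφ : IsSmoothLimit Ω φ Dφ) (hm : MulMemLp Ω P q φ Dφ)
    {η : E d → ℝ} (hη : IsTest η)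
    (hs : tsupport η ⊆ Ω) {ζ : E d → ℝ} (hζ : IsTest ζ) :
    (∫ x in Ω, localized P q φ Dφ η x * ζ x) +
      ∑ j, ∫ x in Ω, P j x * φ x * η x * partialDeriv j ζ x = 0 := by
  have hτ : IsTest fun x => η x * ζ x := hζ.mul_left hη.contDiff
  have hsτ : tsupport (fun x => η x * ζ x) ⊆ Ω :=
    (tsupport_mul_subset_left (f := η) (g := ζ)).trans hs
  have key := h.sum_integral_mul hb hφ hτ hsτ
  have hint : ∀ {f g : E d → ℝ}, MemLp f 2 (volume.restrict Ω) → IsTest g →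
      Integrable (fun x => f x * g x) (volume.restrict Ω) := fun hf hg =>
    hf.integrable_mul ((LocL2.of_continuous hg.continuous).memLp hb)
  have i1 : Integrable (fun x => q x * φ x * η x * ζ x) (volume.restrict Ω) :=
    hint (hη.memLp_mul hm.right) hζ
  have i2 : ∀ j, Integrable (fun x => P j x * (Dφ j x * η x + φ x * partialDeriv j η x) * ζ x)
      (volume.restrict Ω) := by
    intro j
    have := hint ((hη.memLp_mul (hm.left_partial j)).add
      ((hη.partialDeriv j).memLp_mul (hm.left j))) hζ
    refine this.congr (Eventually.of_forall fun x => ?_)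
    simp only [Pi.add_apply]
    ring
  have i3 : ∀ j, Integrable (fun x => P j x * φ x * η x * partialDeriv j ζ x)
      (volume.restrict Ω) := fun j => hint (hη.memLp_mul (hm.left j)) (hζ.partialDeriv j)
  have e1 : ∫ x in Ω, localized P q φ Dφ η x * ζ x = (∫ x in Ω, q x * φ x * η x * ζ x) +
      ∑ j, ∫ x in Ω, P j x * (Dφ j x * η x + φ x * partialDeriv j η x) * ζ x := by
    rw [← integral_finsetSum _ fun j _ => i2 j, ← integral_add i1 (integrable_finsetSum _
      fun j _ => i2 j)]
    refine integral_congr_ae (Eventually.of_forall fun x => ?_)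
    simp only [localized, add_mul, Finset.sum_mul]
  have e2 : ∀ j, (∫ x in Ω, φ x * (P j x * partialDeriv j (fun x => η x * ζ x) x)) +
      ∫ x in Ω, Dφ j x * (P j x * (η x * ζ x)) =
      (∫ x in Ω, P j x * (Dφ j x * η x + φ x * partialDeriv j η x) * ζ x) +
        ∫ x in Ω, P j x * φ x * η x * partialDeriv j ζ x := by
    intro j
    have k1 : Integrable (fun x => φ x * (P j x * partialDeriv j (fun x => η x * ζ x) x))
        (volume.restrict Ω) :=
      hφ.1.1.integrable_mul ((h.left j).mul_test_memLp (hτ.partialDeriv j).continuous hb)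
    have k2 : Integrable (fun x => Dφ j x * (P j x * (η x * ζ x))) (volume.restrict Ω) :=
      (hφ.1.2 j).1.integrable_mul ((h.left j).mul_test_memLp hτ.continuous hb)
    rw [← integral_add k1 k2, ← integral_add (i2 j) (i3 j)]
    refine integral_congr_ae (Eventually.of_forall fun x => ?_)
    simp only [partialDeriv_mul hη.contDiff hζ.contDiff]
    ring
  have e3 : ∫ x in Ω, φ x * (q x * (η x * ζ x)) = ∫ x in Ω, q x * φ x * η x * ζ x := by
    congr 1 with x
    ring
  simp only [e2, Finset.sum_add_distrib, e3] at key
  rw [e1]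
  linarith

/-- The fields are square integrable with support inside that of η, so the identity tested with
smooth ζ extends to all of H¹(Ω), without boundary terms. -/
theorem HasWeakDiv.localized_eq_zero {Ω : Set (E d)} (hΩ : IsOpen Ω) (hb : Bornology.IsBounded Ω)
    {P : Fin d → E d → ℝ} {q : E d → ℝ} (h : HasWeakDiv P q) {φ : E d → ℝ}
    {Dφ : Fin d → E d → ℝ} (hφ : IsSmoothLimit Ω φ Dφ) (hm : MulMemLp Ω P q φ Dφ)
    {η : E d → ℝ} (hη : IsTest η) (hs : tsupport η ⊆ Ω) {v : E d → ℝ} {Dv : Fin d → E d → ℝ}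
    (hv : IsH1 Ω v Dv) :
    (∫ x in Ω, localized P q φ Dφ η x * v x) +
      ∑ j, ∫ x in Ω, P j x * φ x * η x * Dv j x = 0 := by
  refine integral_add_sum_eq_zero_of_test hΩ hη.hasCompactSupport hs
    (memLp_of_restrict hΩ (hm.localized_memLp hη) fun x hx =>
        NeumannHomogenization.localized_eq_zero
      fun h => hx (hs h))
    (fun j => memLp_of_restrict hΩ (hη.memLp_mul (hm.left j)) fun x hx => by
      rw [image_eq_zero_of_notMem_tsupport fun h => hx (hs h), mul_zero])
    (fun j x hx => by rw [image_eq_zero_of_notMem_tsupport hx, mul_zero]) (fun ζ hζ => ?_) hv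
  have key := h.localized_test hb hφ hm hη hs hζ
  rw [setIntegral_eq_integral_of_tsupport hs fun x hx => by
    rw [NeumannHomogenization.localized_eq_zero hx, zero_mul]] at key
  rw [← key]
  congr 1
  refine Finset.sum_congr rfl fun j _ => (setIntegral_eq_integral_of_tsupport hs fun x hx =>
      ?_).symm
  rw [image_eq_zero_of_notMem_tsupport hx, mul_zero, zero_mul]

/-- The contribution of a skew-symmetric flux corrector. -/
theorem sum_integral_localized_eq_zero {Ω : Set (E d)} (hΩ : IsOpen Ω)
    (hb : Bornology.IsBounded Ω) {P : Fin d → Fin d → E d → ℝ} {q : Fin d → E d → ℝ}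
    (h : ∀ i, HasWeakDiv (P i) (q i)) (hskew : ∀ i j x, P i j x = -P j i x) {φ : E d → ℝ}
    {Dφ : Fin d → E d → ℝ} (hφ : IsSmoothLimit Ω φ Dφ) (hm : ∀ i, MulMemLp Ω (P i) (q i) φ Dφ)
    {η : E d → ℝ} (hη : IsTest η) (hs : tsupport η ⊆ Ω) {v : E d → ℝ} {Dv : Fin d → E d → ℝ}
    (hv : IsH1 Ω v Dv) :
    ∑ i, ∫ x in Ω, localized (P i) (q i) φ Dφ η x * Dv i x = 0 := by
  -- The vector of divergences is divergence free: f = 0 and G is that vector.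
  have main := integral_add_sum_eq_zero_of_test (f := fun _ => 0)
    (G := fun i => localized (P i) (q i) φ Dφ η) hΩ hη.hasCompactSupport hs MemLp.zero'
    (fun i => memLp_of_restrict hΩ ((hm i).localized_memLp hη) fun x hx =>
      NeumannHomogenization.localized_eq_zero fun h => hx (hs h))
    (fun i x hx => NeumannHomogenization.localized_eq_zero hx) (fun ζ hζ => ?_) hv
  · simpa using main
  simp only [zero_mul, integral_zero, zero_add]
  have e1 : ∀ i, ∫ x, localized (P i) (q i) φ Dφ η x * partialDeriv i ζ x =
      -∑ j, ∫ x in Ω, P i j x * φ x * η x * partialDeriv j (partialDeriv i ζ) x := by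
    intro i
    have key := (h i).localized_test hb hφ (hm i) hη hs (hζ.partialDeriv i)
    rw [setIntegral_eq_integral_of_tsupport hs fun x hx => by
      rw [NeumannHomogenization.localized_eq_zero hx, zero_mul]] at key
    linarith
  simp only [e1, Finset.sum_neg_distrib, neg_eq_zero]
  have e2 : ∀ i j, ∫ x in Ω, P i j x * φ x * η x * partialDeriv j (partialDeriv i ζ) x =
      -∫ x in Ω, P j i x * φ x * η x * partialDeriv i (partialDeriv j ζ) x := by
    intro i j
    rw [← integral_neg]
    congr 1 with x
    rw [hskew i j, partialDeriv_comm hζ.contDiff]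
    ring
  -- A skew matrix contracted with the symmetric Hessian of ζ: the sum equals its own negative.
  have e3 : ∑ i, ∑ j, ∫ x in Ω, P i j x * φ x * η x * partialDeriv j (partialDeriv i ζ) x =
      -∑ i, ∑ j, ∫ x in Ω, P i j x * φ x * η x * partialDeriv j (partialDeriv i ζ) x := by
    conv_lhs => rw [Finset.sum_comm]
    simp only [← Finset.sum_neg_distrib]
    exact Finset.sum_congr rfl fun j _ => Finset.sum_congr rfl fun i _ => e2 i j
  linarith


/-! ### Algebra of the two-scale expansion at a point -/

theorem abs_sum_le_of_forall {n : ℕ} {f : Fin n → ℝ} {K : ℝ} (h : ∀ i, |f i| ≤ K) :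
    |∑ i, f i| ≤ n * K := by
  refine (Finset.abs_sum_le_sum_abs _ _).trans ((Finset.sum_le_sum fun i _ => h i).trans_eq ?_)
  simp

/-- The same identity serves the flux (p = A, r = V, M the means Â and V̂, Q = b) and the lower
order part (p = B, r = c, Q = W). Adding and subtracting φ inside (M - p)∇u₀ and (M - r)u₀ leaves (M
- p)φ, which combines with the fast part p ∇χ φ into Qφ. -/
theorem twoScale_expansion {ε : ℝ} (hε : ε ≠ 0) (M Q : Fin (d + 1) → Fin m → ℝ)
    (p : Fin d → Fin m → ℝ) (r : Fin m → ℝ) (χ : Fin (d + 1) → Fin m → Fin m → ℝ)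
    (Dχ : Fin (d + 1) → Fin d → Fin m → Fin m → ℝ) (φ : Fin (d + 1) → Fin m → ℝ)
    (Dφ : Fin (d + 1) → Fin d → Fin m → ℝ) (u : Fin m → ℝ) (Du : Fin d → Fin m → ℝ)
    (hQ0 : ∀ γ, Q 0 γ = M 0 γ - (r γ + ∑ j, ∑ β, p j β * Dχ 0 j β γ))
    (hQs : ∀ l γ, Q (Fin.succ l) γ =
      M l.succ γ - (p l γ + ∑ j, ∑ β, p j β * Dχ l.succ j β γ)) :
    ((∑ j, ∑ β, M (Fin.succ j) β * Du j β) + ∑ β, M 0 β * u β) -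
      ((∑ j, ∑ β, p j β * Du j β) + ∑ β, r β * u β) -
      ((∑ j, ∑ β, p j β * (ε * ∑ k, ∑ γ, (ε⁻¹ * Dχ k j β γ * φ k γ + χ k β γ * Dφ k j γ))) +
        ∑ β, r β * (ε * ∑ k, ∑ γ, χ k β γ * φ k γ)) =
    (∑ j, ∑ β, (M (Fin.succ j) β - p j β) * (Du j β - φ (Fin.succ j) β)) +
      (∑ β, (M 0 β - r β) * (u β - φ 0 β)) + (∑ k, ∑ γ, Q k γ * φ k γ) -
      (∑ j, ∑ β, p j β * ∑ k, ∑ γ, ε * (χ k β γ * Dφ k j γ)) -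
      ∑ β, r β * ∑ k, ∑ γ, ε * (χ k β γ * φ k γ) := by
  have h1 : ∀ j β, ε * ∑ k, ∑ γ, (ε⁻¹ * Dχ k j β γ * φ k γ + χ k β γ * Dφ k j γ) =
      (∑ k, ∑ γ, Dχ k j β γ * φ k γ) + ∑ k, ∑ γ, ε * (χ k β γ * Dφ k j γ) := by
    intro j β
    simp only [Finset.mul_sum, ← Finset.sum_add_distrib]
    refine Finset.sum_congr rfl fun k _ => Finset.sum_congr rfl fun γ _ => ?_
    field_simp
  have h2 : ∑ j, ∑ β, p j β * ∑ k, ∑ γ, Dχ k j β γ * φ k γ =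
      ∑ k, ∑ γ, (∑ j, ∑ β, p j β * Dχ k j β γ) * φ k γ := by
    simp only [Finset.mul_sum, Finset.sum_mul]
    calc ∑ j, ∑ β, ∑ k, ∑ γ, p j β * (Dχ k j β γ * φ k γ)
        = ∑ j, ∑ k, ∑ β, ∑ γ, p j β * (Dχ k j β γ * φ k γ) :=
          Finset.sum_congr rfl fun j _ => Finset.sum_comm
      _ = ∑ k, ∑ j, ∑ β, ∑ γ, p j β * (Dχ k j β γ * φ k γ) := Finset.sum_comm
      _ = ∑ k, ∑ j, ∑ γ, ∑ β, p j β * (Dχ k j β γ * φ k γ) :=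
          Finset.sum_congr rfl fun k _ => Finset.sum_congr rfl fun j _ => Finset.sum_comm
      _ = ∑ k, ∑ γ, ∑ j, ∑ β, p j β * (Dχ k j β γ * φ k γ) :=
          Finset.sum_congr rfl fun k _ => Finset.sum_comm
      _ = _ := by simp only [mul_assoc]
  have h3 : ∀ β, ε * ∑ k, ∑ γ, χ k β γ * φ k γ = ∑ k, ∑ γ, ε * (χ k β γ * φ k γ) := by
    intro β
    simp only [Finset.mul_sum]
  rw [Fin.sum_univ_succ] at h2
  rw [Fin.sum_univ_succ (fun k => ∑ γ, Q k γ * φ k γ)]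
  simp only [h1, h3, hQ0, hQs]
  simp only [mul_add, sub_mul, mul_sub, add_mul, Finset.sum_add_distrib,
    Finset.sum_sub_distrib, h2]
  ring

/-- The common structure of the bounds of the residuals of the two-scale expansion. -/
theorem abs_residual_le {ε h s C₀ κ C₃ Cη : ℝ} (hε : 0 < ε) (hκ : 0 ≤ κ)
    (hC₃ : 0 ≤ C₃) {M Q : Fin (d + 1) → Fin m → ℝ}
    {p : Fin d → Fin m → ℝ} {r : Fin m → ℝ} {χ : Fin (d + 1) → Fin m → Fin m → ℝ}
    {P : Fin (d + 1) → Fin m → Fin d → ℝ} {φ : Fin (d + 1) → Fin m → ℝ}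
    {Dφ : Fin (d + 1) → Fin d → Fin m → ℝ} {u : Fin m → ℝ} {Du : Fin d → Fin m → ℝ}
    {η : ℝ} {Dη : Fin d → ℝ}
    (hM : ∀ k γ, |M k γ| ≤ C₀) (hp : ∀ j β, |p j β| ≤ κ) (hr : ∀ β, |r β| ≤ κ)
    (hQ : ∀ k γ, |Q k γ| ≤ C₃ * h) (hχ : ∀ k β γ, |χ k β γ| ≤ h) (hP : ∀ k γ j, |P k γ j| ≤ h)
    (hη0 : 0 ≤ η) (hη1 : η ≤ 1)
    (hDu : ∀ j β, |Du j β - φ (Fin.succ j) β| ≤ s) (hu : ∀ β, |u β - φ 0 β| ≤ s)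
    (hφ : ∀ k γ, ε * h * |φ k γ| ≤ s) (hDφ : ∀ k j γ, ε * h * |Dφ k j γ| ≤ s)
    (hφη : ∀ k γ, (1 - η) * (h * |φ k γ|) ≤ s)
    (hDη : ∀ k γ j, ε * |Dη j| * (h * |φ k γ|) ≤ Cη * s) :
    |(∑ j, ∑ β, (M (Fin.succ j) β - p j β) * (Du j β - φ (Fin.succ j) β)) +
      (∑ β, (M 0 β - r β) * (u β - φ 0 β)) + (∑ k, ∑ γ, Q k γ * φ k γ) -
      (∑ j, ∑ β, p j β * ∑ k, ∑ γ, ε * (χ k β γ * Dφ k j γ)) -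
      (∑ β, r β * ∑ k, ∑ γ, ε * (χ k β γ * φ k γ)) -
      ∑ k, ∑ γ, (Q k γ * φ k γ * η + ∑ j, ε * P k γ j * (Dφ k j γ * η + φ k γ * Dη j))| ≤
    (d * (m * (C₀ + κ)) + m * (C₀ + κ) + (d + 1) * (m * C₃) + d * (m * (κ * ((d + 1) * m))) +
      m * (κ * ((d + 1) * m)) + (d + 1) * (m * (d * (1 + Cη)))) * s := by
  have hcast : ((d + 1 : ℕ) : ℝ) = d + 1 := by push_cast; ring
  have t1 : |∑ j, ∑ β, (M (Fin.succ j) β - p j β) * (Du j β - φ (Fin.succ j) β)| ≤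
      d * (m * ((C₀ + κ) * s)) := abs_sum_le_of_forall fun j => abs_sum_le_of_forall fun β => by
    rw [abs_mul]
    have h1 := (abs_sub (M (Fin.succ j) β) (p j β)).trans (add_le_add (hM _ _) (hp _ _))
    exact mul_le_mul h1 (hDu j β) (abs_nonneg _) ((abs_nonneg _).trans h1)
  have t2 : |∑ β, (M 0 β - r β) * (u β - φ 0 β)| ≤ m * ((C₀ + κ) * s) :=
    abs_sum_le_of_forall fun β => by
      rw [abs_mul]
      have h1 := (abs_sub (M 0 β) (r β)).trans (add_le_add (hM _ _) (hr _))
      exact mul_le_mul h1 (hu β) (abs_nonneg _) ((abs_nonneg _).trans h1)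
  have t3 : |∑ k, ∑ γ, Q k γ * φ k γ * (1 - η)| ≤ (d + 1) * (m * (C₃ * s)) := by
    rw [← hcast]
    refine abs_sum_le_of_forall fun k => abs_sum_le_of_forall fun γ => ?_
    rw [abs_mul, abs_mul, abs_of_nonneg (sub_nonneg.2 hη1)]
    calc |Q k γ| * |φ k γ| * (1 - η) ≤ C₃ * h * |φ k γ| * (1 - η) := by
          have := sub_nonneg.2 hη1
          gcongr
          exact hQ k γ
      _ = C₃ * ((1 - η) * (h * |φ k γ|)) := by ring
      _ ≤ C₃ * s := mul_le_mul_of_nonneg_left (hφη k γ) hC₃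
  have t4 : |∑ j, ∑ β, p j β * ∑ k, ∑ γ, ε * (χ k β γ * Dφ k j γ)| ≤
      d * (m * (κ * ((d + 1) * (m * s)))) :=
    abs_sum_le_of_forall fun j => abs_sum_le_of_forall fun β => by
      rw [abs_mul]
      refine mul_le_mul (hp j β) ?_ (abs_nonneg _) hκ
      rw [← hcast]
      refine abs_sum_le_of_forall fun k => abs_sum_le_of_forall fun γ => ?_
      rw [abs_mul, abs_mul, abs_of_pos hε, ← mul_assoc]
      refine le_trans ?_ (hDφ k j γ)
      gcongr
      exact hχ k β γ
  have t5 : |∑ β, r β * ∑ k, ∑ γ, ε * (χ k β γ * φ k γ)| ≤ m * (κ * ((d + 1) * (m * s))) :=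
    abs_sum_le_of_forall fun β => by
      rw [abs_mul]
      refine mul_le_mul (hr β) ?_ (abs_nonneg _) hκ
      rw [← hcast]
      refine abs_sum_le_of_forall fun k => abs_sum_le_of_forall fun γ => ?_
      rw [abs_mul, abs_mul, abs_of_pos hε, ← mul_assoc]
      refine le_trans ?_ (hφ k γ)
      gcongr
      exact hχ k β γ
  have t6 : |∑ k, ∑ γ, ∑ j, ε * P k γ j * (Dφ k j γ * η + φ k γ * Dη j)| ≤
      (d + 1) * (m * (d * ((1 + Cη) * s))) := by
    rw [← hcast]
    refine abs_sum_le_of_forall fun k => abs_sum_le_of_forall fun γ =>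
      abs_sum_le_of_forall fun j => ?_
    rw [abs_mul, abs_mul, abs_of_pos hε]
    have hh : 0 ≤ h := (abs_nonneg _).trans (hP k γ j)
    have hD : |Dφ k j γ * η + φ k γ * Dη j| ≤ |Dφ k j γ| + |φ k γ| * |Dη j| := by
      refine (abs_add_le _ _).trans ?_
      rw [abs_mul, abs_mul, abs_of_nonneg hη0]
      have := mul_le_of_le_one_right (abs_nonneg (Dφ k j γ)) hη1
      linarith
    calc ε * |P k γ j| * |Dφ k j γ * η + φ k γ * Dη j|
        ≤ ε * h * (|Dφ k j γ| + |φ k γ| * |Dη j|) := by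
          gcongr
          exact hP k γ j
      _ = ε * h * |Dφ k j γ| + ε * |Dη j| * (h * |φ k γ|) := by ring
      _ ≤ s + Cη * s := add_le_add (hDφ k j γ) (hDη k γ j)
      _ = (1 + Cη) * s := by ring
  -- Subtracting the localized divergence from Qφ leaves Qφ(1 - η), which vanishes where η = 1, plus
  -- terms with a factor ε.
  have hsplit : ∑ k, ∑ γ, (Q k γ * φ k γ * η +
      ∑ j, ε * P k γ j * (Dφ k j γ * η + φ k γ * Dη j)) =
      (∑ k, ∑ γ, Q k γ * φ k γ) - (∑ k, ∑ γ, Q k γ * φ k γ * (1 - η)) +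
        ∑ k, ∑ γ, ∑ j, ε * P k γ j * (Dφ k j γ * η + φ k γ * Dη j) := by
    simp only [mul_sub, mul_one, Finset.sum_sub_distrib, Finset.sum_add_distrib]
    ring
  rw [hsplit]
  rw [abs_le] at *
  constructor <;> linarith [t1.1, t1.2, t2.1, t2.2, t3.1, t3.2, t4.1, t4.2, t5.1, t5.2, t6.1, t6.2]

/-! ### Coercivity -/

/-- The flux `A∇u + V u`. -/
def Coefficients.fluxOf (𝒜 : Coefficients d m) (u : Fin m → E d → ℝ)
    (Du : Fin d → Fin m → E d → ℝ) (i : Fin d) (α : Fin m) (x : E d) : ℝ :=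
  (∑ j, ∑ β, 𝒜.a i j α β x * Du j β x) + ∑ β, 𝒜.V i α β x * u β x

/-- The lower order terms `B∇u + c u + λ u`. -/
def Coefficients.lowOf (𝒜 : Coefficients d m) (lam : ℝ) (u : Fin m → E d → ℝ)
    (Du : Fin d → Fin m → E d → ℝ) (α : Fin m) (x : E d) : ℝ :=
  (∑ i, ∑ β, 𝒜.B i α β x * Du i β x) + (∑ β, 𝒜.c α β x * u β x) + lam * u α x

/-- The threshold for `λ` above which the bilinear form is coercive. -/
def coercivityThreshold (d m : ℕ) (μ κ : ℝ) : ℝ :=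
  2 * κ ^ 2 * d * m ^ 2 / μ + κ * m + μ / 2

theorem neg_mul_mul_le {τ κ v s t : ℝ} (hτ : 0 < τ) (hv : |v| ≤ κ) :
    -(κ ^ 2 / (2 * τ) * s ^ 2 + τ / 2 * t ^ 2) ≤ v * s * t := by
  have h1 : |-(v * s)| ≤ κ * |s| := by
    rw [abs_neg, abs_mul]; exact mul_le_mul_of_nonneg_right hv (abs_nonneg s)
  have h2 := neg_mul_le_add_sq (t := t) hτ h1
  rw [mul_pow, sq_abs] at h2
  have h3 : κ ^ 2 * s ^ 2 / (2 * τ) = κ ^ 2 / (2 * τ) * s ^ 2 := by ring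
  linarith

theorem coercive_pointwise {μ κ lam : ℝ} (hm : 0 < m) (hμ : 0 < μ)
    (hlam : coercivityThreshold d m μ κ ≤ lam)
    {a : Fin d → Fin d → Fin m → Fin m → ℝ} {V B : Fin d → Fin m → Fin m → ℝ}
    {c : Fin m → Fin m → ℝ} (hV : ∀ i α β, |V i α β| ≤ κ) (hB : ∀ i α β, |B i α β| ≤ κ)
    (hc : ∀ α β, |c α β| ≤ κ) (w : Fin m → ℝ) (ξ : Fin d → Fin m → ℝ)
    (hell : μ * ∑ i, ∑ α, ξ i α ^ 2 ≤ ∑ i, ∑ j, ∑ α, ∑ β, a i j α β * ξ i α * ξ j β) :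
    μ / 2 * ((∑ i, ∑ α, ξ i α ^ 2) + ∑ α, w α ^ 2) ≤
      (∑ i, ∑ α, ((∑ j, ∑ β, a i j α β * ξ j β) + ∑ β, V i α β * w β) * ξ i α) +
        ∑ α, ((∑ i, ∑ β, B i α β * ξ i β) + (∑ β, c α β * w β) + lam * w α) * w α := by
  set X := ∑ i, ∑ α, ξ i α ^ 2 with hX
  set Y := ∑ α, w α ^ 2 with hY
  have hY0 : 0 ≤ Y := Finset.sum_nonneg fun _ _ => sq_nonneg _
  have hm' : (0 : ℝ) < m := by exact_mod_cast hm
  -- With this τ the V and B terms each cost mτ/2 = μ/4 of the gradient square, so half of μ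
  -- remains; the corresponding squares of w are paid for by λ.
  set τ := μ / (2 * m) with hτ
  have hτ0 : 0 < τ := by positivity
  rw [sum_quadratic_eq] at hell
  have e1 : ∑ i, ∑ α, ((∑ j, ∑ β, a i j α β * ξ j β) + ∑ β, V i α β * w β) * ξ i α =
      (∑ i, ∑ α, (∑ j, ∑ β, a i j α β * ξ j β) * ξ i α) +
        ∑ i, ∑ α, ∑ β, V i α β * w β * ξ i α := by
    simp only [add_mul, Finset.sum_add_distrib, Finset.sum_mul]
  have e2 : ∑ α, ((∑ i, ∑ β, B i α β * ξ i β) + (∑ β, c α β * w β) + lam * w α) * w α =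
      (∑ i, ∑ α, ∑ β, B i α β * w α * ξ i β) + (∑ α, ∑ β, c α β * w β * w α) + lam * Y := by
    simp only [add_mul, Finset.sum_add_distrib, Finset.sum_mul, hY, Finset.mul_sum]
    refine congrArg₂ _ (congrArg₂ _ ?_ rfl) ?_
    · rw [Finset.sum_comm]
      exact Finset.sum_congr rfl fun i _ => Finset.sum_congr rfl fun α _ =>
        Finset.sum_congr rfl fun β _ => by ring
    · exact Finset.sum_congr rfl fun α _ => by ring
  set q := κ ^ 2 / (2 * τ) with hq
  have b1 : -(d * m * q * Y + m * (τ / 2) * X) ≤ ∑ i, ∑ α, ∑ β, V i α β * w β * ξ i α := by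
    have : ∑ i, ∑ α, ∑ β, -(q * w β ^ 2 + τ / 2 * ξ i α ^ 2) ≤
        ∑ i, ∑ α, ∑ β, V i α β * w β * ξ i α :=
      Finset.sum_le_sum fun i _ => Finset.sum_le_sum fun α _ => Finset.sum_le_sum fun β _ =>
        neg_mul_mul_le hτ0 (hV i α β)
    refine le_trans (le_of_eq ?_) this
    simp only [Finset.sum_neg_distrib, Finset.sum_add_distrib, ← Finset.mul_sum, Finset.sum_const,
      Finset.card_univ, Fintype.card_fin, nsmul_eq_mul, ← hX, ← hY]
    ring
  have b2 : -(d * m * q * Y + m * (τ / 2) * X) ≤ ∑ i, ∑ α, ∑ β, B i α β * w α * ξ i β := by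
    have : ∑ i, ∑ α, ∑ β, -(q * w α ^ 2 + τ / 2 * ξ i β ^ 2) ≤
        ∑ i, ∑ α, ∑ β, B i α β * w α * ξ i β :=
      Finset.sum_le_sum fun i _ => Finset.sum_le_sum fun α _ => Finset.sum_le_sum fun β _ =>
        neg_mul_mul_le hτ0 (hB i α β)
    refine le_trans (le_of_eq ?_) this
    simp only [Finset.sum_neg_distrib, Finset.sum_add_distrib, ← Finset.mul_sum, Finset.sum_const,
      Finset.card_univ, Fintype.card_fin, nsmul_eq_mul, ← hX, ← hY]
    ring
  have b3 : -(κ * m * Y) ≤ ∑ α, ∑ β, c α β * w β * w α := by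
    have : ∑ α, ∑ β, -(κ / 2 * w β ^ 2 + κ / 2 * w α ^ 2) ≤ ∑ α, ∑ β, c α β * w β * w α := by
      refine Finset.sum_le_sum fun α _ => Finset.sum_le_sum fun β _ => ?_
      have hκ : 0 ≤ κ := (abs_nonneg _).trans (hc α β)
      have h1 : |c α β * w β * w α| ≤ κ * (|w β| * |w α|) := by
        rw [abs_mul, abs_mul, mul_assoc]
        exact mul_le_mul_of_nonneg_right (hc α β) (by positivity)
      have h2 : |w β| * |w α| ≤ (w β ^ 2 + w α ^ 2) / 2 := by
        rw [← sq_abs (w β), ← sq_abs (w α)]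
        nlinarith [sq_nonneg (|w β| - |w α|)]
      have h3 := mul_le_mul_of_nonneg_left h2 hκ
      have h4 := neg_abs_le (c α β * w β * w α)
      linarith
    refine le_trans (le_of_eq ?_) this
    simp only [Finset.sum_neg_distrib, Finset.sum_add_distrib, ← Finset.mul_sum, Finset.sum_const,
      Finset.card_univ, Fintype.card_fin, nsmul_eq_mul, ← hY]
    ring
  have hmτ : m * (τ / 2) = μ / 4 := by rw [hτ]; field_simp; norm_num
  have hdq : 2 * (d * m * q) = 2 * κ ^ 2 * d * m ^ 2 / μ := by rw [hq, hτ]; field_simp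
  have hlamY : coercivityThreshold d m μ κ * Y ≤ lam * Y := mul_le_mul_of_nonneg_right hlam hY0
  unfold coercivityThreshold at hlamY
  rw [← hdq] at hlamY
  rw [hmτ] at b1 b2
  rw [e1, e2]
  linarith


/-! ### Bounded coefficients and the pairing with test functions -/

/-- Measurable coefficients bounded by `K`. -/
structure Coefficients.IsBdd (𝒜 : Coefficients d m) (K : ℝ) : Prop where
  measurable_a : ∀ i j α β, Measurable (𝒜.a i j α β)
  measurable_V : ∀ i α β, Measurable (𝒜.V i α β)
  measurable_B : ∀ i α β, Measurable (𝒜.B i α β)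
  measurable_c : ∀ α β, Measurable (𝒜.c α β)
  bounded_a : ∀ i j α β, ∀ᵐ y : E d, |𝒜.a i j α β y| ≤ K
  bounded_V : ∀ i α β, ∀ᵐ y : E d, |𝒜.V i α β y| ≤ K
  bounded_B : ∀ i α β, ∀ᵐ y : E d, |𝒜.B i α β y| ≤ K
  bounded_c : ∀ α β, ∀ᵐ y : E d, |𝒜.c α β y| ≤ K

theorem Coefficients.IsAdmissible.isBdd_rescale {𝒜 : Coefficients d m} {μ κ : ℝ}
    (h : 𝒜.IsAdmissible μ κ) {ε : ℝ} (hε : 0 < ε) : (𝒜.rescale ε).IsBdd κ where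
  measurable_a i j α β := (h.measurable_a i j α β).comp (measurable_const_smul _)
  measurable_V i α β := (h.measurable_V i α β).comp (measurable_const_smul _)
  measurable_B i α β := (h.measurable_B i α β).comp (measurable_const_smul _)
  measurable_c α β := (h.measurable_c α β).comp (measurable_const_smul _)
  bounded_a i j α β := ae_comp_smul (h.bounded_a i j α β) (inv_pos.2 hε).ne'
  bounded_V i α β := ae_comp_smul (h.bounded_V i α β) (inv_pos.2 hε).ne'
  bounded_B i α β := ae_comp_smul (h.bounded_B i α β) (inv_pos.2 hε).ne'
  bounded_c α β := ae_comp_smul (h.bounded_c α β) (inv_pos.2 hε).ne'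

theorem Coefficients.IsCorrector.isBdd_homogenized {𝒜 : Coefficients d m} {μ κ : ℝ} (hμ : 0 < μ)
    (hκ : 0 < κ) (h : 𝒜.IsAdmissible μ κ) {χ : Fin (d + 1) → Fin m → Fin m → E d → ℝ}
    {Dχ : Fin (d + 1) → Fin d → Fin m → Fin m → E d → ℝ} (hχ : 𝒜.IsCorrector χ Dχ) :
    (𝒜.homogenized Dχ).IsBdd (meanBound d m μ κ) where
  measurable_a _ _ _ _ := measurable_const
  measurable_V _ _ _ := measurable_const
  measurable_B _ _ _ := measurable_const
  measurable_c _ _ := measurable_const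
  bounded_a i j α β := Eventually.of_forall fun _ => hχ.abs_integral_flux_le hμ hκ h j.succ i α β
  bounded_V i α β := Eventually.of_forall fun _ => hχ.abs_integral_flux_le hμ hκ h 0 i α β
  bounded_B i α β := Eventually.of_forall fun _ => hχ.abs_integral_lowerFlux_le hμ hκ h i.succ α β
  bounded_c α β := Eventually.of_forall fun _ => hχ.abs_integral_lowerFlux_le hμ hκ h 0 α β

theorem memLp_measurable_bdd_mul {Ω : Set (E d)} {f g : E d → ℝ} {K : ℝ} (hf : Measurable f)
    (hb : ∀ᵐ y : E d, |f y| ≤ K) (hg : MemLp g 2 (volume.restrict Ω)) :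
    MemLp (fun x => f x * g x) 2 (volume.restrict Ω) :=
  memLp_bdd_mul hf.aestronglyMeasurable (ae_restrict_of_ae hb) hg

theorem Coefficients.IsBdd.fluxOf_memLp {𝒜 : Coefficients d m} {K : ℝ} (h : 𝒜.IsBdd K)
    {Ω : Set (E d)} {u : Fin m → E d → ℝ} {Du : Fin d → Fin m → E d → ℝ}
    (hu : ∀ α, MemLp (u α) 2 (volume.restrict Ω))
    (hDu : ∀ i α, MemLp (Du i α) 2 (volume.restrict Ω)) (i : Fin d) (α : Fin m) :
    MemLp (𝒜.fluxOf u Du i α) 2 (volume.restrict Ω) :=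
  (memLp_finsetSum _ fun j _ => memLp_finsetSum _ fun β _ =>
    memLp_measurable_bdd_mul (h.measurable_a i j α β) (h.bounded_a i j α β) (hDu j β)).add
  (memLp_finsetSum _ fun β _ =>
    memLp_measurable_bdd_mul (h.measurable_V i α β) (h.bounded_V i α β) (hu β))

theorem Coefficients.IsBdd.lowOf_memLp {𝒜 : Coefficients d m} {K : ℝ} (h : 𝒜.IsBdd K) (lam : ℝ)
    {Ω : Set (E d)} {u : Fin m → E d → ℝ} {Du : Fin d → Fin m → E d → ℝ}
    (hu : ∀ α, MemLp (u α) 2 (volume.restrict Ω))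
    (hDu : ∀ i α, MemLp (Du i α) 2 (volume.restrict Ω)) (α : Fin m) :
    MemLp (𝒜.lowOf lam u Du α) 2 (volume.restrict Ω) :=
  ((memLp_finsetSum _ fun j _ => memLp_finsetSum _ fun β _ =>
    memLp_measurable_bdd_mul (h.measurable_B j α β) (h.bounded_B j α β) (hDu j β)).add
  (memLp_finsetSum _ fun β _ =>
    memLp_measurable_bdd_mul (h.measurable_c α β) (h.bounded_c α β) (hu β))).add
  ((hu α).const_mul lam)

theorem Coefficients.fluxOf_sub_sub (𝒜 : Coefficients d m) (u v w : Fin m → E d → ℝ)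
    (Du Dv Dw : Fin d → Fin m → E d → ℝ) (i : Fin d) (α : Fin m) (x : E d) :
    𝒜.fluxOf (fun β x => u β x - v β x - w β x) (fun j β x => Du j β x - Dv j β x - Dw j β x) i α x
        =
      𝒜.fluxOf u Du i α x - 𝒜.fluxOf v Dv i α x - 𝒜.fluxOf w Dw i α x := by
  simp only [Coefficients.fluxOf, mul_sub, Finset.sum_sub_distrib]
  ring

theorem Coefficients.lowOf_sub_sub (𝒜 : Coefficients d m) (lam : ℝ) (u v w : Fin m → E d → ℝ)
    (Du Dv Dw : Fin d → Fin m → E d → ℝ) (α : Fin m) (x : E d) :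
    𝒜.lowOf lam (fun β x => u β x - v β x - w β x) (fun j β x => Du j β x - Dv j β x - Dw j β x) α
        x =
      𝒜.lowOf lam u Du α x - 𝒜.lowOf lam v Dv α x - 𝒜.lowOf lam w Dw α x := by
  simp only [Coefficients.lowOf, mul_sub, Finset.sum_sub_distrib]
  ring

/-- The functional `v ↦ ∫ F · ∇v + G · v`. -/
def pairing (Ω : Set (E d)) (F : Fin d → Fin m → E d → ℝ) (G : Fin m → E d → ℝ)
    (v : Fin m → E d → ℝ) (Dv : Fin d → Fin m → E d → ℝ) : ℝ :=
  (∫ x in Ω, ∑ i, ∑ α, F i α x * Dv i α x) + ∫ x in Ω, ∑ α, G α x * v α x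

theorem Coefficients.form_eq_pairing (𝒜 : Coefficients d m) (Ω : Set (E d)) (lam : ℝ)
    (u : Fin m → E d → ℝ) (Du : Fin d → Fin m → E d → ℝ) (v : Fin m → E d → ℝ)
    (Dv : Fin d → Fin m → E d → ℝ) :
    𝒜.form Ω lam u Du v Dv = pairing Ω (𝒜.fluxOf u Du) (𝒜.lowOf lam u Du) v Dv := rfl

section pairing

variable {Ω : Set (E d)} {F F' : Fin d → Fin m → E d → ℝ} {G G' : Fin m → E d → ℝ}
  {v : Fin m → E d → ℝ} {Dv : Fin d → Fin m → E d → ℝ}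

theorem integrable_sum_sum_mul (hF : ∀ i α, MemLp (F i α) 2 (volume.restrict Ω))
    (hDv : ∀ i α, MemLp (Dv i α) 2 (volume.restrict Ω)) :
    Integrable (fun x => ∑ i, ∑ α, F i α x * Dv i α x) (volume.restrict Ω) :=
  integrable_finsetSum _ fun i _ => integrable_finsetSum _ fun α _ =>
    (hF i α).integrable_mul (hDv i α)

theorem integrable_sum_mul (hG : ∀ α, MemLp (G α) 2 (volume.restrict Ω))
    (hv : ∀ α, MemLp (v α) 2 (volume.restrict Ω)) :
    Integrable (fun x => ∑ α, G α x * v α x) (volume.restrict Ω) :=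
  integrable_finsetSum _ fun α _ => (hG α).integrable_mul (hv α)

theorem pairing_sub (hF : ∀ i α, MemLp (F i α) 2 (volume.restrict Ω))
    (hF' : ∀ i α, MemLp (F' i α) 2 (volume.restrict Ω))
    (hG : ∀ α, MemLp (G α) 2 (volume.restrict Ω)) (hG' : ∀ α, MemLp (G' α) 2 (volume.restrict Ω))
    (hv : ∀ α, MemLp (v α) 2 (volume.restrict Ω))
    (hDv : ∀ i α, MemLp (Dv i α) 2 (volume.restrict Ω)) :
    pairing Ω (fun i α x => F i α x - F' i α x) (fun α x => G α x - G' α x) v Dv =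
      pairing Ω F G v Dv - pairing Ω F' G' v Dv := by
  simp only [pairing, sub_mul, Finset.sum_sub_distrib]
  rw [integral_sub (integrable_sum_sum_mul hF hDv) (integrable_sum_sum_mul hF' hDv),
    integral_sub (integrable_sum_mul hG hv) (integrable_sum_mul hG' hv)]
  ring

theorem pairing_eq_sum (hF : ∀ i α, MemLp (F i α) 2 (volume.restrict Ω))
    (hG : ∀ α, MemLp (G α) 2 (volume.restrict Ω)) (hv : ∀ α, MemLp (v α) 2 (volume.restrict Ω))
    (hDv : ∀ i α, MemLp (Dv i α) 2 (volume.restrict Ω)) :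
    pairing Ω F G v Dv =
      ∑ α, ((∫ x in Ω, G α x * v α x) + ∑ i, ∫ x in Ω, F i α x * Dv i α x) := by
  have e1 : ∫ x in Ω, ∑ i, ∑ α, F i α x * Dv i α x = ∑ i, ∑ α, ∫ x in Ω, F i α x * Dv i α x := by
    rw [integral_finsetSum _ fun i _ => integrable_finsetSum _ fun α _ =>
      show Integrable (fun x => F i α x * Dv i α x) _ from (hF i α).integrable_mul (hDv i α)]
    exact Finset.sum_congr rfl fun i _ => integral_finsetSum _ fun α _ =>
      (hF i α).integrable_mul (hDv i α)
  have e2 : ∫ x in Ω, ∑ α, G α x * v α x = ∑ α, ∫ x in Ω, G α x * v α x :=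
    integral_finsetSum _ fun α _ => (hG α).integrable_mul (hv α)
  rw [pairing, e1, e2, Finset.sum_add_distrib, add_comm, Finset.sum_comm]

theorem pairing_sum {ι : Type*} (s : Finset ι) {F : ι → Fin d → Fin m → E d → ℝ}
    {G : ι → Fin m → E d → ℝ} (hF : ∀ k i α, MemLp (F k i α) 2 (volume.restrict Ω))
    (hG : ∀ k α, MemLp (G k α) 2 (volume.restrict Ω)) (hv : ∀ α, MemLp (v α) 2 (volume.restrict Ω))
    (hDv : ∀ i α, MemLp (Dv i α) 2 (volume.restrict Ω)) :
    pairing Ω (fun i α x => ∑ k ∈ s, F k i α x) (fun α x => ∑ k ∈ s, G k α x) v Dv =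
      ∑ k ∈ s, pairing Ω (F k) (G k) v Dv := by
  rw [pairing_eq_sum (fun i α => memLp_finsetSum s fun k _ => hF k i α)
    (fun α => memLp_finsetSum s fun k _ => hG k α) hv hDv]
  simp only [fun k => pairing_eq_sum (hF k) (hG k) hv hDv]
  rw [Finset.sum_comm]
  refine Finset.sum_congr rfl fun α _ => ?_
  rw [Finset.sum_add_distrib]
  congr 1
  · simp only [Finset.sum_mul]
    exact integral_finsetSum _ fun k _ => (hG k α).integrable_mul (hv α)
  · rw [Finset.sum_comm]
    refine Finset.sum_congr rfl fun i _ => ?_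
    simp only [Finset.sum_mul]
    exact integral_finsetSum _ fun k _ => (hF k i α).integrable_mul (hDv i α)

/-- The energy estimate: coercivity and a pointwise bound of the residuals. -/
theorem energy_bound {R : Fin d → Fin m → E d → ℝ} {S : Fin m → E d → ℝ} {c K : ℝ} {s : E d → ℝ}
    (hc : 0 < c) (hF : ∀ i α, MemLp (F i α) 2 (volume.restrict Ω))
    (hG : ∀ α, MemLp (G α) 2 (volume.restrict Ω))
    (hR : ∀ i α, MemLp (R i α) 2 (volume.restrict Ω))
    (hS : ∀ α, MemLp (S α) 2 (volume.restrict Ω)) (hv : ∀ α, MemLp (v α) 2 (volume.restrict Ω))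
    (hDv : ∀ i α, MemLp (Dv i α) 2 (volume.restrict Ω)) (hs : MemLp s 2 (volume.restrict Ω))
    (hcoer : ∀ᵐ x ∂volume.restrict Ω, c * ((∑ i, ∑ α, Dv i α x ^ 2) + ∑ α, v α x ^ 2) ≤
      (∑ i, ∑ α, F i α x * Dv i α x) + ∑ α, G α x * v α x)
    (hRs : ∀ᵐ x ∂volume.restrict Ω, ∀ i α, |R i α x| ≤ K * s x)
    (hSs : ∀ᵐ x ∂volume.restrict Ω, ∀ α, |S α x| ≤ K * s x)
    (heq : pairing Ω F G v Dv = pairing Ω R S v Dv) :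
    ∫ x in Ω, ((∑ i, ∑ α, Dv i α x ^ 2) + ∑ α, v α x ^ 2) ≤
      (d + 1) * m * K ^ 2 / c ^ 2 * ∫ x in Ω, s x ^ 2 := by
  have iQ : Integrable (fun x => (∑ i, ∑ α, Dv i α x ^ 2) + ∑ α, v α x ^ 2)
      (volume.restrict Ω) :=
    (integrable_finsetSum _ fun i _ => integrable_finsetSum _ fun α _ =>
      (hDv i α).integrable_sq).add (integrable_finsetSum _ fun α _ => (hv α).integrable_sq)
  have is : Integrable (fun x => s x ^ 2) (volume.restrict Ω) := hs.integrable_sq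
  have h1 := integral_mono_ae (iQ.const_mul c)
    ((integrable_sum_sum_mul hF hDv).add (integrable_sum_mul hG hv)) hcoer
  have h2 : ∀ᵐ x ∂volume.restrict Ω, (∑ i, ∑ α, R i α x * Dv i α x) + ∑ α, S α x * v α x ≤
      (d + 1) * m * K ^ 2 / (2 * c) * s x ^ 2 +
        c / 2 * ((∑ i, ∑ α, Dv i α x ^ 2) + ∑ α, v α x ^ 2) := by
    filter_upwards [hRs, hSs] with x hx hx'
    have a1 : ∑ i, ∑ α, R i α x * Dv i α x ≤
        ∑ i, ∑ α, ((K * s x) ^ 2 / (2 * c) + c / 2 * Dv i α x ^ 2) :=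
      Finset.sum_le_sum fun i _ => Finset.sum_le_sum fun α _ => neg_mul_le_add_sq hc (hx i α)
    have a2 : ∑ α, S α x * v α x ≤ ∑ α, ((K * s x) ^ 2 / (2 * c) + c / 2 * v α x ^ 2) :=
      Finset.sum_le_sum fun α _ => neg_mul_le_add_sq hc (hx' α)
    rw [sum_sum_const_add_mul] at a1
    rw [Finset.sum_add_distrib, ← Finset.mul_sum] at a2
    simp only [Finset.sum_const, Finset.card_univ, Fintype.card_fin, nsmul_eq_mul] at a2
    have a3 : (d + 1) * m * K ^ 2 / (2 * c) * s x ^ 2 =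
        d * m * ((K * s x) ^ 2 / (2 * c)) + m * ((K * s x) ^ 2 / (2 * c)) := by ring
    rw [a3]
    linarith
  have h3 := integral_mono_ae
    ((integrable_sum_sum_mul hR hDv).add (integrable_sum_mul hS hv))
    ((is.const_mul _).add (iQ.const_mul _)) h2
  rw [integral_add' (integrable_sum_sum_mul hF hDv) (integrable_sum_mul hG hv),
    integral_const_mul] at h1
  rw [integral_add' (integrable_sum_sum_mul hR hDv) (integrable_sum_mul hS hv),
    integral_add' (is.const_mul _) (iQ.const_mul _), integral_const_mul, integral_const_mul] at h3
  unfold pairing at heq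
  set Q := ∫ x in Ω, ((∑ i, ∑ α, Dv i α x ^ 2) + ∑ α, v α x ^ 2)
  -- Half of the coercive term absorbs the pairing; (d + 1)m counts the components of R and S.
  have h4 : c / 2 * Q ≤ (d + 1) * m * K ^ 2 / (2 * c) * ∫ x in Ω, s x ^ 2 := by linarith
  calc Q = 2 / c * (c / 2 * Q) := by field_simp
    _ ≤ 2 / c * ((d + 1) * m * K ^ 2 / (2 * c) * ∫ x in Ω, s x ^ 2) :=
      mul_le_mul_of_nonneg_left h4 (by positivity)
    _ = _ := by field_simp

end pairing

/-! ### Norms with values in `[0, ∞]` -/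

theorem l2Norm_sq {ι : Type*} [Fintype ι] (ν : Measure (E d)) (f : ι → E d → ℝ) :
    l2Norm ν f ^ 2 = ∫⁻ x, ∑ i, ENNReal.ofReal (f i x ^ 2) ∂ν := by
  unfold l2Norm
  rw [← ENNReal.rpow_natCast, ← ENNReal.rpow_mul]
  norm_num

theorem l2Norm_sq_eq_ofReal {ι : Type*} [Fintype ι] {ν : Measure (E d)} {f : ι → E d → ℝ}
    (hf : ∀ i, MemLp (f i) 2 ν) :
    l2Norm ν f ^ 2 = ENNReal.ofReal (∫ x, ∑ i, f i x ^ 2 ∂ν) := by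
  rw [l2Norm_sq, ofReal_integral_eq_lintegral_ofReal
    (integrable_finsetSum _ fun i _ => (hf i).integrable_sq)
    (Eventually.of_forall fun x => Finset.sum_nonneg fun i _ => sq_nonneg _)]
  refine lintegral_congr fun x => ?_
  rw [ENNReal.ofReal_sum_of_nonneg fun i _ => sq_nonneg _]

theorem memLp_of_l2Norm_ne_top {ι : Type*} [Fintype ι] {ν : Measure (E d)} {f : ι → E d → ℝ}
    (hf : ∀ i, AEStronglyMeasurable (f i) ν) (h : l2Norm ν f ≠ ⊤) (i : ι) : MemLp (f i) 2 ν := by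
  refine ⟨hf i, ?_⟩
  have h1 : eLpNorm (f i) 2 ν ^ 2 ≤ l2Norm ν f ^ 2 := by
    rw [eLpNorm_two_sq, l2Norm_sq]
    refine lintegral_mono fun x => ?_
    refine le_trans (le_of_eq ?_) (Finset.single_le_sum (f := fun i => ENNReal.ofReal (f i x ^ 2))
      (fun _ _ => zero_le) (Finset.mem_univ i))
    rw [← sq_abs, ENNReal.ofReal_pow (abs_nonneg _), Real.enorm_eq_ofReal_abs]
  exact ((ENNReal.pow_le_pow_left_iff two_ne_zero).1 h1).trans_lt h.lt_top

/-! ### The weight -/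

theorem LocL2.abs {f : E d → ℝ} (hf : LocL2 f) : LocL2 (fun x => |f x|) := fun R => (hf R).abs

theorem memLp_of_weight {Ω : Set (E d)} {f H g : E d → ℝ} {K : ℝ} (hf : LocL2 f)
    (hg : AEStronglyMeasurable g (volume.restrict Ω)) (hb : ∀ᵐ x : E d, |f x| ≤ K * H x)
    (hH : MemLp (fun x => H x * g x) 2 (volume.restrict Ω)) :
    MemLp (fun x => f x * g x) 2 (volume.restrict Ω) := by
  refine hH.of_le_mul (c := |K|) (hf.aestronglyMeasurable.restrict.mul hg) ?_
  filter_upwards [ae_restrict_of_ae hb] with x hx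
  rw [norm_mul, norm_mul, ← mul_assoc]
  refine mul_le_mul_of_nonneg_right ?_ (norm_nonneg _)
  rw [Real.norm_eq_abs, Real.norm_eq_abs, ← abs_mul]
  exact hx.trans (le_abs_self _)


/-! ### The corrector term and the residuals of the two-scale expansion -/

/-- The corrector term `ε ∑_k χ_k(x/ε) φ_k`. -/
def correctorTerm (ε : ℝ) (χ : Fin (d + 1) → Fin m → Fin m → E d → ℝ)
    (φ : Fin (d + 1) → Fin m → E d → ℝ) (β : Fin m) (x : E d) : ℝ :=
  ε * ∑ k, ∑ γ, χ k β γ (ε⁻¹ • x) * φ k γ x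

/-- The partial derivatives of the corrector term. -/
def correctorTermPartial (ε : ℝ) (χ : Fin (d + 1) → Fin m → Fin m → E d → ℝ)
    (Dχ : Fin (d + 1) → Fin d → Fin m → Fin m → E d → ℝ) (φ : Fin (d + 1) → Fin m → E d → ℝ)
    (Dφ : Fin (d + 1) → Fin d → Fin m → E d → ℝ) (j : Fin d) (β : Fin m) (x : E d) : ℝ :=
  ε * ∑ k, ∑ γ, (ε⁻¹ * Dχ k j β γ (ε⁻¹ • x) * φ k γ x + χ k β γ (ε⁻¹ • x) * Dφ k j γ x)

/-- The constant in the bound of the residuals. -/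
def residualConst (d m : ℕ) (C₀ κ C₃ Cη : ℝ) : ℝ :=
  d * (m * (C₀ + κ)) + m * (C₀ + κ) + (d + 1) * (m * C₃) + d * (m * (κ * ((d + 1) * m))) +
    m * (κ * ((d + 1) * m)) + (d + 1) * (m * (d * (1 + Cη)))

/-- The bounds at the point `x` of the quantities in the two-scale expansion. -/
structure PointwiseBounds (𝒜 : Coefficients d m) (χ : Fin (d + 1) → Fin m → Fin m → E d → ℝ)
    (Dχ : Fin (d + 1) → Fin d → Fin m → Fin m → E d → ℝ)
    (Dθ : Fin (d + 1) → Fin d → Fin d → Fin m → Fin m → E d → ℝ)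
    (Dϑ : Fin (d + 1) → Fin d → Fin m → Fin m → E d → ℝ)
    (φ : Fin (d + 1) → Fin m → E d → ℝ) (Dφ : Fin (d + 1) → Fin d → Fin m → E d → ℝ)
    (u : Fin m → E d → ℝ) (Du : Fin d → Fin m → E d → ℝ) (η : E d → ℝ)
    (ε κ C₀ C₃ Cη h s : ℝ) (x : E d) : Prop where
  a : ∀ i j α β, |𝒜.a i j α β (ε⁻¹ • x)| ≤ κ
  V : ∀ i α β, |𝒜.V i α β (ε⁻¹ • x)| ≤ κ
  B : ∀ i α β, |𝒜.B i α β (ε⁻¹ • x)| ≤ κ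
  c : ∀ α β, |𝒜.c α β (ε⁻¹ • x)| ≤ κ
  meanFlux : ∀ k i α γ, |∫ y in cell d, 𝒜.flux Dχ k i α γ y| ≤ C₀
  meanLowerFlux : ∀ k α γ, |∫ y in cell d, 𝒜.lowerFlux Dχ k α γ y| ≤ C₀
  b : ∀ k i α γ, |𝒜.b Dχ k i α γ (ε⁻¹ • x)| ≤ C₃ * h
  W : ∀ k α γ, |𝒜.W Dχ k α γ (ε⁻¹ • x)| ≤ C₃ * h
  corrector : ∀ k β γ, |χ k β γ (ε⁻¹ • x)| ≤ h
  fluxCorrector : ∀ k j i α γ, |fluxCorrector Dθ k j i α γ (ε⁻¹ • x)| ≤ h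
  partialAux : ∀ k i α γ, |Dϑ k i α γ (ε⁻¹ • x)| ≤ h
  cutoff_nonneg : 0 ≤ η x
  cutoff_le_one : η x ≤ 1
  gradient : ∀ j β, |Du j β x - φ (Fin.succ j) β x| ≤ s
  solution : ∀ β, |u β x - φ 0 β x| ≤ s
  approx : ∀ k γ, ε * h * |φ k γ x| ≤ s
  approxPartial : ∀ k j γ, ε * h * |Dφ k j γ x| ≤ s
  approx_layer : ∀ k γ, (1 - η x) * (h * |φ k γ x|) ≤ s
  cutoffPartial : ∀ k γ j, ε * |partialDeriv j η x| * (h * |φ k γ x|) ≤ Cη * s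

section

variable {𝒜 : Coefficients d m} {χ : Fin (d + 1) → Fin m → Fin m → E d → ℝ}
  {Dχ : Fin (d + 1) → Fin d → Fin m → Fin m → E d → ℝ}
  {Dθ : Fin (d + 1) → Fin d → Fin d → Fin m → Fin m → E d → ℝ}
  {Dϑ : Fin (d + 1) → Fin d → Fin m → Fin m → E d → ℝ}
  {φ : Fin (d + 1) → Fin m → E d → ℝ} {Dφ : Fin (d + 1) → Fin d → Fin m → E d → ℝ}
  {u : Fin m → E d → ℝ} {Du : Fin d → Fin m → E d → ℝ} {η : E d → ℝ}
  {ε κ C₀ C₃ Cη h s : ℝ} {x : E d}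

theorem abs_sum_sum_mul_cutoff_le (hε : 0 < ε) {P : Fin (d + 1) → Fin m → ℝ}
    (hP : ∀ k γ, |P k γ| ≤ h) (hη0 : 0 ≤ η x) (hη1 : η x ≤ 1)
    (hφ : ∀ k γ, ε * h * |φ k γ x| ≤ s) :
    |∑ k, ∑ γ, ε * P k γ * φ k γ x * η x| ≤ (d + 1) * m * s := by
  have hcast : ((d + 1 : ℕ) : ℝ) = d + 1 := by push_cast; ring
  rw [← hcast, mul_assoc]
  refine abs_sum_le_of_forall fun k => abs_sum_le_of_forall fun γ => ?_
  rw [abs_mul, abs_of_nonneg hη0]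
  refine (mul_le_of_le_one_right (abs_nonneg _) hη1).trans (le_trans ?_ (hφ k γ))
  rw [abs_mul, abs_mul, abs_of_pos hε]
  gcongr
  exact hP k γ

theorem abs_correctorTerm_le (hε : 0 < ε) (hχ : ∀ k β γ, |χ k β γ (ε⁻¹ • x)| ≤ h)
    (hφ : ∀ k γ, ε * h * |φ k γ x| ≤ s) (β : Fin m) :
    |correctorTerm ε χ φ β x| ≤ (d + 1) * m * s := by
  have hcast : ((d + 1 : ℕ) : ℝ) = d + 1 := by push_cast; ring
  unfold correctorTerm
  simp only [Finset.mul_sum]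
  rw [← hcast, mul_assoc]
  refine abs_sum_le_of_forall fun k => abs_sum_le_of_forall fun γ => le_trans ?_ (hφ k γ)
  rw [abs_mul, abs_mul, abs_of_pos hε, ← mul_assoc]
  gcongr
  exact hχ k β γ

theorem PointwiseBounds.abs_flux_residual_le (hε : 0 < ε) (hκ : 0 ≤ κ) (hC₃ : 0 ≤ C₃)
    (hb : PointwiseBounds 𝒜 χ Dχ Dθ Dϑ φ Dφ u Du η ε κ C₀ C₃ Cη h s x) (i : Fin d) (α : Fin m) :
    |(𝒜.homogenized Dχ).fluxOf u Du i α x - (𝒜.rescale ε).fluxOf u Du i α x -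
      (𝒜.rescale ε).fluxOf (correctorTerm ε χ φ) (correctorTermPartial ε χ Dχ φ Dφ) i α x -
      ∑ k, ∑ γ, localized (fun j x => ε * NeumannHomogenization.fluxCorrector Dθ k j i α γ (ε⁻¹ •
          x))
        (fun x => 𝒜.b Dχ k i α γ (ε⁻¹ • x)) (φ k γ) (fun j => Dφ k j γ) η x| ≤
    residualConst d m C₀ κ C₃ Cη * s := by
  have h1 := twoScale_expansion hε.ne' (fun k γ => ∫ y in cell d, 𝒜.flux Dχ k i α γ y)
    (fun k γ => 𝒜.b Dχ k i α γ (ε⁻¹ • x)) (fun j β => 𝒜.a i j α β (ε⁻¹ • x))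
    (fun β => 𝒜.V i α β (ε⁻¹ • x)) (fun k β γ => χ k β γ (ε⁻¹ • x))
    (fun k j β γ => Dχ k j β γ (ε⁻¹ • x)) (fun k γ => φ k γ x) (fun k j γ => Dφ k j γ x)
    (fun β => u β x) (fun j β => Du j β x) (fun γ => rfl) (fun l γ => rfl)
  have h2 := abs_residual_le hε hκ hC₃ (fun k γ => hb.meanFlux k i α γ) (fun j β => hb.a i j α β)
    (fun β => hb.V i α β) (fun k γ => hb.b k i α γ) hb.corrector
    (fun k γ j => hb.fluxCorrector k j i α γ) hb.cutoff_nonneg hb.cutoff_le_one hb.gradient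
    hb.solution hb.approx hb.approxPartial hb.approx_layer hb.cutoffPartial
  rw [← h1] at h2
  exact h2

theorem PointwiseBounds.abs_lower_residual_le (hε : 0 < ε) (hκ : 0 ≤ κ) (hC₃ : 0 ≤ C₃)
    (hb : PointwiseBounds 𝒜 χ Dχ Dθ Dϑ φ Dφ u Du η ε κ C₀ C₃ Cη h s x) (lam : ℝ) (α : Fin m) :
    |(𝒜.homogenized Dχ).lowOf lam u Du α x - (𝒜.rescale ε).lowOf lam u Du α x -
      (𝒜.rescale ε).lowOf lam (correctorTerm ε χ φ) (correctorTermPartial ε χ Dχ φ Dφ) α x -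
      ∑ k, ∑ γ, localized (fun j x => ε * Dϑ k j α γ (ε⁻¹ • x))
        (fun x => 𝒜.W Dχ k α γ (ε⁻¹ • x)) (φ k γ) (fun j => Dφ k j γ) η x| ≤
    (residualConst d m C₀ κ C₃ Cη + |lam| * ((d + 1) * m)) * s := by
  have h1 := twoScale_expansion hε.ne' (fun k γ => ∫ y in cell d, 𝒜.lowerFlux Dχ k α γ y)
    (fun k γ => 𝒜.W Dχ k α γ (ε⁻¹ • x)) (fun j β => 𝒜.B j α β (ε⁻¹ • x))
    (fun β => 𝒜.c α β (ε⁻¹ • x)) (fun k β γ => χ k β γ (ε⁻¹ • x))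
    (fun k j β γ => Dχ k j β γ (ε⁻¹ • x)) (fun k γ => φ k γ x) (fun k j γ => Dφ k j γ x)
    (fun β => u β x) (fun j β => Du j β x) (fun γ => rfl) (fun l γ => rfl)
  have h2 := abs_residual_le hε hκ hC₃ (fun k γ => hb.meanLowerFlux k α γ) (fun j β => hb.B j α β)
    (fun β => hb.c α β) (fun k γ => hb.W k α γ) hb.corrector
    (fun k γ j => hb.partialAux k j α γ) hb.cutoff_nonneg hb.cutoff_le_one hb.gradient
    hb.solution hb.approx hb.approxPartial hb.approx_layer hb.cutoffPartial
  rw [← h1] at h2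
  have h3 : |lam * correctorTerm ε χ φ α x| ≤ |lam| * ((d + 1) * m * s) := by
    rw [abs_mul]
    exact mul_le_mul_of_nonneg_left (abs_correctorTerm_le hε hb.corrector hb.approx α)
      (abs_nonneg _)
  refine le_trans (le_of_eq (congrArg _ ?_)) ((abs_sub _ _).trans
    ((add_le_add h2 h3).trans (le_of_eq ?_)))
  · simp only [Coefficients.lowOf, Coefficients.homogenized, Coefficients.rescale, localized,
      correctorTerm, correctorTermPartial]
    ring
  · unfold residualConst
    ring

end

/-! ### The oscillating terms -/

/-- The skew fields contribute zero on their own. The lower order divergence div(pφη), paired with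
v, is compensated by adding pφη to the flux; this extra flux carries a factor ε in the application
and is harmless. -/
theorem pairing_localized_eq_zero {Ω : Set (E d)} (hΩ : IsOpen Ω) (hb : Bornology.IsBounded Ω)
    {P : Fin m → Fin d → Fin d → E d → ℝ} {q : Fin m → Fin d → E d → ℝ}
    {p : Fin m → Fin d → E d → ℝ} {r : Fin m → E d → ℝ} {φ : E d → ℝ} {Dφ : Fin d → E d → ℝ}
    (hP : ∀ α i, HasWeakDiv (P α i) (q α i)) (hskew : ∀ α i j x, P α i j x = -P α j i x)
    (hp : ∀ α, HasWeakDiv (p α) (r α)) (hφ : IsSmoothLimit Ω φ Dφ)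
    (hPm : ∀ α i, MulMemLp Ω (P α i) (q α i) φ Dφ) (hpm : ∀ α, MulMemLp Ω (p α) (r α) φ Dφ)
    {η : E d → ℝ} (hη : IsTest η) (hs : tsupport η ⊆ Ω) {v : Fin m → E d → ℝ}
    {Dv : Fin d → Fin m → E d → ℝ} (hv : IsH1Vec Ω v Dv) :
    pairing Ω (fun i α x => localized (P α i) (q α i) φ Dφ η x + p α i x * φ x * η x)
      (fun α => localized (p α) (r α) φ Dφ η) v Dv = 0 := by
  have h1 : ∀ i α, MemLp (localized (P α i) (q α i) φ Dφ η) 2 (volume.restrict Ω) :=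
    fun i α => (hPm α i).localized_memLp hη
  have h2 : ∀ i α, MemLp (fun x => p α i x * φ x * η x) 2 (volume.restrict Ω) :=
    fun i α => hη.memLp_mul ((hpm α).left i)
  have h3 : ∀ i α, MemLp (Dv i α) 2 (volume.restrict Ω) := fun i α => ((hv α).2 i).1
  refine (pairing_eq_sum (fun i α => (h1 i α).add (h2 i α))
    (fun α => (hpm α).localized_memLp hη) (fun α => (hv α).1) h3).trans ?_
  simp only [Pi.add_apply]
  refine Finset.sum_eq_zero fun α _ => ?_
  have e : ∀ i, ∫ x in Ω, (localized (P α i) (q α i) φ Dφ η x + p α i x * φ x * η x) * Dv i α x =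
      (∫ x in Ω, localized (P α i) (q α i) φ Dφ η x * Dv i α x) +
        ∫ x in Ω, p α i x * φ x * η x * Dv i α x := fun i => by
    simp only [add_mul]
    exact integral_add ((h1 i α).integrable_mul (h3 i α)) ((h2 i α).integrable_mul (h3 i α))
  simp only [e]
  rw [Finset.sum_add_distrib,
    sum_integral_localized_eq_zero hΩ hb (hP α) (hskew α) hφ (hPm α) hη hs (hv α), zero_add]
  exact (hp α).localized_eq_zero hΩ hb hφ (hpm α) hη hs (hv α)

/-! ### Comparison of the norms -/

/-- Squared norms of the two blocks add, and a² + b² ≤ (a + b)². -/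
theorem l2Norm_sumElim_le {ι ι' : Type*} [Fintype ι] [Fintype ι'] {ν : Measure (E d)}
    {f : ι → E d → ℝ} {g : ι' → E d → ℝ} (hf : ∀ i, AEStronglyMeasurable (f i) ν) :
    l2Norm ν (Sum.elim f g) ≤ l2Norm ν f + l2Norm ν g := by
  rw [← ENNReal.pow_le_pow_left_iff two_ne_zero, l2Norm_sq]
  simp only [Fintype.sum_sum_type, Sum.elim_inl, Sum.elim_inr]
  rw [lintegral_add_left' (Finset.aemeasurable_fun_sum _ fun i _ =>
    ((hf i).aemeasurable.pow_const 2).ennreal_ofReal), ← l2Norm_sq, ← l2Norm_sq, add_sq']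
  exact le_self_add

theorem l2Norm_const_mul {ι : Type*} [Fintype ι] (ν : Measure (E d)) (f : ι → E d → ℝ) {c : ℝ}
    (hc : 0 ≤ c) : l2Norm ν (fun i x => c * f i x) = ENNReal.ofReal c * l2Norm ν f := by
  refine (ENNReal.pow_right_strictMono two_ne_zero).injective ?_
  rw [mul_pow, l2Norm_sq, l2Norm_sq,
    ← ENNReal.ofReal_pow hc, ← lintegral_const_mul' _ _ ENNReal.ofReal_ne_top]
  refine lintegral_congr fun x => ?_
  rw [Finset.mul_sum]
  refine Finset.sum_congr rfl fun i _ => ?_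
  rw [mul_pow, ENNReal.ofReal_mul (sq_nonneg c)]

theorem l2Norm_indicator {ι : Type*} [Fintype ι] {A Ω : Set (E d)} (hA : MeasurableSet A)
    (hs : A ⊆ Ω) (f : ι → E d → ℝ) :
    l2Norm (volume.restrict Ω) (fun i => A.indicator (f i)) = l2Norm (volume.restrict A) f := by
  refine (ENNReal.pow_right_strictMono two_ne_zero).injective ?_
  rw [l2Norm_sq, l2Norm_sq]
  have h : volume.restrict A = (volume.restrict Ω).restrict A := by
    rw [Measure.restrict_restrict hA, inter_eq_left.2 hs]
  rw [h, ← lintegral_indicator hA]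
  refine lintegral_congr fun x => ?_
  by_cases hx : x ∈ A <;> simp [hx]

theorem h1Norm_le_of_integral_le {ι : Type*} [Fintype ι] {Ω : Set (E d)} {w : Fin m → E d → ℝ}
    {Dw : Fin d → Fin m → E d → ℝ} (hw : IsH1Vec Ω w Dw) {f : ι → E d → ℝ}
    (hf : ∀ i, MemLp (f i) 2 (volume.restrict Ω)) {K : ℝ} (hK : 0 ≤ K)
    (h : ∫ x in Ω, ((∑ i, ∑ α, Dw i α x ^ 2) + ∑ α, w α x ^ 2) ≤
      K ^ 2 * ∫ x in Ω, ∑ i, f i x ^ 2) :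
    h1Norm Ω w ≤ ENNReal.ofReal K * l2Norm (volume.restrict Ω) f := by
  refine (iInf₂_le Dw fun i α => ((hw α).2 i).2).trans ?_
  have hD : ∀ p : Fin d × Fin m, MemLp (Dw p.1 p.2) 2 (volume.restrict Ω) :=
    fun p => ((hw p.2).2 p.1).1
  have h1 : l2Norm (volume.restrict Ω) w ^ 2 +
      l2Norm (volume.restrict Ω) (fun (p : Fin d × Fin m) => Dw p.1 p.2) ^ 2 ≤
      (ENNReal.ofReal K * l2Norm (volume.restrict Ω) f) ^ 2 := by
    rw [mul_pow, l2Norm_sq_eq_ofReal fun α => (hw α).1, l2Norm_sq_eq_ofReal hD,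
      l2Norm_sq_eq_ofReal hf, ← ENNReal.ofReal_pow hK, ← ENNReal.ofReal_mul (sq_nonneg K),
      ← ENNReal.ofReal_add
        (integral_nonneg fun x => Finset.sum_nonneg fun i _ => sq_nonneg _)
        (integral_nonneg fun x => Finset.sum_nonneg fun i _ => sq_nonneg _),
      ← integral_add (integrable_finsetSum _ fun α _ => ((hw α).1).integrable_sq)
        (integrable_finsetSum _ fun p _ => (hD p).integrable_sq)]
    refine ENNReal.ofReal_le_ofReal (le_trans (le_of_eq ?_) h)
    simp only [Fintype.sum_prod_type, add_comm]
  calc _ ≤ ((ENNReal.ofReal K * l2Norm (volume.restrict Ω) f) ^ 2) ^ (1 / 2 : ℝ) :=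
        ENNReal.rpow_le_rpow h1 (by norm_num)
    _ = _ := by
        rw [← ENNReal.rpow_natCast, ← ENNReal.rpow_mul]
        norm_num


/-! ### The setting of the estimate -/

/-- Admissible coefficients with correctors and the fields whose divergences are `b` and `W`. -/
structure AuxiliaryFields (𝒜 : Coefficients d m) (μ κ : ℝ)
    (χ : Fin (d + 1) → Fin m → Fin m → E d → ℝ)
    (Dχ : Fin (d + 1) → Fin d → Fin m → Fin m → E d → ℝ)
    (Dθ : Fin (d + 1) → Fin d → Fin d → Fin m → Fin m → E d → ℝ)
    (Dϑ : Fin (d + 1) → Fin d → Fin m → Fin m → E d → ℝ) : Prop where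
  admissible : 𝒜.IsAdmissible μ κ
  isCorrector : 𝒜.IsCorrector χ Dχ
  div_fluxCorrector : ∀ k i α γ,
    HasWeakDiv (fun j => fluxCorrector Dθ k j i α γ) (𝒜.b Dχ k i α γ)
  div_partialAux : ∀ k α γ, HasWeakDiv (fun j => Dϑ k j α γ) (𝒜.W Dχ k α γ)

/-- Functions approximable by smooth ones whose products with the weight are square integrable. -/
structure WeightedApprox (Ω : Set (E d)) (H : E d → ℝ) (φ : Fin (d + 1) → Fin m → E d → ℝ)
    (Dφ : Fin (d + 1) → Fin d → Fin m → E d → ℝ) : Prop where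
  isSmoothLimit : ∀ k γ, IsSmoothLimit Ω (φ k γ) (fun j => Dφ k j γ)
  memLp : ∀ k γ, MemLp (fun x => H x * φ k γ x) 2 (volume.restrict Ω)
  memLp_partial : ∀ k j γ, MemLp (fun x => H x * Dφ k j γ x) 2 (volume.restrict Ω)

/-- The functions whose `L²` norms appear in the error estimate. -/
def errorFamily (Ω : Set (E d)) (ε : ℝ) (H : E d → ℝ) (φ : Fin (d + 1) → Fin m → E d → ℝ)
    (Dφ : Fin (d + 1) → Fin d → Fin m → E d → ℝ) (u : Fin m → E d → ℝ)
    (Du : Fin d → Fin m → E d → ℝ) :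
    (Fin (d + 1) × Fin m) ⊕ (Fin d × Fin m) ⊕ Fin m ⊕ (Fin (d + 1) × Fin d × Fin m) ⊕
      (Fin (d + 1) × Fin m) → E d → ℝ :=
  Sum.elim (fun p => (Ω \ innerRegion Ω (2 * ε)).indicator fun x => H x * φ p.1 p.2 x) <|
  Sum.elim (fun p x => Du p.1 p.2 x - φ p.1.succ p.2 x) <|
  Sum.elim (fun β x => u β x - φ 0 β x) <|
  Sum.elim (fun p x => ε * (H x * Dφ p.1 p.2.1 p.2.2 x)) fun p x => ε * (H x * φ p.1 p.2 x)

theorem abs_le_sqrt_sum_sq {ι : Type*} [Fintype ι] (f : ι → ℝ) (i : ι) :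
    |f i| ≤ √(∑ j, f j ^ 2) :=
  Real.abs_le_sqrt (Finset.single_le_sum (f := fun j => f j ^ 2) (fun _ _ => sq_nonneg _)
    (Finset.mem_univ i))

theorem memLp_sqrt_sum_sq {ι : Type*} [Fintype ι] {ν : Measure (E d)} {f : ι → E d → ℝ}
    (hf : ∀ i, MemLp (f i) 2 ν) : MemLp (fun x => √(∑ i, f i x ^ 2)) 2 ν := by
  have h : Integrable (fun x => ∑ i, f i x ^ 2) ν :=
    integrable_finsetSum _ fun i _ => (hf i).integrable_sq
  rw [memLp_two_iff_integrable_sq (Real.continuous_sqrt.comp_aestronglyMeasurable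
    h.aestronglyMeasurable)]
  refine h.congr (Eventually.of_forall fun x => ?_)
  exact (Real.sq_sqrt (Finset.sum_nonneg fun _ _ => sq_nonneg _)).symm

section

variable {𝒜 : Coefficients d m} {μ κ : ℝ} {χ : Fin (d + 1) → Fin m → Fin m → E d → ℝ}
  {Dχ : Fin (d + 1) → Fin d → Fin m → Fin m → E d → ℝ}
  {Dθ : Fin (d + 1) → Fin d → Fin d → Fin m → Fin m → E d → ℝ}
  {Dϑ : Fin (d + 1) → Fin d → Fin m → Fin m → E d → ℝ}
  {φ : Fin (d + 1) → Fin m → E d → ℝ} {Dφ : Fin (d + 1) → Fin d → Fin m → E d → ℝ}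
  {Ω : Set (E d)} {ε : ℝ}

theorem AuxiliaryFields.of_poisson (h : 𝒜.IsAdmissible μ κ) (hχ : 𝒜.IsCorrector χ Dχ)
    {θ : Fin (d + 1) → Fin d → Fin m → Fin m → E d → ℝ}
    (hθ : ∀ k i α γ, IsPeriodicPoissonSolution (𝒜.b Dχ k i α γ) (θ k i α γ)
      (fun j => Dθ k i j α γ))
    {ϑ : Fin (d + 1) → Fin m → Fin m → E d → ℝ}
    (hϑ : ∀ k α γ, IsPeriodicPoissonSolution (𝒜.W Dχ k α γ) (ϑ k α γ) (fun i => Dϑ k i α γ)) :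
    AuxiliaryFields 𝒜 μ κ χ Dχ Dθ Dϑ where
  admissible := h
  isCorrector := hχ
  div_fluxCorrector k i α γ := hasWeakDiv_sub_of_poisson (b := fun i => 𝒜.b Dχ k i α γ)
    (fun i => hθ k i α γ) (fun _ hψ => Coefficients.IsCorrector.sum_integral_b h hχ k α γ hψ) i
  div_partialAux k α γ := (hϑ k α γ).hasWeakDiv

theorem AuxiliaryFields.locL2_weight (A : AuxiliaryFields 𝒜 μ κ χ Dχ Dθ Dϑ) :
    LocL2 (𝒜.weight χ Dχ Dθ Dϑ) := by
  have h := A.admissible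
  refine LocL2.add (LocL2.add (LocL2.add (LocL2.add (LocL2.add (LocL2.add (LocL2.add ?_ ?_) ?_) ?_)
    ?_) ?_) ?_) ?_
  · exact LocL2.sum _ fun i => LocL2.sum _ fun j => LocL2.sum _ fun α => LocL2.sum _ fun β =>
      (LocL2.of_bdd (h.measurable_a i j α β) (h.bounded_a i j α β)).abs
  · exact LocL2.sum _ fun i => LocL2.sum _ fun α => LocL2.sum _ fun β =>
      (LocL2.of_bdd (h.measurable_V i α β) (h.bounded_V i α β)).abs
  · exact LocL2.sum _ fun i => LocL2.sum _ fun α => LocL2.sum _ fun β =>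
      (LocL2.of_bdd (h.measurable_B i α β) (h.bounded_B i α β)).abs
  · exact LocL2.sum _ fun α => LocL2.sum _ fun β =>
      (LocL2.of_bdd (h.measurable_c α β) (h.bounded_c α β)).abs
  · exact LocL2.sum _ fun k => LocL2.sum _ fun α => LocL2.sum _ fun γ =>
      ((A.isCorrector.1 k α γ).1.locL2).abs
  · exact LocL2.sum _ fun k => LocL2.sum _ fun i => LocL2.sum _ fun α => LocL2.sum _ fun γ =>
      (A.div_fluxCorrector k i α γ).right.abs
  · exact LocL2.sum _ fun k => LocL2.sum _ fun j => LocL2.sum _ fun i => LocL2.sum _ fun α =>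
      LocL2.sum _ fun γ => ((A.div_fluxCorrector k i α γ).left j).abs
  · exact LocL2.sum _ fun k => LocL2.sum _ fun i => LocL2.sum _ fun α => LocL2.sum _ fun γ =>
      ((A.div_partialAux k α γ).left i).abs

theorem WeightedApprox.memLp_mul
    (hA : WeightedApprox Ω (fun x => 𝒜.weight χ Dχ Dθ Dϑ (ε⁻¹ • x)) φ Dφ)
    (hε : 0 < ε) {f : E d → ℝ} (hf : LocL2 f) {K : ℝ}
    (hb : ∀ᵐ y : E d, |f y| ≤ K * 𝒜.weight χ Dχ Dθ Dϑ y) (k : Fin (d + 1)) (γ : Fin m) :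
    MemLp (fun x => f (ε⁻¹ • x) * φ k γ x) 2 (volume.restrict Ω) ∧
      ∀ j, MemLp (fun x => f (ε⁻¹ • x) * Dφ k j γ x) 2 (volume.restrict Ω) :=
  ⟨memLp_of_weight (hf.comp_smul (inv_pos.2 hε)) (hA.isSmoothLimit k γ).1.1.1
      (ae_comp_smul hb (inv_pos.2 hε).ne') (hA.memLp k γ),
    fun j => memLp_of_weight (hf.comp_smul (inv_pos.2 hε)) ((hA.isSmoothLimit k γ).1.2 j).1.1
      (ae_comp_smul hb (inv_pos.2 hε).ne') (hA.memLp_partial k j γ)⟩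

theorem WeightedApprox.mulMemLp
    (hA : WeightedApprox Ω (fun x => 𝒜.weight χ Dχ Dθ Dϑ (ε⁻¹ • x)) φ Dφ)
    (hε : 0 < ε) {P : Fin d → E d → ℝ} {q : E d → ℝ} (h : HasWeakDiv P q) {K : ℝ}
    (hP : ∀ j, ∀ y, |P j y| ≤ 𝒜.weight χ Dχ Dθ Dϑ y)
    (hq : ∀ᵐ y : E d, |q y| ≤ K * 𝒜.weight χ Dχ Dθ Dϑ y) (k : Fin (d + 1)) (γ : Fin m) :
    MulMemLp Ω (fun j x => ε * P j (ε⁻¹ • x)) (fun x => q (ε⁻¹ • x)) (φ k γ)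
      (fun j => Dφ k j γ) := by
  have h1 := fun j => hA.memLp_mul hε (h.left j) (K := 1)
    (Eventually.of_forall fun y => by simpa using hP j y) k γ
  refine ⟨(hA.memLp_mul hε h.right hq k γ).1, fun j => ?_, fun j => ?_⟩
  · simpa only [mul_assoc] using (h1 j).1.const_mul ε
  · simpa only [mul_assoc] using ((h1 j).2 j).const_mul ε

/-- The gradient contains ∇χ_k(x/ε) φ_k; it is square integrable because |∇χ_k| is bounded by a
multiple of the weight. -/
theorem AuxiliaryFields.isH1Vec_correctorTerm (A : AuxiliaryFields 𝒜 μ κ χ Dχ Dθ Dϑ)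
    (hA : WeightedApprox Ω (fun x => 𝒜.weight χ Dχ Dθ Dϑ (ε⁻¹ • x)) φ Dφ) (hd : 0 < d) (hm : 0 < m)
    (hμ : 0 < μ) (hκ : 0 < κ) (hΩ : Bornology.IsBounded Ω) (hε : 0 < ε) :
    IsH1Vec Ω (correctorTerm ε χ φ) (correctorTermPartial ε χ Dχ φ Dφ) := by
  intro β
  have hX : ∀ k γ, LocL2 (χ k β γ) := fun k γ => (A.isCorrector.1 k β γ).1.locL2
  have hDX : ∀ k j γ, LocL2 (Dχ k j β γ) := fun k j γ => A.isCorrector.locL2 k j β γ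
  have hm1 : ∀ k γ, _ := fun k γ => hA.memLp_mul hε (hX k γ) (K := 1)
    (Eventually.of_forall fun y => by
      simpa using (𝒜.abs_entries_le_weight χ Dχ Dθ Dϑ y).2.2.2.2.1 k β γ) k γ
  have hm2 : ∀ k j γ, _ := fun k j γ => hA.memLp_mul hε (hDX k j γ)
    ((A.isCorrector.ae_bounds hd hm hμ hκ A.admissible Dθ Dϑ).mono fun y hy => hy.2.1 k j β γ) k γ
  refine ⟨(memLp_finsetSum _ fun k _ => memLp_finsetSum _ fun γ _ => (hm1 k γ).1).const_mul ε,
    fun j => ⟨(memLp_finsetSum _ fun k _ => memLp_finsetSum _ fun γ _ =>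
      MemLp.add ?_ ((hm1 k γ).2 j)).const_mul ε, ?_⟩⟩
  · simpa only [mul_assoc] using (hm2 k j γ).1.const_mul ε⁻¹
  · refine HasWeakPartial.const_mul (HasWeakPartial.sum _ fun k => HasWeakPartial.sum _ fun γ =>
        ?_) ε
    exact (((A.isCorrector.1 k β γ).1.2.2 j).2.2.comp_smul (hX k γ) (hDX k j γ) hε).mul hΩ
      ((hX k γ).comp_smul (inv_pos.2 hε)) (((hDX k j γ).comp_smul (inv_pos.2 hε)).const_mul _)
      (hA.isSmoothLimit k γ)

theorem WeightedApprox.memLp_errorFamily {H : E d → ℝ} (hA : WeightedApprox Ω H φ Dφ)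
    (hΩ : IsOpen Ω) {u : Fin m → E d → ℝ} {Du : Fin d → Fin m → E d → ℝ} (hu : IsH1Vec Ω u Du) (i) :
    MemLp (errorFamily Ω ε H φ Dφ u Du i) 2 (volume.restrict Ω) := by
  rcases i with p | p | β | p | p
  · exact (hA.memLp p.1 p.2).indicator
      (hΩ.measurableSet.diff (isOpen_innerRegion hΩ _).measurableSet)
  · exact ((hu p.2).2 p.1).1.sub (hA.isSmoothLimit _ _).1.1
  · exact (hu β).1.sub (hA.isSmoothLimit _ _).1.1
  · exact (hA.memLp_partial _ _ _).const_mul ε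
  · exact (hA.memLp _ _).const_mul ε

theorem l2Norm_errorFamily_le {H : E d → ℝ} (hA : WeightedApprox Ω H φ Dφ)
    (hΩ : IsOpen Ω) (hε : 0 < ε) {u : Fin m → E d → ℝ} {Du : Fin d → Fin m → E d → ℝ}
    (hu : IsH1Vec Ω u Du) :
    l2Norm (volume.restrict Ω) (errorFamily Ω ε H φ Dφ u Du) ≤
      l2Norm (volume.restrict (Ω \ innerRegion Ω (2 * ε)))
          (fun (p : Fin (d + 1) × Fin m) x => H x * φ p.1 p.2 x) +
        l2Norm (volume.restrict Ω)
          (fun (p : Fin d × Fin m) x => Du p.1 p.2 x - φ p.1.succ p.2 x) +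
        l2Norm (volume.restrict Ω) (fun β x => u β x - φ 0 β x) +
        ENNReal.ofReal ε * l2Norm (volume.restrict Ω)
          (fun (p : Fin (d + 1) × Fin d × Fin m) x => H x * Dφ p.1 p.2.1 p.2.2 x) +
        ENNReal.ofReal ε * l2Norm (volume.restrict Ω)
          (fun (p : Fin (d + 1) × Fin m) x => H x * φ p.1 p.2 x) := by
  have hF := fun i => (hA.memLp_errorFamily hΩ hu (ε := ε) i).1
  rw [← l2Norm_indicator (hΩ.measurableSet.diff (isOpen_innerRegion hΩ _).measurableSet)
    sdiff_subset, ← l2Norm_const_mul _ _ hε.le, ← l2Norm_const_mul _ _ hε.le, add_assoc, add_assoc,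
    add_assoc]
  refine (l2Norm_sumElim_le fun p => hF (.inl p)).trans (add_le_add le_rfl ?_)
  refine (l2Norm_sumElim_le fun p => hF (.inr (.inl p))).trans (add_le_add le_rfl ?_)
  refine (l2Norm_sumElim_le fun p => hF (.inr (.inr (.inl p)))).trans (add_le_add le_rfl ?_)
  exact l2Norm_sumElim_le fun p => hF (.inr (.inr (.inr (.inl p))))

/-- The Euclidean length s of the error family dominates each of its members. The bounds involving 1
- η and ∇η need checking only outside Σ_{2ε}, where the first block of the family equals hφ. -/
theorem AuxiliaryFields.ae_pointwiseBounds (A : AuxiliaryFields 𝒜 μ κ χ Dχ Dθ Dϑ) (hd : 0 < d)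
    (hm : 0 < m) (hμ : 0 < μ) (hκ : 0 < κ) (hΩ : IsOpen Ω) (hε : 0 < ε) {Cη : ℝ} (hCη : 0 ≤ Cη)
    {η : E d → ℝ} (hη : IsCutoff Ω ε Cη η) (φ : Fin (d + 1) → Fin m → E d → ℝ)
    (Dφ : Fin (d + 1) → Fin d → Fin m → E d → ℝ) (u : Fin m → E d → ℝ)
    (Du : Fin d → Fin m → E d → ℝ) :
    ∀ᵐ x ∂volume.restrict Ω, PointwiseBounds 𝒜 χ Dχ Dθ Dϑ φ Dφ u Du η ε κ (meanBound d m μ κ)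
      (lowerBound d m μ κ) Cη (𝒜.weight χ Dχ Dθ Dϑ (ε⁻¹ • x))
      (√(∑ i, errorFamily Ω ε (fun x => 𝒜.weight χ Dχ Dθ Dϑ (ε⁻¹ • x)) φ Dφ u Du i x ^ 2)) x := by
  have h := A.admissible
  have hε' := (inv_pos.2 hε).ne'
  have hbd := h.isBdd_rescale hε
  filter_upwards [ae_restrict_mem hΩ.measurableSet,
    ae_restrict_of_ae (ae_comp_smul
      (A.isCorrector.ae_bounds hd hm hμ hκ h Dθ Dϑ) hε'),
    ae_restrict_of_ae (ae_all_iff.2 fun i => ae_all_iff.2 fun j => ae_all_iff.2 fun α =>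
      ae_all_iff.2 fun β => hbd.bounded_a i j α β),
    ae_restrict_of_ae (ae_all_iff.2 fun i => ae_all_iff.2 fun α => ae_all_iff.2 fun β =>
      hbd.bounded_V i α β),
    ae_restrict_of_ae (ae_all_iff.2 fun i => ae_all_iff.2 fun α => ae_all_iff.2 fun β =>
      hbd.bounded_B i α β),
    ae_restrict_of_ae (ae_all_iff.2 fun α => ae_all_iff.2 fun β => hbd.bounded_c α β)]
    with x hx hw ha hV hB hc
  obtain ⟨-, -, -, -, wχ, wb, wE, wϑ⟩ := 𝒜.abs_entries_le_weight χ Dχ Dθ Dϑ (ε⁻¹ • x)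
  set F := errorFamily Ω ε (fun x => 𝒜.weight χ Dχ Dθ Dϑ (ε⁻¹ • x)) φ Dφ u Du with hF
  have hs := abs_le_sqrt_sum_sq (fun i => F i x)
  set s := √(∑ i, F i x ^ 2)
  have hs0 : 0 ≤ s := Real.sqrt_nonneg _
  have hh : 0 ≤ 𝒜.weight χ Dχ Dθ Dϑ (ε⁻¹ • x) := hμ.le.trans hw.1
  have hlayer : x ∉ innerRegion Ω (2 * ε) →
      ∀ k γ, 𝒜.weight χ Dχ Dθ Dϑ (ε⁻¹ • x) * |φ k γ x| ≤ s := fun hx' k γ => by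
    have := hs (.inl (k, γ))
    simp only [hF, errorFamily, Sum.elim_inl] at this
    have hmem : x ∈ Ω \ innerRegion Ω (2 * ε) := ⟨hx, hx'⟩
    rwa [indicator_of_mem hmem, abs_mul, abs_of_nonneg hh] at this
  -- Needed so that one constant bounds b_k, which is an entry of the weight, as well as W_k.
  have hlb : 1 ≤ lowerBound d m μ κ := by
    have := meanBound_nonneg (d := d) (m := m) (μ := μ) hκ
    unfold lowerBound correctorBound
    have : 0 ≤ meanBound d m μ κ / μ + d * m * (κ * (d * m * ((meanBound d m μ κ / μ + 2) / μ))) :=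
        by
      positivity
    linarith
  refine
    { a := ha, V := hV, B := hB, c := hc
      meanFlux := A.isCorrector.abs_integral_flux_le hμ hκ h
      meanLowerFlux := A.isCorrector.abs_integral_lowerFlux_le hμ hκ h
      b := fun k i α γ => (wb k i α γ).trans (le_mul_of_one_le_left hh hlb)
      W := hw.2.2
      corrector := wχ
      fluxCorrector := wE
      partialAux := wϑ
      cutoff_nonneg := hη.nonneg x
      cutoff_le_one := hη.le_one x
      gradient := fun j β => hs (.inr (.inl (j, β)))
      solution := fun β => hs (.inr (.inr (.inl β)))
      approx := fun k γ => ?_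
      approxPartial := fun k j γ => ?_
      approx_layer := fun k γ => ?_
      cutoffPartial := fun k γ j => ?_ }
  · have := hs (.inr (.inr (.inr (.inr (k, γ)))))
    simp only [hF, errorFamily, Sum.elim_inr] at this
    rwa [abs_mul, abs_mul, abs_of_pos hε, abs_of_nonneg hh, ← mul_assoc] at this
  · have := hs (.inr (.inr (.inr (.inl (k, j, γ)))))
    simp only [hF, errorFamily, Sum.elim_inr, Sum.elim_inl] at this
    rwa [abs_mul, abs_mul, abs_of_pos hε, abs_of_nonneg hh, ← mul_assoc] at this
  · by_cases hx' : x ∈ innerRegion Ω (2 * ε)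
    · rw [hη.eq_one x hx', sub_self, zero_mul]
      exact hs0
    · refine (mul_le_of_le_one_left (by positivity) ?_).trans (hlayer hx' k γ)
      linarith [hη.nonneg x]
  · by_cases hx' : x ∈ innerRegion Ω (2 * ε)
    · rw [hη.partialDeriv_eq_zero x hx' j, abs_zero, mul_zero, zero_mul]
      positivity
    · exact mul_le_mul (hη.partialDeriv_le x j) (hlayer hx' k γ) (by positivity) hCη

theorem pairing_oscillating_eq_zero (A : AuxiliaryFields 𝒜 μ κ χ Dχ Dθ Dϑ)
    (hA : WeightedApprox Ω (fun x => 𝒜.weight χ Dχ Dθ Dϑ (ε⁻¹ • x)) φ Dφ) (hd : 0 < d) (hm : 0 < m)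
    (hμ : 0 < μ) (hκ : 0 < κ) (hΩ : IsOpen Ω) (hΩb : Bornology.IsBounded Ω) (hε : 0 < ε)
    {η : E d → ℝ} (hη : IsTest η) (hs : tsupport η ⊆ Ω) :
    (∀ i α, MemLp (fun x => ∑ k, ∑ γ,
      (localized (fun j x => ε * fluxCorrector Dθ k j i α γ (ε⁻¹ • x))
        (fun x => 𝒜.b Dχ k i α γ (ε⁻¹ • x)) (φ k γ) (fun j => Dφ k j γ) η x +
        ε * Dϑ k i α γ (ε⁻¹ • x) * φ k γ x * η x)) 2 (volume.restrict Ω)) ∧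
    (∀ α, MemLp (fun x => ∑ k, ∑ γ, localized (fun j x => ε * Dϑ k j α γ (ε⁻¹ • x))
        (fun x => 𝒜.W Dχ k α γ (ε⁻¹ • x)) (φ k γ) (fun j => Dφ k j γ) η x) 2
        (volume.restrict Ω)) ∧
    ∀ (v : Fin m → E d → ℝ) (Dv : Fin d → Fin m → E d → ℝ), IsH1Vec Ω v Dv →
    pairing Ω (fun i α x => ∑ k, ∑ γ,
      (localized (fun j x => ε * fluxCorrector Dθ k j i α γ (ε⁻¹ • x))
        (fun x => 𝒜.b Dχ k i α γ (ε⁻¹ • x)) (φ k γ) (fun j => Dφ k j γ) η x +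
        ε * Dϑ k i α γ (ε⁻¹ • x) * φ k γ x * η x))
      (fun α x => ∑ k, ∑ γ, localized (fun j x => ε * Dϑ k j α γ (ε⁻¹ • x))
        (fun x => 𝒜.W Dχ k α γ (ε⁻¹ • x)) (φ k γ) (fun j => Dφ k j γ) η x) v Dv = 0 := by
  have hP : ∀ k γ α i, _ := fun k γ α i => hA.mulMemLp hε (A.div_fluxCorrector k i α γ) (K := 1)
    (fun j y => (𝒜.abs_entries_le_weight χ Dχ Dθ Dϑ y).2.2.2.2.2.2.1 k j i α γ)
    (Eventually.of_forall fun y => by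
      simpa using (𝒜.abs_entries_le_weight χ Dχ Dθ Dϑ y).2.2.2.2.2.1 k i α γ) k γ
  have hp : ∀ k γ α, _ := fun k γ α => hA.mulMemLp hε (A.div_partialAux k α γ)
    (fun j y => (𝒜.abs_entries_le_weight χ Dχ Dθ Dϑ y).2.2.2.2.2.2.2 k j α γ)
    ((A.isCorrector.ae_bounds hd hm hμ hκ A.admissible Dθ Dϑ).mono fun y hy => hy.2.2 k α γ) k γ
  have h1 : ∀ k γ i α, MemLp (fun x =>
      localized (fun j x => ε * fluxCorrector Dθ k j i α γ (ε⁻¹ • x))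
        (fun x => 𝒜.b Dχ k i α γ (ε⁻¹ • x)) (φ k γ) (fun j => Dφ k j γ) η x +
        ε * Dϑ k i α γ (ε⁻¹ • x) * φ k γ x * η x) 2 (volume.restrict Ω) := fun k γ i α =>
    ((hP k γ α i).localized_memLp hη).add (hη.memLp_mul ((hp k γ α).left i))
  have h2 : ∀ k γ α, MemLp (fun x => localized (fun j x => ε * Dϑ k j α γ (ε⁻¹ • x))
        (fun x => 𝒜.W Dχ k α γ (ε⁻¹ • x)) (φ k γ) (fun j => Dφ k j γ) η x) 2
        (volume.restrict Ω) := fun k γ α => (hp k γ α).localized_memLp hη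
  have h1' := fun k i α => memLp_finsetSum Finset.univ fun γ _ => h1 k γ i α
  have h2' := fun k α => memLp_finsetSum Finset.univ fun γ _ => h2 k γ α
  refine ⟨fun i α => memLp_finsetSum _ fun k _ => h1' k i α,
    fun α => memLp_finsetSum _ fun k _ => h2' k α, fun v Dv hv => ?_⟩
  have hv1 : ∀ α, MemLp (v α) 2 (volume.restrict Ω) := fun α => (hv α).1
  have hv2 : ∀ i α, MemLp (Dv i α) 2 (volume.restrict Ω) := fun i α => ((hv α).2 i).1
  rw [pairing_sum Finset.univ h1' h2' hv1 hv2]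
  refine Finset.sum_eq_zero fun k _ => ?_
  rw [pairing_sum Finset.univ (fun γ => h1 k γ) (fun γ => h2 k γ) hv1 hv2]
  refine Finset.sum_eq_zero fun γ _ => ?_
  exact pairing_localized_eq_zero hΩ hΩb (fun α i => (A.div_fluxCorrector k i α γ).rescale hε)
    (fun α i j x => by simp only [fluxCorrector]; ring)
    (fun α => (A.div_partialAux k α γ).rescale hε) (hA.isSmoothLimit k γ)
    (fun α i => hP k γ α i) (fun α => hp k γ α) hη hs hv

/-- The constant in the pointwise bounds of the right-hand sides. -/
def errorConst (d m : ℕ) (μ κ lam Cη : ℝ) : ℝ :=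
  residualConst d m (meanBound d m μ κ) κ (lowerBound d m μ κ) Cη + (1 + |lam|) * ((d + 1) * m)

/-- The energy method with test function w. The residuals R, S are the data B_0[u₀,·] - B_ε[u₀,·] -
B_ε[z,·] minus the oscillating functional, which vanishes on H¹(Ω). -/
theorem integral_remainder_sq_le (A : AuxiliaryFields 𝒜 μ κ χ Dχ Dθ Dϑ)
    (hA : WeightedApprox Ω (fun x => 𝒜.weight χ Dχ Dθ Dϑ (ε⁻¹ • x)) φ Dφ) (hd : 0 < d) (hm : 0 < m)
    (hμ : 0 < μ) (hκ : 0 < κ) (hΩ : IsOpen Ω) (hΩb : Bornology.IsBounded Ω) (hε : 0 < ε)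
    {lam : ℝ} (hlam : coercivityThreshold d m μ κ ≤ lam) {Cη : ℝ} (hCη : 0 ≤ Cη)
    {η : E d → ℝ} (hη : IsCutoff Ω ε Cη η) {uε u₀ : Fin m → E d → ℝ}
    {Duε Du₀ : Fin d → Fin m → E d → ℝ} (huε : IsH1Vec Ω uε Duε) (hu₀ : IsH1Vec Ω u₀ Du₀)
    (heq : ∀ v Dv, IsH1Vec Ω v Dv →
      (𝒜.rescale ε).form Ω lam uε Duε v Dv = (𝒜.homogenized Dχ).form Ω lam u₀ Du₀ v Dv) :
    ∃ Dw : Fin d → Fin m → E d → ℝ, IsH1Vec Ω (remainder ε χ uε u₀ φ) Dw ∧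
      ∫ x in Ω, ((∑ i, ∑ α, Dw i α x ^ 2) + ∑ α, remainder ε χ uε u₀ φ α x ^ 2) ≤
      (d + 1) * m * errorConst d m μ κ lam Cη ^ 2 / (μ / 2) ^ 2 *
        ∫ x in Ω, ∑ i, errorFamily Ω ε (fun x => 𝒜.weight χ Dχ Dθ Dϑ (ε⁻¹ • x)) φ Dφ u₀ Du₀ i x ^ 2
            := by
  have hC := A.isH1Vec_correctorTerm hA hd hm hμ hκ hΩb hε
  set z := correctorTerm ε χ φ with hz
  set Dz := correctorTermPartial ε χ Dχ φ Dφ with hDz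
  set Dw : Fin d → Fin m → E d → ℝ := fun j β x => Duε j β x - Du₀ j β x - Dz j β x with hDw
  have hwdef : remainder ε χ uε u₀ φ = fun β x => uε β x - u₀ β x - z β x := rfl
  have hw : IsH1Vec Ω (remainder ε χ uε u₀ φ) Dw := fun β =>
    ⟨((huε β).1.sub (hu₀ β).1).sub (hC β).1, fun j =>
      ⟨(((huε β).2 j).1.sub ((hu₀ β).2 j).1).sub ((hC β).2 j).1,
        (((huε β).2 j).2.sub ((hu₀ β).2 j).2).sub ((hC β).2 j).2⟩⟩
  refine ⟨Dw, hw, ?_⟩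
  have m1 : ∀ {u : Fin m → E d → ℝ} {Du : Fin d → Fin m → E d → ℝ}, IsH1Vec Ω u Du →
      ∀ α, MemLp (u α) 2 (volume.restrict Ω) := fun hu α => (hu α).1
  have m2 : ∀ {u : Fin m → E d → ℝ} {Du : Fin d → Fin m → E d → ℝ}, IsH1Vec Ω u Du →
      ∀ i α, MemLp (Du i α) 2 (volume.restrict Ω) := fun hu i α => ((hu α).2 i).1
  have bε := A.admissible.isBdd_rescale hε
  have b₀ := A.isCorrector.isBdd_homogenized hμ hκ A.admissible
  have fε : ∀ {u : Fin m → E d → ℝ} {Du : Fin d → Fin m → E d → ℝ}, IsH1Vec Ω u Du → _ :=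
    fun hu => bε.fluxOf_memLp (m1 hu) (m2 hu)
  have gε : ∀ {u : Fin m → E d → ℝ} {Du : Fin d → Fin m → E d → ℝ}, IsH1Vec Ω u Du → _ :=
    fun hu => bε.lowOf_memLp lam (m1 hu) (m2 hu)
  have f₀ := b₀.fluxOf_memLp (m1 hu₀) (m2 hu₀)
  have g₀ := b₀.lowOf_memLp lam (m1 hu₀) (m2 hu₀)
  obtain ⟨hI, hJ, hosc⟩ := pairing_oscillating_eq_zero A hA hd hm hμ hκ hΩ hΩb hε hη.isTest
    hη.tsupport_subset
  have hF : ∀ i, MemLp (errorFamily Ω ε (fun x => 𝒜.weight χ Dχ Dθ Dϑ (ε⁻¹ • x)) φ Dφ u₀ Du₀ i) 2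
      (volume.restrict Ω) := hA.memLp_errorFamily hΩ hu₀
  have hbounds := A.ae_pointwiseBounds hd hm hμ hκ hΩ hε hCη hη φ Dφ u₀ Du₀
  have hlb : 0 ≤ lowerBound d m μ κ := by
    have := meanBound_nonneg (d := d) (m := m) (μ := μ) hκ
    unfold lowerBound correctorBound
    positivity
  have key := energy_bound (half_pos hμ) (fε hw) (gε hw)
    (fun i α => (((f₀ i α).sub (fε hu₀ i α)).sub (fε hC i α)).sub (hI i α))
    (fun α => (((g₀ α).sub (gε hu₀ α)).sub (gε hC α)).sub (hJ α)) (m1 hw) (m2 hw)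
    (memLp_sqrt_sum_sq hF) (K := errorConst d m μ κ lam Cη) ?_ ?_ ?_ ?_
  · refine key.trans (le_of_eq ?_)
    congr 1
    refine integral_congr_ae (Eventually.of_forall fun x => ?_)
    exact Real.sq_sqrt (Finset.sum_nonneg fun _ _ => sq_nonneg _)
  · filter_upwards [hbounds, ae_restrict_of_ae (ae_comp_smul A.admissible.elliptic
      (inv_pos.2 hε).ne')] with x hb hell
    exact coercive_pointwise hm hμ hlam hb.V hb.B hb.c (fun α => remainder ε χ uε u₀ φ α x)
      (fun i α => Dw i α x) (hell _).1
  · filter_upwards [hbounds] with x hb i α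
    have h1 := hb.abs_flux_residual_le hε hκ.le hlb i α
    have h2 := abs_sum_sum_mul_cutoff_le (η := η) hε (fun k γ => hb.partialAux k i α γ)
      hb.cutoff_nonneg hb.cutoff_le_one hb.approx
    have h3 : 0 ≤ |lam| * ((d + 1) * m) * √(∑ i, errorFamily Ω ε
      (fun x => 𝒜.weight χ Dχ Dθ Dϑ (ε⁻¹ • x)) φ Dφ u₀ Du₀ i x ^ 2) := by positivity
    simp only [Pi.sub_apply, Finset.sum_add_distrib, ← sub_sub]
    refine (abs_sub _ _).trans ((add_le_add h1 h2).trans ?_)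
    unfold errorConst
    linarith
  · filter_upwards [hbounds] with x hb α
    have h1 := hb.abs_lower_residual_le hε hκ.le hlb lam α
    have h3 : 0 ≤ ((d + 1) * m : ℝ) * √(∑ i, errorFamily Ω ε
      (fun x => 𝒜.weight χ Dχ Dθ Dϑ (ε⁻¹ • x)) φ Dφ u₀ Du₀ i x ^ 2) := by positivity
    refine h1.trans ?_
    unfold errorConst
    linarith
  · have e1 : (𝒜.rescale ε).fluxOf (remainder ε χ uε u₀ φ) Dw = fun i α x =>
        (𝒜.rescale ε).fluxOf uε Duε i α x - (𝒜.rescale ε).fluxOf u₀ Du₀ i α x -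
          (𝒜.rescale ε).fluxOf z Dz i α x := by
      funext i α x
      exact Coefficients.fluxOf_sub_sub ..
    have e2 : (𝒜.rescale ε).lowOf lam (remainder ε χ uε u₀ φ) Dw = fun α x =>
        (𝒜.rescale ε).lowOf lam uε Duε α x - (𝒜.rescale ε).lowOf lam u₀ Du₀ α x -
          (𝒜.rescale ε).lowOf lam z Dz α x := by
      funext α x
      exact Coefficients.lowOf_sub_sub ..
    -- Here the equation enters, tested with w itself, which is allowed because w has been shown to
    -- lie in H¹(Ω).
    have hq := heq _ _ hw
    rw [Coefficients.form_eq_pairing, Coefficients.form_eq_pairing] at hq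
    rw [e1, e2]
    refine (pairing_sub (fun i α => (fε huε i α).sub (fε hu₀ i α)) (fε hC)
      (fun α => (gε huε α).sub (gε hu₀ α)) (gε hC) (m1 hw) (m2 hw)).trans ?_
    refine Eq.trans ?_ (pairing_sub
      (fun i α => ((f₀ i α).sub (fε hu₀ i α)).sub (fε hC i α)) hI
      (fun α => ((g₀ α).sub (gε hu₀ α)).sub (gε hC α)) hJ (m1 hw) (m2 hw)).symm
    rw [hosc _ _ hw, sub_zero]
    refine Eq.trans ?_ (pairing_sub (fun i α => (f₀ i α).sub (fε hu₀ i α)) (fε hC)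
      (fun α => (g₀ α).sub (gε hu₀ α)) (gε hC) (m1 hw) (m2 hw)).symm
    refine congrArg₂ _ ?_ rfl
    refine (pairing_sub (fε huε) (fε hu₀) (gε huε) (gε hu₀) (m1 hw) (m2 hw)).trans ?_
    refine Eq.trans ?_ (pairing_sub f₀ (fε hu₀) g₀ (gε hu₀) (m1 hw) (m2 hw)).symm
    rw [hq]

theorem WeightedApprox.of_l2Norm_ne_top {H : E d → ℝ} (hH : LocL2 H)
    (hlim : ∀ k γ, IsSmoothLimit Ω (φ k γ) (fun j => Dφ k j γ))
    (h : l2Norm (volume.restrict Ω) (fun (p : Fin (d + 1) × Fin m) x => H x * φ p.1 p.2 x) ≠ ⊤)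
    (h' : l2Norm (volume.restrict Ω)
      (fun (p : Fin (d + 1) × Fin d × Fin m) x => H x * Dφ p.1 p.2.1 p.2.2 x) ≠ ⊤) :
    WeightedApprox Ω H φ Dφ := by
  have hH' := hH.aestronglyMeasurable.restrict (s := Ω)
  have h1 : ∀ p : Fin (d + 1) × Fin m,
      AEStronglyMeasurable (fun x => H x * φ p.1 p.2 x) (volume.restrict Ω) :=
    fun p => hH'.mul (hlim p.1 p.2).1.1.1
  have h2 : ∀ p : Fin (d + 1) × Fin d × Fin m,
      AEStronglyMeasurable (fun x => H x * Dφ p.1 p.2.1 p.2.2 x) (volume.restrict Ω) :=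
    fun p => hH'.mul ((hlim p.1 p.2.2).1.2 p.2.1).1.1
  exact ⟨hlim, fun k γ => memLp_of_l2Norm_ne_top h1 h (k, γ),
    fun k j γ => memLp_of_l2Norm_ne_top h2 h' (k, j, γ)⟩

theorem h1Norm_remainder_le (A : AuxiliaryFields 𝒜 μ κ χ Dχ Dθ Dϑ) (hd : 0 < d) (hm : 0 < m)
    (hμ : 0 < μ) (hκ : 0 < κ) (hΩ : IsOpen Ω) (hΩb : Bornology.IsBounded Ω) (hε : 0 < ε)
    {lam : ℝ} (hlam : coercivityThreshold d m μ κ ≤ lam) {Cη : ℝ} (hCη : 0 ≤ Cη)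
    {η : E d → ℝ} (hη : IsCutoff Ω ε Cη η) {uε u₀ : Fin m → E d → ℝ}
    {Duε Du₀ : Fin d → Fin m → E d → ℝ} (huε : IsH1Vec Ω uε Duε) (hu₀ : IsH1Vec Ω u₀ Du₀)
    (heq : ∀ v Dv, IsH1Vec Ω v Dv →
      (𝒜.rescale ε).form Ω lam uε Duε v Dv = (𝒜.homogenized Dχ).form Ω lam u₀ Du₀ v Dv)
    (hlim : ∀ k γ, IsSmoothLimit Ω (φ k γ) (fun j => Dφ k j γ)) {K : ℝ} (hK : 0 ≤ K)
    (hK2 : K ^ 2 = (d + 1) * m * errorConst d m μ κ lam Cη ^ 2 / (μ / 2) ^ 2) :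
    h1Norm Ω (remainder ε χ uε u₀ φ) ≤
      ((1 + K.toNNReal : ℝ≥0) : ℝ≥0∞) *
        (l2Norm (volume.restrict (Ω \ innerRegion Ω (2 * ε)))
            (fun (p : Fin (d + 1) × Fin m) x =>
              𝒜.weight χ Dχ Dθ Dϑ (ε⁻¹ • x) * φ p.1 p.2 x)
        + l2Norm (volume.restrict Ω)
            (fun (p : Fin d × Fin m) x => Du₀ p.1 p.2 x - φ p.1.succ p.2 x)
        + l2Norm (volume.restrict Ω) (fun β x => u₀ β x - φ 0 β x)
        + ENNReal.ofReal ε * l2Norm (volume.restrict Ω)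
            (fun (p : Fin (d + 1) × Fin d × Fin m) x =>
              𝒜.weight χ Dχ Dθ Dϑ (ε⁻¹ • x) * Dφ p.1 p.2.1 p.2.2 x)
        + ENNReal.ofReal ε * l2Norm (volume.restrict Ω)
            (fun (p : Fin (d + 1) × Fin m) x =>
              𝒜.weight χ Dχ Dθ Dϑ (ε⁻¹ • x) * φ p.1 p.2 x)) := by
  have hH : LocL2 (fun x => 𝒜.weight χ Dχ Dθ Dϑ (ε⁻¹ • x)) :=
    A.locL2_weight.comp_smul (inv_pos.2 hε)
  have hε0 : ENNReal.ofReal ε ≠ 0 := (ENNReal.ofReal_pos.2 hε).ne'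
  -- The summand 1 keeps the constant positive, so that an infinite norm makes the right side
  -- infinite (0 · ∞ = 0 in `ℝ≥0∞`).
  have hC0 : ((1 + K.toNNReal : ℝ≥0) : ℝ≥0∞) ≠ 0 := by
    rw [ENNReal.coe_ne_zero]
    positivity
  set N₄ := l2Norm (volume.restrict Ω) (fun (p : Fin (d + 1) × Fin d × Fin m) x =>
    𝒜.weight χ Dχ Dθ Dϑ (ε⁻¹ • x) * Dφ p.1 p.2.1 p.2.2 x) with hN₄
  set N₅ := l2Norm (volume.restrict Ω) (fun (p : Fin (d + 1) × Fin m) x =>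
    𝒜.weight χ Dχ Dθ Dϑ (ε⁻¹ • x) * φ p.1 p.2 x) with hN₅
  by_cases h4 : N₄ = ⊤
  · rw [h4, ENNReal.mul_top hε0, add_top, top_add, ENNReal.mul_top hC0]
    exact le_top
  by_cases h5 : N₅ = ⊤
  · rw [h5, ENNReal.mul_top hε0, add_top, ENNReal.mul_top hC0]
    exact le_top
  have hA : WeightedApprox Ω (fun x => 𝒜.weight χ Dχ Dθ Dϑ (ε⁻¹ • x)) φ Dφ :=
    WeightedApprox.of_l2Norm_ne_top hH hlim h5 h4
  obtain ⟨Dw, hw, hint⟩ := integral_remainder_sq_le A hA hd hm hμ hκ hΩ hΩb hε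
    hlam hCη hη huε hu₀ heq
  rw [← hK2] at hint
  have hF := fun i => hA.memLp_errorFamily hΩ hu₀ (ε := ε) i
  refine (h1Norm_le_of_integral_le hw hF hK hint).trans ?_
  refine mul_le_mul' ?_ (l2Norm_errorFamily_le hA hΩ hε hu₀)
  exact ENNReal.coe_le_coe.2 le_add_self

end

end NeumannHomogenization

end

/-! ### The error estimate -/

open NeumannHomogenization in
theorem lemma4p4 (d m : ℕ) (hd : 3 ≤ d) (hm : 1 ≤ m) (μ κ : ℝ) (hμ : 0 < μ) (hκ : 0 < κ) :
    ∃ lam₀ : ℝ, 0 ≤ lam₀ ∧ ∀ lam : ℝ, lam₀ ≤ lam →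
    ∀ Ω : Set (E d), IsBoundedLipschitzDomain Ω →
    ∃ C : ℝ≥0, ∀ 𝒜 : Coefficients d m, 𝒜.IsAdmissible μ κ →
    ∀ (χ : Fin (d + 1) → Fin m → Fin m → E d → ℝ)
      (Dχ : Fin (d + 1) → Fin d → Fin m → Fin m → E d → ℝ),
      𝒜.IsCorrector χ Dχ →
    ∀ (θ : Fin (d + 1) → Fin d → Fin m → Fin m → E d → ℝ)
      (Dθ : Fin (d + 1) → Fin d → Fin d → Fin m → Fin m → E d → ℝ),
      (∀ k i α γ, IsPeriodicPoissonSolution (𝒜.b Dχ k i α γ) (θ k i α γ)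
        (fun j => Dθ k i j α γ)) →
    ∀ (ϑ : Fin (d + 1) → Fin m → Fin m → E d → ℝ)
      (Dϑ : Fin (d + 1) → Fin d → Fin m → Fin m → E d → ℝ),
      (∀ k α γ, IsPeriodicPoissonSolution (𝒜.W Dχ k α γ) (ϑ k α γ)
        (fun i => Dϑ k i α γ)) →
    ∀ ε : ℝ, 0 < ε →
    ∀ (uε : Fin m → E d → ℝ) (Duε : Fin d → Fin m → E d → ℝ)
      (u₀ : Fin m → E d → ℝ) (Du₀ : Fin d → Fin m → E d → ℝ),
      IsH1Vec Ω uε Duε → IsH1Vec Ω u₀ Du₀ →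
      (∀ (v : Fin m → E d → ℝ) (Dv : Fin d → Fin m → E d → ℝ), IsH1Vec Ω v Dv →
        (𝒜.rescale ε).form Ω lam uε Duε v Dv = (𝒜.homogenized Dχ).form Ω lam u₀ Du₀ v Dv) →
    ∀ (φ : Fin (d + 1) → Fin m → E d → ℝ) (Dφ : Fin (d + 1) → Fin d → Fin m → E d → ℝ),
      (∀ k, IsH1Vec Set.univ (φ k) (Dφ k)) →
    ∀ (trφ : Fin (d + 1) → Fin m → E d → ℝ)
      (trDϑ : Fin (d + 1) → Fin d → Fin m → Fin m → E d → ℝ),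
      (∀ k γ, HasTrace Ω (φ k γ) (trφ k γ)) →
      (∀ k i α γ, HasTrace Ω (fun x => Dϑ k i α γ (ε⁻¹ • x)) (trDϑ k i α γ)) →
    h1Norm Ω (remainder ε χ uε u₀ φ) ≤
      C * (l2Norm (volume.restrict (Ω \ innerRegion Ω (2 * ε)))
            (fun (p : Fin (d + 1) × Fin m) x =>
              𝒜.weight χ Dχ Dθ Dϑ (ε⁻¹ • x) * φ p.1 p.2 x)
        + l2Norm (volume.restrict Ω)
            (fun (p : Fin d × Fin m) x => Du₀ p.1 p.2 x - φ p.1.succ p.2 x)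
        + l2Norm (volume.restrict Ω) (fun β x => u₀ β x - φ 0 β x)
        + ENNReal.ofReal ε * l2Norm (volume.restrict Ω)
            (fun (p : Fin (d + 1) × Fin d × Fin m) x =>
              𝒜.weight χ Dχ Dθ Dϑ (ε⁻¹ • x) * Dφ p.1 p.2.1 p.2.2 x)
        + ENNReal.ofReal ε * l2Norm (volume.restrict Ω)
            (fun (p : Fin (d + 1) × Fin m) x =>
              𝒜.weight χ Dχ Dθ Dϑ (ε⁻¹ • x) * φ p.1 p.2 x))
      + C * (ENNReal.ofReal ε * l2Norm (surfaceMeasure Ω)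
            (fun (p : Fin (d + 1) × Fin m) x =>
              (∑ k, ∑ i, ∑ α, ∑ γ, |trDϑ k i α γ x|) * trφ p.1 p.2 x)) := by
  obtain ⟨Cη, hCη, hcut⟩ := exists_cutoff d
  refine ⟨coercivityThreshold d m μ κ, by unfold coercivityThreshold; positivity,
    fun lam hlam Ω hΩ => ⟨1 + (√((d + 1) * m * errorConst d m μ κ lam Cη ^ 2 /
      (μ / 2) ^ 2)).toNNReal, ?_⟩⟩
  intro 𝒜 h χ Dχ hχ θ Dθ hθ ϑ Dϑ hϑ ε hε uε Duε u₀ Du₀ huε hu₀ heq φ Dφ hφ trφ _ htr _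
  obtain ⟨η, hη⟩ := hcut Ω hΩ.isOpen hΩ.isBounded ε hε
  -- The bound already holds without the surface norm, so that nonnegative term is simply added.
  exact le_add_right (h1Norm_remainder_le (AuxiliaryFields.of_poisson h hχ hθ hϑ) (by omega)
    (by omega) hμ hκ hΩ.isOpen hΩ.isBounded hε hlam hCη hη huε hu₀ heq (fun k γ =>
      (htr k γ).isSmoothLimit hΩ.isOpen (hφ k γ)) (Real.sqrt_nonneg _)
      (Real.sq_sqrt (by positivity)))
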